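/- **Setting.** Let $(\mathcal C,d,m,\pi)$ be a finite-dimensional, non-negatively graded, unital dg Frobenius algebra over $\mathbb R$ with pairing of degree $-3$. That is, $\mathcal C=\bigoplus_{i\ge 0}\mathcal C^i$ is a unital graded-commutative dg algebra with a non-degenerate graded-symmetric pairing $\pi$ such that $\pi(a,b)\ne0\Rightarrow|a|+|b|=3$, $\pi(da,b)+(-1)^{|a|}\pi(a,db)=0$ and $\pi(a,bc)=\pi(ab,c)$. Put $B_i=\dim H^i(\mathcal C)$ and assume $B_0=1$ and $B_1=0$ (so $B_3=1$, $B_2=0$). Let $\mathfrak g=\mathfrak{su}(2)$ with an invariant inner product $\pi_{\mathfrak g}$ and an orthonormal basis $T_1,T_2,T_3$, and put $f_{abc}=\pi_{\mathfrak g}(T_a,[T_b,T_c])$ (for the normalization $\pi_{\mathfrak g}(x,y)=-2\,\mathrm{tr}(xy)$ and a suitably oriented basis, $f_{abc}=\epsilon_{abc}$). Let $\{e_I\}$ be a homogeneous basis of $\mathcal C$. Let $\mathrm{Fun}(\mathcal F)$ be the free graded-commutative algebra on the coordinates $\omega^{Ia}$ of $\mathcal F=\mathfrak g\otimes\mathcal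 C[1]$, of ghost number $1-|e_I|$, and let $S=\frac12\pi(\omega,d\omega)+\frac16\pi(\omega,l(\omega,\omega))$ with $\omega=\sum_{I,a} T_a e_I\,\omega^{Ia}$ and $l(X\otimes a,Y\otimes b)=[X,Y]\otimes ab$; explicitly $$S=\tfrac12\sum_{I,J,a}(-1)^{|e_I|+1}\pi(e_I,de_J)\,\omega^{Ia}\omega^{Ja}+\tfrac16\sum_{I,J,K,a,b,c}(-1)^{|e_J|(|e_K|+1)}f_{abc}\,\pi(e_I,e_Je_K)\,\omega^{Ia}\omega^{Jb}\omega^{Kc}.$$ **Relaxed induction data.** These are pairs $(\iota,\hat K)$, where $\iota:H^\bullet(\mathcal C)\to\mathcal C$ is a degree-preserving linear choice of cocycle representatives ($[\iota(x)]=x$) and $\hat K:\mathcal C^\bullet\to\mathcal C^{\bullet-1}$ is linear with $$d\hat K+\hat Kd=\mathrm{id}-\iota\iota^T,\qquad \pi(\hat Ka,b)=(-1)^{|a|}\pi(a,\hat Kb),\qquad \hat K\iota=0,$$ $\iota^T$ being the transpose of $\iota$ with respect to $\pi$ and the induced pairing $\pi'(x,y)=\pi(\iota x,\iota y)$. The data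 are called *strict* if moreover $\hat K^2=0$. **Effective action.** Write $\omega=\iota(\alpha)+\omega''$ with $\omega''$ in $\mathfrak g\otimes(\mathrm{im}\,\iota)^\perp[1]$, and put $S_0(\omega'')=\frac12\pi(\omega'',d\omega'')$. The (relaxed) effective action is defined by the perturbation series $$\mathrm{Ind}_{\iota,\hat K}(S)(\alpha)=\hbar\log\Big(e^{-\frac{\hbar}{2}\pi^{-1}(\frac{\partial}{\partial\omega''},\hat K\frac{\partial}{\partial\omega''})}\Big|_{\omega''=0}\,e^{(S(\iota(\alpha)+\omega'')-S_0(\omega''))/\hbar}\Big).$$ Here $\pi^{-1}(\partial,\hat K\partial)=\sum_{I,J,M,a}(\pi^{-1})^{IM}\hat K^J{}_I\,\frac{\partial}{\partial\omega^{Ja}}\frac{\partial}{\partial\omega^{Ma}}$ with left derivatives, where $\hat Ke_I=\sum_J\hat K^J{}_Ie_J$ and $(\pi^{-1})^{IM}$ is the inverse of the matrix $\pi(e_I,e_J)$. The series is expanded by the number $V$ of factors $1/\hbar$ (vertices) and the number $E$ of factors $\hbar$ (edges), and the logarithm is taken in this double power series before collecting powers of $\hbar$. Let $\alpha_{(0)}^a,\alpha_{(3)}^a$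 be the coordinates (of ghost number $1$ and $-2$) on $\mathcal F'=\mathfrak g\otimes H^\bullet(\mathcal C)[1]$ with respect to $e_{(0)}=[1]\in H^0(\mathcal C)$ and the class $e_{(3)}\in H^3(\mathcal C)$ with $\pi'(e_{(0)},e_{(3)})=1$, and put $$W^{003}_{\mathrm{prod}}=\tfrac12\,\pi_{\mathfrak g}(\alpha_{(3)},[\alpha_{(0)},\alpha_{(0)}])=\tfrac12\sum_{a,b,c}f_{abc}\,\alpha_{(0)}^a\alpha_{(0)}^b\alpha_{(3)}^c .$$ **Proposition.** For all relaxed induction data, $\mathrm{Ind}_{\iota,\hat K}(S)$ is a well-defined element of $\mathrm{Fun}(\mathcal F')[[\hbar]]$ (there are no negative powers of $\hbar$, and for each power of $\hbar$ only finitely many pairs $(V,E)$ contribute), and it has the form $$\mathrm{Ind}_{\iota,\hat K}(S)(\alpha)=A(\hbar)\,W^{003}_{\mathrm{prod}}(\alpha)+B(\hbar),$$ $$A(\hbar)=1+\hbar A^{(1)}+\hbar^2A^{(2)}+\cdots,\qquad B(\hbar)=\hbar^2B^{(2)}+\hbar^3B^{(3)}+\cdots$$ with $A,B\in\mathbb R[[\hbar]]$.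 The number $$F^{(2)}=3A^{(1)}+B^{(2)}$$ is invariant under deformations of the relaxed induction data; indeed it is the same for all relaxed induction data $(\iota,\hat K)$. It is the two-loop part of the strict invariant: for all strict induction data $(\iota,K)$ one has $\mathrm{Ind}_{\iota,K}(S)=W^{003}_{\mathrm{prod}}+F(\hbar)$ with $F(\hbar)=\hbar^2F^{(2)}+O(\hbar^3)\in\mathbb R[[\hbar]]$, and the coefficient $F^{(2)}$ here is the number $3A^{(1)}+B^{(2)}$ above. -/

import Mathlib

open scoped TensorProduct

noncomputable section

namespace AbstractCS

/-! ### Super-commutative polynomial functions -/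

section SuperPoly

variable {X Y : Type*}

/-- Polynomial functions on a graded vector space with linear coordinates `x : X` of ghost number
`gh x`: the free graded-commutative real algebra on `X`, i.e. polynomials in the coordinates of
even ghost number tensored with the exterior algebra on the coordinates of odd ghost number. -/
abbrev SuperPoly (gh : X → ℤ) : Type _ :=
  MvPolynomial {x : X // Even (gh x)} ℝ ⊗[ℝ] ExteriorAlgebra ℝ ({x : X // ¬ Even (gh x)} →₀ ℝ)

/-- The coordinate function `x`. -/
def SuperPoly.coord (gh : X → ℤ) (x : X) : SuperPoly gh :=
  if h : Even (gh x) then MvPolynomial.X ⟨x, h⟩ ⊗ₜ[ℝ] 1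
  else 1 ⊗ₜ[ℝ] ExteriorAlgebra.ι ℝ (Finsupp.single ⟨x, h⟩ 1)

/-- The left partial derivative `∂/∂x`: the usual derivative if `x` is even, and the contraction
(the left anti-derivation dual to `x`) if `x` is odd. -/
def SuperPoly.pderiv (gh : X → ℤ) (x : X) : SuperPoly gh →ₗ[ℝ] SuperPoly gh :=
  if h : Even (gh x) then
    TensorProduct.map (MvPolynomial.pderiv (R := ℝ) (⟨x, h⟩ : {x : X // Even (gh x)})).toLinearMap
      LinearMap.id
  else
    TensorProduct.map LinearMap.id
      (CliffordAlgebra.contractLeft (Q := (0 : QuadraticForm ℝ ({x : X // ¬ Even (gh x)} →₀ ℝ)))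
        (Finsupp.lapply ⟨x, h⟩))

/-- The pull-back of functions along a linear map that preserves the grading: the algebra
homomorphism with `x ↦ ∑ y, M x y • y`. -/
def SuperPoly.linearSubst [Fintype Y] (ghX : X → ℤ) (ghY : Y → ℤ) (M : X → Y → ℝ) :
    SuperPoly ghX →ₐ[ℝ] SuperPoly ghY :=
  Algebra.TensorProduct.map
    (MvPolynomial.aeval fun x : {x : X // Even (ghX x)} =>
      ∑ y : {y : Y // Even (ghY y)}, MvPolynomial.C (M x.1 y.1) * MvPolynomial.X y)
    (ExteriorAlgebra.map
      (Finsupp.linearCombination ℝ fun x : {x : X // ¬ Even (ghX x)} =>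
        ∑ y : {y : Y // ¬ Even (ghY y)}, Finsupp.single y (M x.1 y.1)))

end SuperPoly

/-- The formal logarithm `∑_{k ≥ 1} (-1)^(k+1)/k • (Z - 1)^k` of a power series `Z` with constant
coefficient `1` (the coefficient of order `n` only receives contributions of `k ≤ n`). -/
def formalLog {R : Type*} [Ring R] [Algebra ℝ R] (Z : PowerSeries R) : PowerSeries R :=
  PowerSeries.mk fun n =>
    ∑ k ∈ Finset.Icc 1 n, ((-1 : ℝ) ^ (k + 1) / k) • PowerSeries.coeff n ((Z - 1) ^ k)

/-! ### dg Frobenius algebras -/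

/-- A unital differential graded-commutative algebra, graded by `ℕ`, with a non-degenerate graded
symmetric pairing of degree `-3` that is compatible with the differential and the product. -/
structure DGFrobenius {C : Type*} [Ring C] [Algebra ℝ C] (𝒜 : ℕ → Submodule ℝ C)
    [GradedAlgebra 𝒜] where
  d : C →ₗ[ℝ] C
  d_mem : ∀ i a, a ∈ 𝒜 i → d a ∈ 𝒜 (i + 1)
  d_d : ∀ a, d (d a) = 0
  mul_comm' : ∀ i j a b, a ∈ 𝒜 i → b ∈ 𝒜 j → a * b = (-1 : ℝ) ^ (i * j) • (b * a)
  leibniz : ∀ i a b, a ∈ 𝒜 i → d (a * b) = d a * b + (-1 : ℝ) ^ i • (a * d b)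
  π : C →ₗ[ℝ] C →ₗ[ℝ] ℝ
  π_degree : ∀ i j a b, a ∈ 𝒜 i → b ∈ 𝒜 j → i + j ≠ 3 → π a b = 0
  π_symm : ∀ i j a b, a ∈ 𝒜 i → b ∈ 𝒜 j → π a b = (-1 : ℝ) ^ (i * j) * π b a
  π_nondeg : ∀ a, (∀ b, π a b = 0) → a = 0
  π_d : ∀ i a b, a ∈ 𝒜 i → π (d a) b + (-1 : ℝ) ^ i * π a (d b) = 0
  π_mul : ∀ a b c, π a (b * c) = π (a * b) c

/-- A basis consisting of homogeneous elements. -/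
structure HomogeneousBasis {M : Type*} [AddCommGroup M] [Module ℝ M] (𝒢 : ℕ → Submodule ℝ M)
    (I : Type*) where
  basis : Module.Basis I ℝ M
  deg : I → ℕ
  mem : ∀ i, basis i ∈ 𝒢 (deg i)

/-- Ghost numbers of the coordinates on `𝔤 ⊗ M[1]` for a basis of `M` with degrees `deg` and a
basis of `𝔤` indexed by `τ`: `gh (ω^{Ia}) = 1 - |e_I|`. -/
def ghost {I : Type*} (deg : I → ℕ) (τ : Type*) : I × τ → ℤ := fun x => 1 - (deg x.1 : ℤ)

section

variable {C : Type*} [Ring C] [Algebra ℝ C] {𝒜 : ℕ → Submodule ℝ C} [GradedAlgebra 𝒜]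

namespace DGFrobenius

variable (D : DGFrobenius 𝒜)

theorem d_one : D.d 1 = 0 := by
  have h := D.leibniz 0 1 1 SetLike.GradedOne.one_mem
  simpa using h

/-- The cohomology `ker d / im d`. -/
abbrev Cohomology : Type _ :=
  LinearMap.ker D.d ⧸ (LinearMap.range D.d).submoduleOf (LinearMap.ker D.d)

/-- The cohomology class of a cocycle. -/
def cls (a : C) (ha : D.d a = 0) : D.Cohomology :=
  Submodule.Quotient.mk ⟨a, LinearMap.mem_ker.mpr ha⟩

/-- The degree `i` part of cohomology: the classes of cocycles of degree `i`. -/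
def cohomologyDeg (i : ℕ) : Submodule ℝ D.Cohomology :=
  ((𝒜 i).comap (LinearMap.ker D.d).subtype).map
    ((LinearMap.range D.d).submoduleOf (LinearMap.ker D.d)).mkQ

/-- The Betti number `B_i`. -/
def betti (i : ℕ) : ℕ := Module.finrank ℝ (D.cohomologyDeg i)

theorem cls_mem {i : ℕ} {a : C} (ha : D.d a = 0) (hi : a ∈ 𝒜 i) :
    D.cls a ha ∈ D.cohomologyDeg i :=
  ⟨⟨a, LinearMap.mem_ker.mpr ha⟩, hi, rfl⟩

/-- Relaxed induction data `(ι, K)`: a degree-preserving choice `ι` of representatives of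
cohomology classes, and a chain homotopy `K` of degree `-1` with
`d K + K d = id - ι ιᵀ`, symmetric with respect to the pairing, and with `K ι = 0`.
Here `x = ιᵀ a` is characterised by `π' (x, y) = π (a, ι y)` for all `y`, with
`π' (x, y) = π (ι x, ι y)` the induced pairing on cohomology. -/
structure RelaxedInductionData where
  ι : D.Cohomology →ₗ[ℝ] C
  ι_mem : ∀ i x, x ∈ D.cohomologyDeg i → ι x ∈ 𝒜 i
  d_ι : ∀ x, D.d (ι x) = 0
  cls_ι : ∀ x, D.cls (ι x) (d_ι x) = x
  K : C →ₗ[ℝ] C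
  K_mem : ∀ i a, a ∈ 𝒜 (i + 1) → K a ∈ 𝒜 i
  K_mem_zero : ∀ a, a ∈ 𝒜 0 → K a = 0
  homotopy : ∀ a, ∃ x, D.d (K a) + K (D.d a) = a - ι x ∧
    ∀ y, D.π (ι x) (ι y) = D.π a (ι y)
  K_symm : ∀ i a b, a ∈ 𝒜 i → D.π (K a) b = (-1 : ℝ) ^ i * D.π a (K b)
  K_ι : ∀ x, K (ι x) = 0

/-- The induction data are strict if `K² = 0`. -/
def RelaxedInductionData.IsStrict {D : DGFrobenius 𝒜} (R : D.RelaxedInductionData) : Prop :=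
  ∀ a, R.K (R.K a) = 0

/-- A Darboux basis of cohomology when `B_0 = B_3 = 1` and `B_1 = B_2 = 0`: the class
`e_(0) = [1]` of the unit and the class `e_(3) = [v]` in degree three with `π (1, v) = 1`. -/
structure DarbouxBasis where
  basis : Module.Basis (Fin 2) ℝ D.Cohomology
  v : C
  v_mem : v ∈ 𝒜 3
  d_v : D.d v = 0
  π_one_v : D.π 1 v = 1
  basis_zero : basis 0 = D.cls 1 D.d_one
  basis_one : basis 1 = D.cls v d_v

/-- The Darboux basis as a homogeneous basis of cohomology, in degrees `0` and `3`. -/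
def DarbouxBasis.toHomogeneous {D : DGFrobenius 𝒜} (h : D.DarbouxBasis) :
    HomogeneousBasis D.cohomologyDeg (Fin 2) where
  basis := h.basis
  deg := ![0, 3]
  mem := by
    intro i
    fin_cases i
    · simpa [h.basis_zero] using D.cls_mem D.d_one SetLike.GradedOne.one_mem
    · simpa [h.basis_one] using D.cls_mem h.d_v h.v_mem

/-! ### The abstract Chern-Simons action and the effective action -/

variable {I τ L : Type*} [Fintype I] [DecidableEq I] [Fintype τ] [LieRing L] [LieAlgebra ℝ L]
  (e : HomogeneousBasis 𝒜 I)

/-- The coordinate `ω^{Ia}` on the space of fields `𝔤 ⊗ C[1]`. -/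
def field (τ : Type*) (e : HomogeneousBasis 𝒜 I) (i : I) (a : τ) :
    SuperPoly (ghost e.deg τ) :=
  SuperPoly.coord (ghost e.deg τ) (i, a)

/-- The structure constants `f_{abc} = κ (T_a, [T_b, T_c])`. -/
def structureConst (κ : LinearMap.BilinForm ℝ L) (T : Module.Basis τ ℝ L) (a b c : τ) : ℝ :=
  κ (T a) ⁅T b, T c⁆

/-- The free action `½ π(ω, d ω)`. -/
def freeAction (τ : Type*) [Fintype τ] : SuperPoly (ghost e.deg τ) :=
  (1 / 2 : ℝ) • ∑ i : I, ∑ j : I, ∑ a : τ,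
    ((-1 : ℝ) ^ (e.deg i + 1) * D.π (e.basis i) (D.d (e.basis j))) •
      (field τ e i a * field τ e j a)

/-- The cubic term `⅙ π(ω, l(ω, ω))`. -/
def cubicAction (κ : LinearMap.BilinForm ℝ L) (T : Module.Basis τ ℝ L) :
    SuperPoly (ghost e.deg τ) :=
  (1 / 6 : ℝ) • ∑ i : I, ∑ j : I, ∑ k : I, ∑ a : τ, ∑ b : τ, ∑ c : τ,
    ((-1 : ℝ) ^ (e.deg j * (e.deg k + 1)) * structureConst κ T a b c *
        D.π (e.basis i) (e.basis j * e.basis k)) •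
      (field τ e i a * field τ e j b * field τ e k c)

/-- The abstract Chern-Simons action `½ π(ω, d ω) + ⅙ π(ω, l(ω, ω))`; the basis `T` of the Lie
algebra has to be orthonormal with respect to `κ`. -/
def action (κ : LinearMap.BilinForm ℝ L) (T : Module.Basis τ ℝ L) :
    SuperPoly (ghost e.deg τ) :=
  D.freeAction e τ + D.cubicAction e κ T

/-- The matrix `π_{IJ} = π(e_I, e_J)`. -/
def pairingMatrix : Matrix I I ℝ := Matrix.of fun i j => D.π (e.basis i) (e.basis j)

variable {D} (R : D.RelaxedInductionData)

/-- The second order operator `π⁻¹(∂/∂ω'', K ∂/∂ω'')`, that is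
`∑ (π⁻¹)^{IM} K^J_I ∂/∂ω^{Ja} ∂/∂ω^{Ma}` with `K e_I = ∑ K^J_I e_J`. It only differentiates along
the orthogonal complement of the image of `ι`, since `K` vanishes on that image and takes values
in its complement. -/
def laplacian (τ : Type*) [Fintype τ] :
    SuperPoly (ghost e.deg τ) →ₗ[ℝ] SuperPoly (ghost e.deg τ) :=
  ∑ i : I, ∑ j : I, ∑ m : I, ∑ a : τ,
    ((D.pairingMatrix e)⁻¹ i m * e.basis.repr (R.K (e.basis i)) j) •
      (SuperPoly.pderiv (ghost e.deg τ) (j, a) ∘ₗ SuperPoly.pderiv (ghost e.deg τ) (m, a))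

variable {P : Type*} [Fintype P] (h : HomogeneousBasis D.cohomologyDeg P)

/-- The restriction of functions of `ω = ι(α) + ω''` to `ω'' = 0`, in the coordinates `α^{pa}`
of the basis `e_p` of cohomology: `ω^{Ia} ↦ ∑ ι^I_p α^{pa}`. -/
def restrict (τ : Type*) [Fintype τ] :
    SuperPoly (ghost e.deg τ) →ₐ[ℝ] SuperPoly (ghost h.deg τ) :=
  open Classical in
  SuperPoly.linearSubst _ _ fun x y =>
    if x.2 = y.2 then e.basis.repr (R.ι (h.basis y.1)) x.1 else 0

/-- The perturbation series
`exp(-ħ ½ π⁻¹(∂/∂ω'', K ∂/∂ω''))|_{ω'' = 0} exp((S - S₀)/ħ)`.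
Functions of `ι(α) + ω''` are functions on the space of fields, and `S₀(ω'') = ½ π(ω, d ω)` since
`d ι = 0` and the image of `ι` is orthogonal to that of `d`. The outer variable of the
power series stands for the factor `1/ħ` of each vertex and the inner variable for the factor `ħ`
of each edge; they are only identified as `1/ħ` and `ħ` after taking the logarithm. -/
def partitionSeries (S : SuperPoly (ghost e.deg τ)) :
    PowerSeries (PowerSeries (SuperPoly (ghost h.deg τ))) :=
  PowerSeries.mk fun V => PowerSeries.mk fun E =>
    ((1 / (V.factorial : ℝ)) * ((-1 / 2 : ℝ) ^ E / (E.factorial : ℝ))) •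
      restrict e R h τ (((laplacian e R τ) ^ E) ((S - D.freeAction e τ) ^ V))

/-- The coefficient of `(1/ħ)^V ħ^E` in the logarithm of the perturbation series. -/
def logCoeff (S : SuperPoly (ghost e.deg τ)) (V E : ℕ) : SuperPoly (ghost h.deg τ) :=
  PowerSeries.coeff E (PowerSeries.coeff V (formalLog (partitionSeries e R h S)))

/-- `W = Ind_{ι,K}(S)`, i.e.
`W(α) = ħ log(exp(-ħ ½ π⁻¹(∂/∂ω'', K ∂/∂ω''))|_{ω'' = 0} exp((S - S₀)/ħ))`, as a power
series in `ħ` with coefficients in the polynomial functions on `𝔤 ⊗ H(C)[1]`. The right side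
has no negative powers of `ħ`, and for each `l` the coefficient of `ħ^l` on the right, a sum over
all `V, E` with `1 - V + E = l`, has finitely many non-zero terms and equals that of `W`. -/
def IsInd (S : SuperPoly (ghost e.deg τ)) (W : PowerSeries (SuperPoly (ghost h.deg τ))) : Prop :=
  (∀ V E : ℕ, E + 1 < V → logCoeff e R h S V E = 0) ∧
  ∀ l : ℕ, {p : ℕ × ℕ | p.2 + 1 = l + p.1 ∧ logCoeff e R h S p.1 p.2 ≠ 0}.Finite ∧
    PowerSeries.coeff l W =
      ∑ᶠ (p : ℕ × ℕ) (_ : p.2 + 1 = l + p.1), logCoeff e R h S p.1 p.2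

/-- `W_prod^{003} = ½ κ(α_(3), [α_(0), α_(0)]) = ½ ∑ f_{abc} α_(0)^a α_(0)^b α_(3)^c`. -/
def prod003 (h : D.DarbouxBasis) (κ : LinearMap.BilinForm ℝ L) (T : Module.Basis τ ℝ L) :
    SuperPoly (ghost h.toHomogeneous.deg τ) :=
  (1 / 2 : ℝ) • ∑ a : τ, ∑ b : τ, ∑ c : τ, structureConst κ T a b c •
    (SuperPoly.coord (ghost h.toHomogeneous.deg τ) (0, a) *
      SuperPoly.coord (ghost h.toHomogeneous.deg τ) (0, b) *
      SuperPoly.coord (ghost h.toHomogeneous.deg τ) (1, c))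

/-- The series `A(ħ) · w + B(ħ)` for a function `w` and numerical series `A`, `B`. -/
def ansatz {F : Type*} [Ring F] [Algebra ℝ F] (A B : PowerSeries ℝ) (w : F) : PowerSeries F :=
  PowerSeries.mk fun l => PowerSeries.coeff l A • w + algebraMap ℝ F (PowerSeries.coeff l B)

end DGFrobenius

end

section

/- The commutator bracket on matrices. -/
attribute [local instance] LieRing.ofAssociativeRing

/-- The Lie algebra `su(2)` of traceless skew-Hermitian complex `2 × 2` matrices. -/
def su2 : LieSubalgebra ℝ (Matrix (Fin 2) (Fin 2) ℂ) where
  carrier := {A | A.conjTranspose = -A ∧ A.trace = 0}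
  add_mem' := by
    rintro A B ⟨hA, hA'⟩ ⟨hB, hB'⟩
    exact ⟨by rw [Matrix.conjTranspose_add, hA, hB]; abel, by rw [Matrix.trace_add, hA', hB', add_zero]⟩
  zero_mem' := ⟨by simp, by simp⟩
  smul_mem' := by
    rintro c A ⟨hA, hA'⟩
    exact ⟨by rw [Matrix.conjTranspose_smul, hA]; simp, by rw [Matrix.trace_smul, hA', smul_zero]⟩
  lie_mem' := by
    rintro A B ⟨hA, _⟩ ⟨hB, _⟩
    refine ⟨?_, ?_⟩
    · rw [Ring.lie_def, Matrix.conjTranspose_sub, Matrix.conjTranspose_mul,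
        Matrix.conjTranspose_mul, hA, hB]
      simp
    · rw [Ring.lie_def, Matrix.trace_sub, Matrix.trace_mul_comm, sub_self]

end

end AbstractCS

end

open AbstractCS

/-! Write Δ for the second-order operator of the propagator K, c for the cubic part of the action,
and φ for the restriction to the harmonic representatives 1 and v. The diagrams are the functions
φ(Δ^E c^V).

Shape of the effective action. Each diagram has ghost number zero and degree 3V-2E. On cohomology
the coordinates are three odd ones of ghost number 1 and three even ones of ghost number -2, so
ghost number zero forces degree 0 or 3, i.e. 3V = 2E or 3V = 2E+3. Rotation invariance makes every
cubic diagram a multiple of W = φ(c), and W² = 0 by degree. The partition series is therefore 1 + b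
+ aW with scalar double series a and b. Its logarithm is affine in W, and each power of ħ receives
one pair (V,E) for constants and one for W (`coeff_formalLog`, `exists_isInd_of_diagrams`,
`isInd_ansatz`).

Two loops. Two numbers enter: θ = Δ³c² and the coefficient of W in φ(Δ³c³). To find the latter, move
q = ∂₁c past Δ³. The commutator [Δ,q] acts as a linear vector field built from K, hence dies under φ
because K annihilates 1 and v; its own commutator with Δ is -4 times the operator with kernel K²
(`pow_three_lap_mul`). With f = f₀₁₂ and t the form `vtrace`, the coefficient is 3θ - 288 f² t(K³),
so that 3A⁽¹⁾ + B⁽²⁾ = -(θ - 288 f² t(K³))/96. If K² = 0 the vertex q decouples from all other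
vertices, and A = 1.

Invariance for fixed v. For two propagators, K₁ - K₀ = [d, K₀K₁]. The vector field induced by d
annihilates c; passing it through Δ replaces a propagator by the identity minus the harmonic
projector. The identity contributes nothing by the classical master equation, and the harmonic part
gives θ₁ - θ₀ = 288 f² (t(K₁³) - t(K₀³)) (`lap_cube_sq_sub`). The mixed triple products of K₀ and K₁
are reduced to cubes because closed operators of degree -3 that kill harmonic elements vanish
(`eq_zero_of_closed`). These are finite differences; no path of propagators is needed.

Change of v. The strict propagator KdK has vanishing cube, and a rank two correction moves it to
another v while keeping it strict and keeping θ (`strictify`, `add_shift`, `lap_cube_sq_shift`).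
Together these steps connect any two propagators (`two_loop_invariant`).

The algebra su(2) enters through being three-dimensional and non-abelian: an invariant f is then a
non-zero multiple of the Levi-Civita symbol, and Jacobi is automatic. -/

noncomputable section

set_option linter.unusedSectionVars false

namespace AbstractCS

/-! ### Coordinates and derivatives in the free graded-commutative algebra. -/

namespace SuperPoly

section

variable {X : Type*} {gh : X → ℤ}

theorem neg_one_zpow_sq (n : ℤ) : (-1 : ℝ) ^ n * (-1 : ℝ) ^ n = 1 := by
  rcases Int.even_or_odd n with h | h <;> simp [h.neg_one_zpow]

theorem coord_even {x : X} (h : Even (gh x)) :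
    coord gh x = MvPolynomial.X ⟨x, h⟩ ⊗ₜ[ℝ] 1 := dif_pos h

theorem coord_odd {x : X} (h : ¬ Even (gh x)) :
    coord gh x = 1 ⊗ₜ[ℝ] ExteriorAlgebra.ι ℝ (Finsupp.single ⟨x, h⟩ 1) := dif_neg h

theorem pderiv_even {x : X} (h : Even (gh x))
    (p : MvPolynomial {x : X // Even (gh x)} ℝ)
    (w : ExteriorAlgebra ℝ ({x : X // ¬ Even (gh x)} →₀ ℝ)) :
    pderiv gh x (p ⊗ₜ w) = (MvPolynomial.pderiv ⟨x, h⟩ p) ⊗ₜ w := by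
  rw [pderiv, dif_pos h]; rfl

theorem pderiv_odd {x : X} (h : ¬ Even (gh x))
    (p : MvPolynomial {x : X // Even (gh x)} ℝ)
    (w : ExteriorAlgebra ℝ ({x : X // ¬ Even (gh x)} →₀ ℝ)) :
    pderiv gh x (p ⊗ₜ w) = p ⊗ₜ (CliffordAlgebra.contractLeft
      (Q := (0 : QuadraticForm ℝ ({x : X // ¬ Even (gh x)} →₀ ℝ))) (Finsupp.lapply ⟨x, h⟩) w) := by
  rw [pderiv, dif_neg h]; rfl

-- For two even variables this is the Leibniz rule for polynomials, for two odd ones the contraction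
-- rule of the exterior algebra; in the mixed cases the two tensor factors do not interact.
open Classical in
theorem pderiv_coord_mul (x y : X) (f : SuperPoly gh) :
    pderiv gh x (coord gh y * f) =
      (if x = y then f else 0) + (-1 : ℝ) ^ (gh x * gh y) • (coord gh y * pderiv gh x f) := by
  induction f using TensorProduct.induction_on with
  | zero => simp
  | add f g hf hg =>
    rw [mul_add, map_add, hf, hg, map_add, mul_add, smul_add]
    split_ifs <;> abel
  | tmul p w =>
    by_cases hx : Even (gh x) <;> by_cases hy : Even (gh y)
    · rw [coord_even hy, Algebra.TensorProduct.tmul_mul_tmul, one_mul, pderiv_even hx,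
        pderiv_even hx, Derivation.leibniz, MvPolynomial.pderiv_X,
        Algebra.TensorProduct.tmul_mul_tmul, one_mul, (hx.mul_right _).neg_one_zpow, one_smul]
      by_cases hxy : x = y
      · subst hxy
        simp [TensorProduct.add_tmul, add_comm]
      · rw [Pi.single_eq_of_ne (fun h => hxy (congrArg Subtype.val h).symm), if_neg hxy]
        simp
    · have hxy : x ≠ y := by rintro rfl; exact hy hx
      rw [coord_odd hy, Algebra.TensorProduct.tmul_mul_tmul, one_mul, pderiv_even hx,
        pderiv_even hx, Algebra.TensorProduct.tmul_mul_tmul, one_mul,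
        (hx.mul_right _).neg_one_zpow, one_smul, if_neg hxy, zero_add]
    · have hxy : x ≠ y := by rintro rfl; exact hx hy
      rw [coord_even hy, Algebra.TensorProduct.tmul_mul_tmul, one_mul, pderiv_odd hx,
        pderiv_odd hx, Algebra.TensorProduct.tmul_mul_tmul, one_mul,
        (hy.mul_left _).neg_one_zpow, one_smul, if_neg hxy, zero_add]
    · have ho : Odd (gh x * gh y) :=
        (Int.not_even_iff_odd.mp hx).mul (Int.not_even_iff_odd.mp hy)
      rw [coord_odd hy, Algebra.TensorProduct.tmul_mul_tmul, one_mul, pderiv_odd hx,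
        pderiv_odd hx, Algebra.TensorProduct.tmul_mul_tmul, one_mul, ho.neg_one_zpow]
      have := CliffordAlgebra.contractLeft_ι_mul
        (Q := (0 : QuadraticForm ℝ ({x : X // ¬ Even (gh x)} →₀ ℝ)))
        (d := Finsupp.lapply ⟨x, hx⟩) (Finsupp.single ⟨y, hy⟩ 1) w
      rw [show ExteriorAlgebra.ι ℝ = CliffordAlgebra.ι
        (0 : QuadraticForm ℝ ({x : X // ¬ Even (gh x)} →₀ ℝ)) from rfl, this]
      rw [TensorProduct.tmul_sub, Finsupp.lapply_apply, Finsupp.single_apply]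
      simp only [Subtype.mk.injEq, eq_comm (a := y)]
      rw [sub_eq_add_neg]
      congr 1
      · split_ifs <;> simp
      · exact (neg_one_smul ℝ (p ⊗ₜ[ℝ] _)).symm

@[simp]
theorem pderiv_algebraMap (x : X) (r : ℝ) :
    pderiv gh x (algebraMap ℝ (SuperPoly gh) r) = 0 := by
  rw [Algebra.algebraMap_eq_smul_one, map_smul]
  by_cases hx : Even (gh x)
  · rw [Algebra.TensorProduct.one_def, pderiv_even hx]; simp
  · rw [Algebra.TensorProduct.one_def, pderiv_odd hx, CliffordAlgebra.contractLeft_one]; simp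

@[simp]
theorem pderiv_one (x : X) : pderiv gh x (1 : SuperPoly gh) = 0 := by
  rw [← map_one (algebraMap ℝ (SuperPoly gh)), pderiv_algebraMap]

theorem smul_eq_mul_left (r : ℝ) (f : SuperPoly gh) :
    r • f = algebraMap ℝ (SuperPoly gh) r * f := Algebra.smul_def r f

-- Coordinates generate the algebra under left multiplication. The auxiliary claim, that left
-- multiplication by any element preserves `p`, lets the polynomial and the exterior factor be
-- handled by separate inductions.
@[elab_as_elim]
theorem induction {p : SuperPoly gh → Prop} (one : p 1)
    (add : ∀ f g, p f → p g → p (f + g)) (smul : ∀ (r : ℝ) f, p f → p (r • f))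
    (coord_mul : ∀ x f, p f → p (coord gh x * f)) : ∀ f, p f := by
  have key : ∀ f g : SuperPoly gh, p g → p (f * g) := by
    intro f
    have zero : ∀ g : SuperPoly gh, p g → p (0 * g) := by
      intro g hg
      have := smul 0 g hg
      rwa [zero_smul, ← zero_mul g] at this
    have h1 : ∀ (q : MvPolynomial {x : X // Even (gh x)} ℝ) (g : SuperPoly gh), p g →
        p ((q ⊗ₜ[ℝ] 1) * g) := by
      intro q
      induction q using MvPolynomial.induction_on with
      | C r =>
        intro g hg
        have := smul r g hg
        rwa [smul_eq_mul_left] at this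
      | add a b ha hb =>
        intro g hg
        rw [TensorProduct.add_tmul, add_mul]
        exact add _ _ (ha g hg) (hb g hg)
      | mul_X a i ha =>
        intro g hg
        have := ha _ (coord_mul i.1 g hg)
        rw [coord_even i.2, ← mul_assoc, Algebra.TensorProduct.tmul_mul_tmul, one_mul] at this
        exact this
    have h2 : ∀ (w : ExteriorAlgebra ℝ ({x : X // ¬ Even (gh x)} →₀ ℝ)) (g : SuperPoly gh), p g →
        p ((1 ⊗ₜ[ℝ] w) * g) := by
      intro w
      induction w using CliffordAlgebra.left_induction with
      | algebraMap r =>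
        intro g hg
        have := smul r g hg
        rw [smul_eq_mul_left] at this
        convert this using 2
        rw [Algebra.algebraMap_eq_smul_one, Algebra.algebraMap_eq_smul_one,
          TensorProduct.tmul_smul, Algebra.TensorProduct.one_def]
      | add a b ha hb =>
        intro g hg
        rw [TensorProduct.tmul_add, add_mul]
        exact add _ _ (ha g hg) (hb g hg)
      | ι_mul w m hw =>
        intro g hg
        have hm : ∀ g', p g' → p ((1 ⊗ₜ[ℝ] CliffordAlgebra.ι
            (0 : QuadraticForm ℝ ({x : X // ¬ Even (gh x)} →₀ ℝ)) m) * g') := by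
          induction m using Finsupp.induction_linear with
          | zero =>
            intro g' hg'
            rw [map_zero, TensorProduct.tmul_zero]
            exact zero g' hg'
          | add a b ha hb =>
            intro g' hg'
            rw [map_add, TensorProduct.tmul_add, add_mul]
            exact add _ _ (ha g' hg') (hb g' hg')
          | single x r =>
            intro g' hg'
            have := smul r _ (coord_mul x.1 g' hg')
            rw [coord_odd x.2, ← smul_mul_assoc, ← TensorProduct.tmul_smul, ← map_smul,
              Finsupp.smul_single, smul_eq_mul, mul_one] at this
            exact this
        have := hm _ (hw g hg)
        rwa [← mul_assoc, Algebra.TensorProduct.tmul_mul_tmul, one_mul] at this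
    induction f using TensorProduct.induction_on with
    | zero => exact zero
    | add a b ha hb =>
      intro g hg
      rw [add_mul]
      exact add _ _ (ha g hg) (hb g hg)
    | tmul q w =>
      intro g hg
      have := h1 q _ (h2 w g hg)
      rwa [← mul_assoc, Algebra.TensorProduct.tmul_mul_tmul, one_mul, mul_one] at this
  intro f
  simpa using key f 1 one

theorem coord_mul_comm (x y : X) :
    coord gh x * coord gh y = (-1 : ℝ) ^ (gh x * gh y) • (coord gh y * coord gh x) := by
  by_cases hx : Even (gh x) <;> by_cases hy : Even (gh y)
  · rw [coord_even hx, coord_even hy, (hx.mul_right _).neg_one_zpow, one_smul]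
    simp [mul_comm]
  · rw [coord_even hx, coord_odd hy, (hx.mul_right _).neg_one_zpow, one_smul]
    simp
  · rw [coord_odd hx, coord_even hy, (hy.mul_left _).neg_one_zpow, one_smul]
    simp
  · have ho : Odd (gh x * gh y) :=
      (Int.not_even_iff_odd.mp hx).mul (Int.not_even_iff_odd.mp hy)
    rw [coord_odd hx, coord_odd hy, ho.neg_one_zpow, 
      Algebra.TensorProduct.tmul_mul_tmul, Algebra.TensorProduct.tmul_mul_tmul,
      eq_neg_of_add_eq_zero_left (ExteriorAlgebra.ι_add_mul_swap _ _), TensorProduct.tmul_neg]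
    exact (neg_one_smul ℝ (_ ⊗ₜ[ℝ] _)).symm

/-- Setting all coordinates to zero is a left inverse. -/
theorem algebraMap_injective : Function.Injective (algebraMap ℝ (SuperPoly gh)) := by
  let φ : SuperPoly gh →ₐ[ℝ] ℝ :=
    Algebra.TensorProduct.productMap (MvPolynomial.aeval 0) ExteriorAlgebra.algebraMapInv
  intro a b h
  have := congrArg φ h
  simpa only [AlgHom.commutes, Algebra.algebraMap_self, RingHom.id_apply] using this

variable {Y : Type*} [Fintype Y] {ghY : Y → ℤ}

/-- `linearSubst` sums only over target coordinates of the parity of `x`; preservation of ghost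
numbers makes the omitted terms zero. -/
theorem linearSubst_coord (M : X → Y → ℝ) (hM : ∀ x y, M x y ≠ 0 → gh x = ghY y) (x : X) :
    linearSubst gh ghY M (coord gh x) = ∑ y, M x y • coord ghY y := by
  rw [← Fintype.sum_subtype_add_sum_subtype (fun y => Even (ghY y))]
  by_cases hx : Even (gh x)
  · have h0 : ∀ y : {y // ¬ Even (ghY y)}, M x y.1 = 0 := by
      intro y
      by_contra h
      exact y.2 (hM _ _ h ▸ hx)
    rw [coord_even hx, linearSubst, Algebra.TensorProduct.map_tmul, map_one, MvPolynomial.aeval_X,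
      TensorProduct.sum_tmul, Finset.sum_eq_zero (s := (Finset.univ : Finset {y // ¬ Even (ghY y)})),
      add_zero]
    · refine Finset.sum_congr rfl fun y _ => ?_
      rw [coord_even y.2, ← MvPolynomial.smul_eq_C_mul, TensorProduct.smul_tmul']
    · intro y _
      rw [h0 y]
      exact zero_smul ℝ (coord ghY y.1)
  · have h0 : ∀ y : {y // Even (ghY y)}, M x y.1 = 0 := by
      intro y
      by_contra h
      exact hx (hM _ _ h ▸ y.2)
    rw [coord_odd hx, linearSubst, Algebra.TensorProduct.map_tmul, map_one,
      ExteriorAlgebra.map_apply_ι, Finsupp.linearCombination_single, one_smul, map_sum,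
      TensorProduct.tmul_sum, Finset.sum_eq_zero (s := (Finset.univ : Finset {y // Even (ghY y)})),
      zero_add]
    · refine Finset.sum_congr rfl fun y _ => ?_
      rw [coord_odd y.2, ← TensorProduct.tmul_smul, ← map_smul, Finsupp.smul_single, smul_eq_mul,
        mul_one]
    · intro y _
      rw [h0 y]
      exact zero_smul ℝ (coord ghY y.1)

end

end SuperPoly

end AbstractCS

/-! ### Graded differential calculus from its computation rules. -/

namespace AbstractCS

/-- Coordinates and left partial derivatives of a free graded-commutative algebra `A`, presented by
their computation rules. -/
structure SuperCalculus {X : Type*} (gh : X → ℤ) (A : Type*) [Ring A] [Algebra ℝ A] where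
  coord : X → A
  pderiv : X → A →ₗ[ℝ] A
  pderiv_one : ∀ x, pderiv x 1 = 0
  pderiv_coord_mul : open Classical in ∀ x y f, pderiv x (coord y * f) =
    (if x = y then f else 0) + (-1 : ℝ) ^ (gh x * gh y) • (coord y * pderiv x f)
  coord_mul_comm : ∀ x y,
    coord x * coord y = (-1 : ℝ) ^ (gh x * gh y) • (coord y * coord x)
  induction : ∀ p : A → Prop, p 1 → (∀ f g, p f → p g → p (f + g)) →
    (∀ (r : ℝ) f, p f → p (r • f)) → (∀ x f, p f → p (coord x * f)) → ∀ f, p f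
  algebraMap_injective : Function.Injective (algebraMap ℝ A)

/-- The standard calculus on `SuperPoly gh`. -/
def SuperPoly.calculus {X : Type*} (gh : X → ℤ) : SuperCalculus gh (SuperPoly gh) where
  coord := SuperPoly.coord gh
  pderiv := SuperPoly.pderiv gh
  pderiv_one := SuperPoly.pderiv_one
  pderiv_coord_mul := SuperPoly.pderiv_coord_mul
  coord_mul_comm := SuperPoly.coord_mul_comm
  induction := fun _ h1 h2 h3 h4 => SuperPoly.induction h1 h2 h3 h4
  algebraMap_injective := SuperPoly.algebraMap_injective

namespace SuperCalculus

variable {X : Type*} {gh : X → ℤ} {A : Type*} [Ring A] [Algebra ℝ A] (S : SuperCalculus gh A)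

theorem neg_one_zpow_add (m n : ℤ) : (-1 : ℝ) ^ (m + n) = (-1 : ℝ) ^ m * (-1 : ℝ) ^ n :=
  zpow_add₀ (by norm_num) m n

/-- The product of a list of coordinates. -/
def monomial (l : List X) : A := (l.map S.coord).prod

@[simp] theorem monomial_nil : S.monomial [] = 1 := rfl

@[simp] theorem monomial_cons (x : X) (l : List X) :
    S.monomial (x :: l) = S.coord x * S.monomial l := by
  simp [monomial]

/-- The functions that are homogeneous of polynomial degree `n` and of ghost number `g`. -/
def wt (n : ℕ) (g : ℤ) : Submodule ℝ A :=
  Submodule.span ℝ {f | ∃ l : List X, l.length = n ∧ (l.map gh).sum = g ∧ f = S.monomial l}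

theorem monomial_mem (l : List X) : S.monomial l ∈ S.wt l.length (l.map gh).sum :=
  Submodule.subset_span ⟨l, rfl, rfl, rfl⟩

theorem monomial_mem' {l : List X} {n : ℕ} {g : ℤ} (hn : l.length = n)
    (hg : (l.map gh).sum = g) : S.monomial l ∈ S.wt n g :=
  Submodule.subset_span ⟨l, hn, hg, rfl⟩

theorem wt_induction {n : ℕ} {g : ℤ} {p : A → Prop} (zero : p 0)
    (add : ∀ f f', p f → p f' → p (f + f')) (smul : ∀ (r : ℝ) f, p f → p (r • f))
    (mon : ∀ l : List X, l.length = n → (l.map gh).sum = g → p (S.monomial l)) {f : A}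
    (hf : f ∈ S.wt n g) : p f := by
  induction hf using Submodule.span_induction with
  | mem f h => obtain ⟨l, h1, h2, rfl⟩ := h; exact mon l h1 h2
  | zero => exact zero
  | add f f' _ _ h h' => exact add f f' h h'
  | smul r f _ h => exact smul r f h

theorem one_mem : (1 : A) ∈ S.wt 0 0 := S.monomial_mem []

theorem coord_mem (x : X) : S.coord x ∈ S.wt 1 (gh x) := by
  simpa using S.monomial_mem [x]

theorem mul_mem {n m : ℕ} {g k : ℤ} {f f' : A} (hf : f ∈ S.wt n g) (hf' : f' ∈ S.wt m k) :
    f * f' ∈ S.wt (n + m) (g + k) := by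
  refine S.wt_induction (p := fun f => f * f' ∈ S.wt (n + m) (g + k)) ?_ ?_ ?_ ?_ hf
  · rw [zero_mul]; exact Submodule.zero_mem _
  · intro a b ha hb; rw [add_mul]; exact Submodule.add_mem _ ha hb
  · intro r a ha; rw [smul_mul_assoc]; exact Submodule.smul_mem _ _ ha
  · intro l hl hl'
    refine S.wt_induction (p := fun f' => S.monomial l * f' ∈ S.wt (n + m) (g + k)) ?_ ?_ ?_ ?_ hf'
    · rw [mul_zero]; exact Submodule.zero_mem _
    · intro a b ha hb; rw [mul_add]; exact Submodule.add_mem _ ha hb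
    · intro r a ha; rw [mul_smul_comm]; exact Submodule.smul_mem _ _ ha
    · intro l' hm hm'
      have : S.monomial l * S.monomial l' = S.monomial (l ++ l') := by simp [monomial]
      rw [this]
      exact S.monomial_mem' (by simp [hl, hm]) (by simp [hl', hm'])

theorem pow_mem {n : ℕ} {f : A} (hf : f ∈ S.wt n 0) (k : ℕ) : f ^ k ∈ S.wt (n * k) 0 := by
  induction k with
  | zero => simpa using S.one_mem
  | succ k ih =>
    rw [pow_succ, Nat.mul_succ]
    simpa using S.mul_mem ih hf

theorem pderiv_mem {n : ℕ} {g : ℤ} {f : A} (hf : f ∈ S.wt (n + 1) g) (x : X) :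
    S.pderiv x f ∈ S.wt n (g - gh x) := by
  classical
  have key : ∀ (l : List X) (y : X),
      S.pderiv x (S.monomial (y :: l)) ∈ S.wt l.length (((y :: l).map gh).sum - gh x) := by
    intro l
    induction l with
    | nil =>
      intro y
      rw [monomial_cons, S.pderiv_coord_mul, monomial_nil, S.pderiv_one, mul_zero, smul_zero,
        add_zero]
      split_ifs with h
      · subst h; simpa using S.one_mem
      · exact Submodule.zero_mem _
    | cons z l ih =>
      intro y
      rw [monomial_cons, S.pderiv_coord_mul]
      refine Submodule.add_mem _ ?_ (Submodule.smul_mem _ _ ?_)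
      · split_ifs with h
        · subst h
          exact S.monomial_mem' rfl (by simp)
        · exact Submodule.zero_mem _
      · have := S.mul_mem (S.coord_mem y) (ih z)
        convert this using 2
        · simp [add_comm]
        · simp; ring
  refine S.wt_induction (p := fun f => S.pderiv x f ∈ S.wt n (g - gh x)) ?_ ?_ ?_ ?_ hf
  · rw [map_zero]; exact Submodule.zero_mem _
  · intro a b ha hb; rw [map_add]; exact Submodule.add_mem _ ha hb
  · intro r a ha; rw [map_smul]; exact Submodule.smul_mem _ _ ha
  · intro l hl hl'
    cases l with
    | nil => simp at hl
    | cons y l =>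
      have := key l y
      rw [hl'] at this
      convert this using 2
      simpa using hl.symm

theorem exists_const_of_mem {g : ℤ} {f : A} (hf : f ∈ S.wt 0 g) : ∃ r : ℝ, f = algebraMap ℝ A r := by
  refine S.wt_induction (p := fun f => ∃ r : ℝ, f = algebraMap ℝ A r) ?_ ?_ ?_ ?_ hf
  · exact ⟨0, by simp⟩
  · rintro _ _ ⟨a, rfl⟩ ⟨b, rfl⟩; exact ⟨a + b, by simp⟩
  · rintro r _ ⟨a, rfl⟩; exact ⟨r * a, by rw [map_mul, Algebra.smul_def]⟩
  · intro l hl _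
    rw [List.length_eq_zero_iff] at hl
    subst hl
    exact ⟨1, by simp⟩

theorem eq_zero_of_mem_wt_zero {g : ℤ} (hg : g ≠ 0) {f : A} (hf : f ∈ S.wt 0 g) : f = 0 := by
  refine S.wt_induction (p := fun f => f = 0) rfl ?_ ?_ ?_ hf
  · rintro _ _ rfl rfl; simp
  · rintro r _ rfl; simp
  · intro l hl hl'
    rw [List.length_eq_zero_iff] at hl
    subst hl
    exact absurd hl'.symm hg

theorem coord_mul_of_mem {n : ℕ} {g : ℤ} {f : A} (hf : f ∈ S.wt n g) (x : X) :
    S.coord x * f = (-1 : ℝ) ^ (gh x * g) • (f * S.coord x) := by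
  refine S.wt_induction (p := fun f => S.coord x * f = (-1 : ℝ) ^ (gh x * g) • (f * S.coord x))
    ?_ ?_ ?_ ?_ hf
  · simp
  · intro a b ha hb; rw [mul_add, ha, hb, add_mul, smul_add]
  · intro r a ha; rw [mul_smul_comm, ha, smul_mul_assoc, smul_comm]
  · intro l hn hl
    subst hl
    clear hf f hn
    induction l with
    | nil => simp
    | cons y l ih =>
      rw [monomial_cons, ← mul_assoc, S.coord_mul_comm, smul_mul_assoc, mul_assoc, ih,
        mul_smul_comm, smul_smul, List.map_cons, List.sum_cons, mul_add, neg_one_zpow_add,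
        mul_assoc]

theorem mul_comm_of_mem {n m : ℕ} {g k : ℤ} {f f' : A} (hf : f ∈ S.wt n g) (hf' : f' ∈ S.wt m k) :
    f * f' = (-1 : ℝ) ^ (g * k) • (f' * f) := by
  refine S.wt_induction (p := fun f => f * f' = (-1 : ℝ) ^ (g * k) • (f' * f)) ?_ ?_ ?_ ?_ hf
  · simp
  · intro a b ha hb; rw [add_mul, ha, hb, mul_add, smul_add]
  · intro r a ha; rw [smul_mul_assoc, ha, mul_smul_comm, smul_comm]
  · intro l hn hl
    subst hl
    clear hf f hn
    induction l with
    | nil => simp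
    | cons y l ih =>
      rw [monomial_cons, mul_assoc, ih, mul_smul_comm, ← mul_assoc, S.coord_mul_of_mem hf',
        smul_mul_assoc, smul_smul, List.map_cons, List.sum_cons, add_mul, neg_one_zpow_add,
        mul_assoc, mul_comm]

theorem leibniz {n : ℕ} {g : ℤ} {f : A} (hf : f ∈ S.wt n g) (x : X) (f' : A) :
    S.pderiv x (f * f') = S.pderiv x f * f' + (-1 : ℝ) ^ (gh x * g) • (f * S.pderiv x f') := by
  classical
  refine S.wt_induction (p := fun f => S.pderiv x (f * f') =
    S.pderiv x f * f' + (-1 : ℝ) ^ (gh x * g) • (f * S.pderiv x f')) ?_ ?_ ?_ ?_ hf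
  · simp
  · intro a b ha hb
    rw [add_mul, map_add, ha, hb, map_add, add_mul, add_mul, smul_add]
    abel
  · intro r a ha
    rw [smul_mul_assoc, map_smul, ha, map_smul, smul_mul_assoc, smul_mul_assoc, smul_add, smul_comm]
  · intro l hn hl
    subst hl
    clear hf f hn
    induction l with
    | nil => simp [S.pderiv_one]
    | cons y l ih =>
      rw [monomial_cons, mul_assoc, S.pderiv_coord_mul, ih, S.pderiv_coord_mul, List.map_cons,
        List.sum_cons, mul_add (gh x), neg_one_zpow_add, add_mul, smul_mul_assoc, mul_add, smul_add,
        mul_smul_comm, smul_smul, mul_assoc, mul_assoc, ← add_assoc]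
      congr 2
      split_ifs <;> simp

theorem pderiv_coord [DecidableEq X] (x y : X) :
    S.pderiv x (S.coord y) = if x = y then 1 else 0 := by
  have := S.pderiv_coord_mul x y 1
  rw [mul_one, S.pderiv_one, mul_zero, smul_zero, add_zero] at this
  rw [this]
  congr

theorem pderiv_comm (x y : X) (f : A) :
    S.pderiv x (S.pderiv y f) = (-1 : ℝ) ^ (gh x * gh y) • S.pderiv y (S.pderiv x f) := by
  classical
  refine S.induction (fun f => S.pderiv x (S.pderiv y f) =
    (-1 : ℝ) ^ (gh x * gh y) • S.pderiv y (S.pderiv x f)) ?_ ?_ ?_ ?_ f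
  · simp [S.pderiv_one]
  · intro a b ha hb; simp only [map_add, ha, hb, smul_add]
  · intro r a ha; simp only [map_smul, ha]; rw [smul_comm]
  · intro z f hf
    simp only [S.pderiv_coord_mul, map_add, map_smul, hf, smul_add, smul_smul, mul_smul_comm]
    have e1 : S.pderiv x (if y = z then f else 0) = if y = z then S.pderiv x f else 0 := by
      split_ifs <;> simp
    have e2 : S.pderiv y (if x = z then f else 0) = if x = z then S.pderiv y f else 0 := by
      split_ifs <;> simp
    rw [e1, e2]
    have e3 : ((-1 : ℝ) ^ (gh y * gh z)) • (if x = z then S.pderiv y f else 0) =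
        (-1 : ℝ) ^ (gh x * gh y) • (if x = z then S.pderiv y f else 0) := by
      split_ifs with h
      · subst h; rw [mul_comm (gh y)]
      · simp
    have e4 : ((-1 : ℝ) ^ (gh x * gh y) * (-1 : ℝ) ^ (gh x * gh z)) •
        (if y = z then S.pderiv x f else 0) = (if y = z then S.pderiv x f else 0) := by
      split_ifs with h
      · subst h; rw [SuperPoly.neg_one_zpow_sq, one_smul]
      · simp
    rw [e3, e4]
    have e5 : (-1 : ℝ) ^ (gh y * gh z) * ((-1 : ℝ) ^ (gh x * gh z) * (-1 : ℝ) ^ (gh x * gh y)) =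
      (-1 : ℝ) ^ (gh x * gh y) * ((-1 : ℝ) ^ (gh x * gh z) * (-1 : ℝ) ^ (gh y * gh z)) := by ring
    rw [e5]
    abel

/-- Moving a derivative and then its coordinate past the same factor produces the same sign twice,
so Euler's identity holds as in the commutative case. It recovers a homogeneous function from its
first derivatives. -/
theorem euler [Fintype X] {n : ℕ} {g : ℤ} {f : A} (hf : f ∈ S.wt n g) :
    ∑ x, S.coord x * S.pderiv x f = (n : ℝ) • f := by
  classical
  refine S.wt_induction (p := fun f => ∑ x, S.coord x * S.pderiv x f = (n : ℝ) • f) ?_ ?_ ?_ ?_ hf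
  · simp
  · intro a b ha hb; simp only [map_add, mul_add, Finset.sum_add_distrib, ha, hb, smul_add]
  · intro r a ha
    simp only [map_smul, mul_smul_comm, ← Finset.smul_sum, ha]
    rw [smul_comm]
  · intro l hl hg
    subst hl
    clear hf f hg
    induction l with
    | nil => simp [S.pderiv_one]
    | cons y l ih =>
      simp only [monomial_cons, S.pderiv_coord_mul, mul_add, Finset.sum_add_distrib]
      have h1 : ∀ x, S.coord x * ((-1 : ℝ) ^ (gh x * gh y) • (S.coord y * S.pderiv x (S.monomial l)))
          = S.coord y * (S.coord x * S.pderiv x (S.monomial l)) := by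
        intro x
        rw [mul_smul_comm, ← mul_assoc, S.coord_mul_comm x y, smul_mul_assoc, smul_smul,
          SuperPoly.neg_one_zpow_sq, one_smul, mul_assoc]
      simp only [h1]
      rw [← Finset.mul_sum, ih]
      simp [add_smul, add_comm]

theorem eq_zero_of_pderiv [Fintype X] {n : ℕ} {g : ℤ} {f : A} (hf : f ∈ S.wt (n + 1) g)
    (h : ∀ x, S.pderiv x f = 0) : f = 0 := by
  have := S.euler hf
  simp only [h, mul_zero, Finset.sum_const_zero] at this
  exact (smul_eq_zero.mp this.symm).resolve_left (by positivity)

theorem coord_mul_monomial_of_mem {x : X} (hx : Odd (gh x)) {l : List X} (h : x ∈ l) :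
    S.coord x * S.monomial l = 0 := by
  induction l with
  | nil => simp at h
  | cons y l ih =>
    rw [monomial_cons, ← mul_assoc]
    by_cases hxy : x = y
    · subst hxy
      have h2 : S.coord x * S.coord x = 0 := by
        have := S.coord_mul_comm x x
        rw [(hx.mul hx).neg_one_zpow, neg_smul, one_smul] at this
        have h3 : (2 : ℝ) • (S.coord x * S.coord x) = 0 := by
          rw [two_smul]; nth_rewrite 1 [this]; exact neg_add_cancel _
        exact (smul_eq_zero.mp h3).resolve_left (by norm_num)
      rw [h2, zero_mul]
    · rw [S.coord_mul_comm, smul_mul_assoc, mul_assoc,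
        ih ((List.mem_cons.mp h).resolve_left hxy), mul_zero, smul_zero]

/-- An odd coordinate squares to zero. This is what bounds the degree of functions on cohomology. -/
theorem monomial_eq_zero_of_duplicate {x : X} (hx : Odd (gh x)) {l : List X}
    (h : List.Duplicate x l) : S.monomial l = 0 := by
  induction h with
  | cons_mem h => rw [monomial_cons, S.coord_mul_monomial_of_mem hx h]
  | cons_duplicate _ ih => rw [monomial_cons, ih, mul_zero]

section Subst

variable {Y : Type*} [Fintype Y] {ghY : Y → ℤ} {B : Type*} [Ring B] [Algebra ℝ B]
  (S' : SuperCalculus ghY B) (φ : A →ₐ[ℝ] B) (M : X → Y → ℝ)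

/-- `φ` is the pull-back along the linear map with matrix `M`, which preserves ghost numbers. -/
structure IsSubst : Prop where
  map_coord : ∀ x, φ (S.coord x) = ∑ y, M x y • S'.coord y
  gh_eq : ∀ x y, M x y ≠ 0 → gh x = ghY y

variable {S S' φ M}

theorem IsSubst.map_mem (h : S.IsSubst S' φ M) {n : ℕ} {g : ℤ} {f : A} (hf : f ∈ S.wt n g) :
    φ f ∈ S'.wt n g := by
  refine S.wt_induction (p := fun f => φ f ∈ S'.wt n g) ?_ ?_ ?_ ?_ hf
  · rw [map_zero]; exact Submodule.zero_mem _
  · intro a b ha hb; rw [map_add]; exact Submodule.add_mem _ ha hb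
  · intro r a ha; rw [map_smul]; exact Submodule.smul_mem _ _ ha
  · intro l hl hl'
    subst hl; subst hl'
    clear hf f
    induction l with
    | nil => simpa using S'.one_mem
    | cons x l ih =>
      have hx : φ (S.coord x) ∈ S'.wt 1 (gh x) := by
        rw [h.map_coord]
        refine Submodule.sum_mem _ fun y _ => ?_
        by_cases hy : M x y = 0
        · rw [hy, zero_smul]; exact Submodule.zero_mem _
        · rw [h.gh_eq x y hy]; exact Submodule.smul_mem _ _ (S'.coord_mem y)
      have := S'.mul_mem hx ih
      rw [monomial_cons, map_mul, List.map_cons, List.sum_cons]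
      convert this using 2
      simp [add_comm]

/-- The chain rule acquires no signs, since `M` links only coordinates of equal ghost number. -/
theorem IsSubst.pderiv [Fintype X] (h : S.IsSubst S' φ M) (y : Y) (f : A) :
    S'.pderiv y (φ f) = ∑ x, M x y • φ (S.pderiv x f) := by
  classical
  refine S.induction (fun f => S'.pderiv y (φ f) = ∑ x, M x y • φ (S.pderiv x f)) ?_ ?_ ?_ ?_ f
  · simp [S.pderiv_one, S'.pderiv_one]
  · intro a b ha hb; simp only [map_add, ha, hb, smul_add, Finset.sum_add_distrib]
  · intro r a ha
    simp only [map_smul, ha, Finset.smul_sum]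
    exact Finset.sum_congr rfl fun _ _ => smul_comm _ _ _
  · intro z f hf
    simp only [S.pderiv_coord_mul, map_add, map_mul, map_smul, h.map_coord, Finset.sum_mul,
      map_sum, smul_mul_assoc, S'.pderiv_coord_mul, hf, smul_add, Finset.sum_add_distrib]
    congr 1
    · have e : ∀ x, φ (if x = z then f else 0) = if x = z then φ f else 0 := by
        intro x; split_ifs <;> simp
      simp [e, smul_ite]
    · simp only [Finset.mul_sum, Finset.smul_sum, mul_smul_comm]
      rw [Finset.sum_comm]
      refine Finset.sum_congr rfl fun x _ => Finset.sum_congr rfl fun y' _ => ?_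
      simp only [smul_smul]
      by_cases h1 : M z y' = 0
      · simp [h1]
      by_cases h2 : M x y = 0
      · simp [h2]
      rw [h.gh_eq z y' h1, h.gh_eq x y h2]
      congr 1
      ring

end Subst

end SuperCalculus

end AbstractCS

/-! ### Homogeneous bases, the parity operator and the dual basis. -/

namespace AbstractCS

variable {C : Type*} [Ring C] [Algebra ℝ C] {𝒜 : ℕ → Submodule ℝ C} [GradedAlgebra 𝒜]

namespace HomogeneousBasis

variable {I : Type*} (e : HomogeneousBasis 𝒜 I)

theorem induction {p : C → Prop} (zero : p 0) (add : ∀ a b, p a → p b → p (a + b))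
    (smul : ∀ (r : ℝ) a, p a → p (r • a)) (basis : ∀ i, p (e.basis i)) (a : C) : p a := by
  have h : a ∈ Submodule.span ℝ (Set.range e.basis) := by rw [e.basis.span_eq]; trivial
  induction h using Submodule.span_induction with
  | mem x h => obtain ⟨i, rfl⟩ := h; exact basis i
  | zero => exact zero
  | add x y _ _ hx hy => exact add x y hx hy
  | smul r x _ hx => exact smul r x hx

theorem deg_eq_of_repr_ne_zero [Fintype I] {i : ℕ} {a : C} (ha : a ∈ 𝒜 i) {j : I}
    (hj : e.basis.repr a j ≠ 0) : e.deg j = i := by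
  classical
  by_contra hne
  apply hj
  have h1 : a = ∑ k, (if e.deg k = i then e.basis.repr a k else 0) • e.basis k := by
    have h2 : GradedRing.proj 𝒜 i a = a := by
      rw [GradedRing.proj_apply, DirectSum.decompose_of_mem_same 𝒜 ha]
    conv_lhs => rw [← h2, ← e.basis.sum_repr a, map_sum]
    refine Finset.sum_congr rfl fun k _ => ?_
    have h3 : GradedRing.proj 𝒜 i (e.basis.repr a k • e.basis k) =
        e.basis.repr a k • GradedRing.proj 𝒜 i (e.basis k) := by
      rw [GradedRing.proj_apply, DirectSum.decompose_smul, GradedRing.proj_apply]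
      rfl
    rw [h3, GradedRing.proj_apply]
    split_ifs with h
    · rw [DirectSum.decompose_of_mem_same 𝒜 (h ▸ e.mem k)]
    · rw [DirectSum.decompose_of_mem_ne 𝒜 (e.mem k) h, smul_zero, zero_smul]
  rw [h1, map_sum, Finsupp.finsetSum_apply]
  refine Finset.sum_eq_zero fun k _ => ?_
  rw [map_smul, e.basis.repr_self, Finsupp.smul_single, Finsupp.single_apply]
  split_ifs with h4 h5
  · subst h4; exact absurd h5 hne
  · simp
  · rfl

/-- The grading operator `a ↦ (-1)^|a| a`. -/
def sign : C →ₗ[ℝ] C := e.basis.constr ℝ fun i => (-1 : ℝ) ^ e.deg i • e.basis i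

@[simp] theorem sign_basis (i : I) : e.sign (e.basis i) = (-1 : ℝ) ^ e.deg i • e.basis i :=
  e.basis.constr_basis ℝ _ i

theorem sign_of_mem [Fintype I] {i : ℕ} {a : C} (ha : a ∈ 𝒜 i) : e.sign a = (-1 : ℝ) ^ i • a := by
  conv_lhs => rw [← e.basis.sum_repr a, map_sum]
  conv_rhs => rw [← e.basis.sum_repr a, Finset.smul_sum]
  refine Finset.sum_congr rfl fun k _ => ?_
  rw [map_smul, e.sign_basis]
  by_cases h : e.basis.repr a k = 0
  · rw [h]; simp
  · rw [e.deg_eq_of_repr_ne_zero ha h, smul_comm]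

@[simp] theorem sign_sign (a : C) : e.sign (e.sign a) = a := by
  refine e.induction (p := fun a => e.sign (e.sign a) = a) (by simp) ?_ ?_ ?_ a
  · intro a b ha hb; simp only [map_add, ha, hb]
  · intro r a ha; simp only [map_smul, ha]
  · intro i
    rw [sign_basis, map_smul, sign_basis, smul_smul, ← pow_add, ← two_mul, pow_mul]
    simp

@[simp] theorem sign_one [Fintype I] : e.sign 1 = 1 := by
  simpa using e.sign_of_mem (SetLike.GradedOne.one_mem (A := 𝒜))

theorem sign_comp_odd [Fintype I] {N : C →ₗ[ℝ] C}
    (hN : ∀ i a, a ∈ 𝒜 i → ∃ j, N a ∈ 𝒜 j ∧ Odd (i + j)) (a : C) :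
    e.sign (N a) = -N (e.sign a) := by
  refine e.induction (p := fun a => e.sign (N a) = -N (e.sign a)) (by simp) ?_ ?_ ?_ a
  · intro a b ha hb; simp only [map_add, ha, hb]; abel
  · intro r a ha; simp only [map_smul, ha, smul_neg]
  · intro i
    obtain ⟨j, hj, ho⟩ := hN _ _ (e.mem i)
    rw [e.sign_of_mem hj, sign_basis, map_smul, ← neg_smul]
    congr 1
    have h := Nat.odd_add.mp ho
    rcases Nat.even_or_odd j with hj' | hj'
    · rw [(h.mpr hj').neg_one_pow, hj'.neg_one_pow, neg_neg]
    · have : ¬ Odd (e.deg i) := fun h' => (Nat.not_even_iff_odd.mpr hj') (h.mp h')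
      rw [(Nat.not_odd_iff_even.mp this).neg_one_pow, hj'.neg_one_pow]

end HomogeneousBasis

namespace DGFrobenius

variable (D : DGFrobenius 𝒜) {I : Type*} (e : HomogeneousBasis 𝒜 I)

theorem π_basis_eq_zero {i j : I} (h : e.deg i + e.deg j ≠ 3) : D.π (e.basis i) (e.basis j) = 0 :=
  D.π_degree _ _ _ _ (e.mem i) (e.mem j) h

-- The pairing lives in total degree three, where one of the two degrees is even; the graded
-- symmetry sign is then trivial.
include e in
theorem π_comm (a b : C) : D.π a b = D.π b a := by
  refine e.induction (p := fun a => D.π a b = D.π b a) (by simp) ?_ ?_ ?_ a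
  · intro x y hx hy; simp only [map_add, LinearMap.add_apply, hx, hy]
  · intro r x hx; simp only [map_smul, LinearMap.smul_apply, hx]
  intro i
  refine e.induction (p := fun b => D.π (e.basis i) b = D.π b (e.basis i)) (by simp) ?_ ?_ ?_ b
  · intro x y hx hy; simp only [map_add, LinearMap.add_apply, hx, hy]
  · intro r x hx; simp only [map_smul, LinearMap.smul_apply, hx]
  intro j
  by_cases h : e.deg i + e.deg j = 3
  · rw [D.π_symm _ _ _ _ (e.mem i) (e.mem j)]
    have : Even (e.deg i * e.deg j) := by
      have : e.deg i ≤ 3 := by omega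
      have h2 : e.deg j = 3 - e.deg i := by omega
      rw [h2]
      interval_cases e.deg i <;> decide
    rw [this.neg_one_pow, one_mul]
  · rw [D.π_basis_eq_zero e h, D.π_basis_eq_zero e (by omega)]

/-- Paired elements have opposite parity, because their degrees add up to three. -/
theorem π_sign [Fintype I] (a b : C) : D.π (e.sign a) b = -D.π a (e.sign b) := by
  refine e.induction (p := fun a => D.π (e.sign a) b = -D.π a (e.sign b)) (by simp) ?_ ?_ ?_ a
  · intro x y hx hy; simp only [map_add, LinearMap.add_apply, hx, hy, neg_add]
  · intro r x hx; simp only [map_smul, LinearMap.smul_apply, hx, smul_neg]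
  intro i
  refine e.induction (p := fun b => D.π (e.sign (e.basis i)) b = -D.π (e.basis i) (e.sign b))
    (by simp) ?_ ?_ ?_ b
  · intro x y hx hy; simp only [map_add, hx, hy, neg_add]
  · intro r x hx; simp only [map_smul, hx, smul_neg]
  intro j
  rw [e.sign_basis, e.sign_basis, map_smul, map_smul, LinearMap.smul_apply]
  by_cases h : e.deg i + e.deg j = 3
  · have : e.deg i ≤ 3 := by omega
    have h2 : e.deg j = 3 - e.deg i := by omega
    rw [h2]
    interval_cases e.deg i <;> norm_num
  · rw [D.π_basis_eq_zero e h]; simp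

include D e in
theorem eq_zero_of_mem_of_lt {i : ℕ} (hi : 3 < i) {a : C} (ha : a ∈ 𝒜 i) : a = 0 := by
  refine D.π_nondeg a fun b => ?_
  refine e.induction (p := fun b => D.π a b = 0) (by simp) ?_ ?_ ?_ b
  · intro x y hx hy; simp only [map_add, hx, hy, add_zero]
  · intro r x hx; simp only [map_smul, hx, smul_zero]
  · intro j; exact D.π_degree _ _ _ _ ha (e.mem j) (by omega)

variable [Fintype I] [DecidableEq I]

/-- The dual basis: `π (e_k, ē^m) = δ_k^m`. -/
def dual (m : I) : C := ∑ i, (D.pairingMatrix e)⁻¹ i m • e.basis i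

theorem isUnit_pairingMatrix : IsUnit (D.pairingMatrix e) := by
  rw [← Matrix.vecMul_injective_iff_isUnit]
  rw [← Matrix.coe_vecMulLinear, ← LinearMap.ker_eq_bot, LinearMap.ker_eq_bot']
  intro x hx
  have h0 : ∑ i, x i • e.basis i = 0 := by
    refine D.π_nondeg _ fun b => ?_
    refine e.induction (p := fun b => D.π (∑ i, x i • e.basis i) b = 0) (by simp) ?_ ?_ ?_ b
    · intro a b ha hb; rw [map_add, ha, hb, add_zero]
    · intro r a ha; rw [map_smul, ha, smul_zero]
    · intro j
      have := congrFun hx j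
      simpa [Matrix.vecMul, dotProduct, pairingMatrix] using this
  funext i
  exact (Fintype.linearIndependent_iff.mp e.basis.linearIndependent) x h0 i

theorem π_basis_dual (k m : I) : D.π (e.basis k) (D.dual e m) = if k = m then 1 else 0 := by
  have h := Matrix.mul_nonsing_inv (D.pairingMatrix e)
    ((Matrix.isUnit_iff_isUnit_det _).mp (D.isUnit_pairingMatrix e))
  have := congrFun (congrFun h k) m
  rw [Matrix.mul_apply, Matrix.one_apply] at this
  rw [← this, dual, map_sum]
  refine Finset.sum_congr rfl fun i _ => ?_
  rw [map_smul, smul_eq_mul, mul_comm]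
  rfl

theorem eq_of_π_basis {a b : C} (h : ∀ k, D.π (e.basis k) a = D.π (e.basis k) b) : a = b := by
  rw [← sub_eq_zero]
  refine D.π_nondeg _ fun x => ?_
  rw [D.π_comm e]
  refine e.induction (p := fun x => D.π x (a - b) = 0) (by simp) ?_ ?_ ?_ x
  · intro a b ha hb; rw [map_add, LinearMap.add_apply, ha, hb, add_zero]
  · intro r a ha; rw [map_smul, LinearMap.smul_apply, ha, smul_zero]
  · intro k; rw [map_sub, h, sub_self]

theorem sum_π_basis_dual (u : C) : ∑ m, D.π (e.basis m) u • D.dual e m = u := by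
  refine D.eq_of_π_basis e fun k => ?_
  simp [π_basis_dual]

theorem sum_π_dual_basis (u : C) : ∑ m, D.π (D.dual e m) u • e.basis m = u := by
  refine e.induction (p := fun u => ∑ m, D.π (D.dual e m) u • e.basis m = u) (by simp) ?_ ?_ ?_ u
  · intro a b ha hb; simp only [map_add, add_smul, Finset.sum_add_distrib, ha, hb]
  · intro r a ha; simp only [map_smul, smul_assoc, ← Finset.smul_sum, ha]
  · intro k
    simp only [D.π_comm e (D.dual e _), π_basis_dual]
    simp

theorem repr_eq_π_dual (u : C) (m : I) : e.basis.repr u m = D.π (D.dual e m) u := by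
  conv_lhs => rw [← D.sum_π_dual_basis e u]
  simp [Finsupp.single_apply]

theorem sign_dual (m : I) : e.sign (D.dual e m) = -(-1 : ℝ) ^ e.deg m • D.dual e m := by
  refine D.eq_of_π_basis e fun k => ?_
  have := D.π_sign e (e.basis k) (D.dual e m)
  rw [e.sign_basis, map_smul, LinearMap.smul_apply, π_basis_dual] at this
  rw [map_smul, π_basis_dual, ← neg_eq_iff_eq_neg.mpr this]
  split_ifs with h
  · rw [h]; simp
  · simp

/-- The component of `D.dual e m` in the claimed degree has the same pairings with all basis vectors
as the whole vector, so by non-degeneracy it is the whole vector. -/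
theorem dual_mem (m : I) : D.dual e m ∈ 𝒜 (3 - e.deg m) := by
  have hp : ∀ x : C, GradedRing.proj 𝒜 (3 - e.deg m) x ∈ 𝒜 (3 - e.deg m) := fun x =>
    SetLike.coe_mem (DirectSum.decompose 𝒜 x (3 - e.deg m))
  have key : ∀ k, e.deg k = e.deg m → ∀ x : C,
      D.π (e.basis k) (GradedRing.proj 𝒜 (3 - e.deg m) x) = D.π (e.basis k) x := by
    intro k hk x
    refine e.induction (p := fun x => D.π (e.basis k) (GradedRing.proj 𝒜 (3 - e.deg m) x) =
      D.π (e.basis k) x) (by simp) ?_ ?_ ?_ x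
    · intro a b ha hb; rw [map_add, map_add, ha, hb, map_add]
    · intro r a ha
      have h3 : GradedRing.proj 𝒜 (3 - e.deg m) (r • a) =
          r • GradedRing.proj 𝒜 (3 - e.deg m) a := by
        rw [GradedRing.proj_apply, DirectSum.decompose_smul, GradedRing.proj_apply]
        rfl
      rw [h3, map_smul, ha, map_smul]
    · intro j
      rw [GradedRing.proj_apply]
      by_cases h : e.deg j = 3 - e.deg m
      · rw [DirectSum.decompose_of_mem_same 𝒜 (h ▸ e.mem j)]
      · rw [DirectSum.decompose_of_mem_ne 𝒜 (e.mem j) h, map_zero, D.π_basis_eq_zero e (by omega)]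
  have : D.dual e m = GradedRing.proj 𝒜 (3 - e.deg m) (D.dual e m) := by
    refine D.eq_of_π_basis e fun k => ?_
    by_cases hk : e.deg k = e.deg m
    · rw [key k hk]
    · have hkm : k ≠ m := by rintro rfl; exact hk rfl
      rw [π_basis_dual, if_neg hkm]
      have hm : e.deg m ≤ 3 := by
        by_contra h
        have := D.eq_zero_of_mem_of_lt e (by omega) (e.mem m)
        exact e.basis.ne_zero m this
      exact (D.π_degree _ _ _ _ (e.mem k) (hp _) (by omega)).symm
  rw [this]
  exact hp _

variable {E : Type*} [AddCommGroup E] [Module ℝ E]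

/-- The tensor Σ ē^m ⊗ e_m is the inverse of the pairing, so an operator on one leg may be moved to
the other as its transpose. -/
theorem sum_dual_basis_transpose {N N' : C →ₗ[ℝ] C} (h : ∀ u w, D.π (N u) w = D.π u (N' w))
    (B : C →ₗ[ℝ] C →ₗ[ℝ] E) :
    ∑ m, B (D.dual e m) (N (e.basis m)) = ∑ m, B (N' (D.dual e m)) (e.basis m) := by
  have h1 : ∀ m, B (D.dual e m) (N (e.basis m)) =
      ∑ k, D.π (e.basis m) (N' (D.dual e k)) • B (D.dual e m) (e.basis k) := by
    intro m
    conv_lhs => rw [← D.sum_π_dual_basis e (N (e.basis m)), map_sum]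
    refine Finset.sum_congr rfl fun k _ => ?_
    rw [map_smul, D.π_comm e, h]
  have h2 : ∀ k, B (N' (D.dual e k)) (e.basis k) =
      ∑ m, D.π (e.basis m) (N' (D.dual e k)) • B (D.dual e m) (e.basis k) := by
    intro k
    conv_lhs => rw [← D.sum_π_basis_dual e (N' (D.dual e k)), map_sum, LinearMap.sum_apply]
    refine Finset.sum_congr rfl fun m _ => ?_
    rw [map_smul, LinearMap.smul_apply]
  simp only [h1, h2]
  exact Finset.sum_comm

end DGFrobenius

end AbstractCS

/-! ### Constant vector fields and second-order operators. -/

namespace AbstractCS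

/-- Linear operators on `A`. -/
def Op (A : Type*) [Ring A] [Algebra ℝ A] : Type _ := Module.End ℝ A

namespace Op

variable {A : Type*} [Ring A] [Algebra ℝ A]

instance : Ring (Op A) := inferInstanceAs (Ring (Module.End ℝ A))

instance : Algebra ℝ (Op A) := inferInstanceAs (Algebra ℝ (Module.End ℝ A))

instance : FunLike (Op A) A A := inferInstanceAs (FunLike (A →ₗ[ℝ] A) A A)

instance : LinearMapClass (Op A) ℝ A A := inferInstanceAs (LinearMapClass (A →ₗ[ℝ] A) ℝ A A)

/-- A linear map as an operator. -/
def of (f : A →ₗ[ℝ] A) : Op A := f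

@[simp] theorem of_apply (f : A →ₗ[ℝ] A) (a : A) : of f a = f a := rfl

@[ext] theorem ext {x y : Op A} (h : ∀ a, x a = y a) : x = y := LinearMap.ext h

@[simp] theorem add_apply (x y : Op A) (a : A) : (x + y) a = x a + y a := rfl
@[simp] theorem sub_apply (x y : Op A) (a : A) : (x - y) a = x a - y a := rfl
@[simp] theorem neg_apply (x : Op A) (a : A) : (-x) a = -x a := rfl
@[simp] theorem zero_apply (a : A) : (0 : Op A) a = 0 := rfl
@[simp] theorem one_apply (a : A) : (1 : Op A) a = a := rfl
@[simp] theorem mul_apply (x y : Op A) (a : A) : (x * y) a = x (y a) := rfl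
@[simp] theorem smul_apply (r : ℝ) (x : Op A) (a : A) : (r • x) a = r • x a := rfl

@[simp] theorem sum_apply {ι : Type*} (s : Finset ι) (x : ι → Op A) (a : A) :
    (∑ i ∈ s, x i) a = ∑ i ∈ s, x i a := by
  classical
  induction s using Finset.induction_on with
  | empty => simp
  | insert i s h ih => rw [Finset.sum_insert h, Finset.sum_insert h, add_apply, ih]

end Op

variable {C : Type*} [Ring C] [Algebra ℝ C] {𝒜 : ℕ → Submodule ℝ C} [GradedAlgebra 𝒜]
  {I τ : Type*} {e : HomogeneousBasis 𝒜 I} {A : Type*} [Ring A] [Algebra ℝ A]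

namespace SuperCalculus

variable (S : SuperCalculus (ghost e.deg τ) A)

/-- The constant vector field in the direction `T_b ⊗ u`. -/
def dir (b : τ) : C →ₗ[ℝ] Op A :=
  e.basis.constr ℝ fun i => Op.of (S.pderiv (i, b))

@[simp] theorem dir_basis (b : τ) (i : I) : S.dir b (e.basis i) = Op.of (S.pderiv (i, b)) :=
  e.basis.constr_basis ℝ _ i

/-- Left multiplication as an operator. -/
def mul (f : A) : Op A := Op.of (LinearMap.mulLeft ℝ f)

@[simp] theorem mul_apply' (f g : A) : mul f g = f * g := rfl

theorem dir_one (b : τ) (u : C) : S.dir b u 1 = 0 := by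
  refine e.induction (p := fun u => S.dir b u 1 = 0) (by simp) ?_ ?_ ?_ u
  · intro x y hx hy; rw [map_add, Op.add_apply, hx, hy, add_zero]
  · intro r x hx; rw [map_smul, Op.smul_apply, hx, smul_zero]
  · intro i; rw [S.dir_basis, Op.of_apply, S.pderiv_one]

theorem dir_algebraMap (b : τ) (u : C) (r : ℝ) : S.dir b u (algebraMap ℝ A r) = 0 := by
  rw [Algebra.algebraMap_eq_smul_one, map_smul, S.dir_one, smul_zero]

theorem dir_mul_even {n : ℕ} {f : A} (hf : f ∈ S.wt n 0) (b : τ) (u : C) (g : A) :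
    S.dir b u (f * g) = S.dir b u f * g + f * S.dir b u g := by
  refine e.induction (p := fun u => S.dir b u (f * g) = S.dir b u f * g + f * S.dir b u g)
    (by simp) ?_ ?_ ?_ u
  · intro x y hx hy
    simp only [map_add, Op.add_apply, hx, hy, add_mul, mul_add]; abel
  · intro r x hx
    simp only [map_smul, Op.smul_apply, hx, smul_add, smul_mul_assoc, mul_smul_comm]
  · intro i; rw [S.dir_basis, Op.of_apply, S.leibniz hf]; simp

theorem neg_one_zpow_ghost (i : I) (b : τ) (g : ℤ) (hg : Odd g) :
    (-1 : ℝ) ^ (ghost e.deg τ (i, b) * g) = -(-1 : ℝ) ^ e.deg i := by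
  rcases Nat.even_or_odd (e.deg i) with h | h
  · have : Odd (ghost e.deg τ (i, b)) := by
      have h' : Even (e.deg i : ℤ) := by exact_mod_cast h
      exact odd_one.sub_even h'
    rw [(this.mul hg).neg_one_zpow, h.neg_one_pow]
  · have : Even (ghost e.deg τ (i, b)) := by
      have h' : Odd (e.deg i : ℤ) := by exact_mod_cast h
      exact odd_one.sub_odd h'
    rw [(this.mul_right g).neg_one_zpow, h.neg_one_pow, neg_neg]

/-- Passing an odd function costs -(-1)^|u|. Absorbing this sign into `e.sign u` keeps the rule
linear in `u`, so that it holds for inhomogeneous directions as well. -/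
theorem dir_mul_odd {n : ℕ} {g : ℤ} (hg : Odd g) {f : A} (hf : f ∈ S.wt n g) (b : τ) (u : C)
    (f' : A) : S.dir b u (f * f') = S.dir b u f * f' - f * S.dir b (e.sign u) f' := by
  refine e.induction (p := fun u => S.dir b u (f * f') =
    S.dir b u f * f' - f * S.dir b (e.sign u) f') (by simp) ?_ ?_ ?_ u
  · intro x y hx hy
    simp only [map_add, Op.add_apply, hx, hy, add_mul, mul_add]; abel
  · intro r x hx
    simp only [map_smul, Op.smul_apply, hx, smul_sub, smul_mul_assoc, mul_smul_comm]
  · intro i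
    rw [S.dir_basis, Op.of_apply, S.leibniz hf, e.sign_basis, map_smul, S.dir_basis, Op.of_apply, neg_one_zpow_ghost _ _ _ hg,
      Op.smul_apply, mul_smul_comm, neg_smul,
      sub_eq_add_neg, Op.of_apply]

/-- Because of the shift in `𝔤 ⊗ C[1]`, directions of odd degree give even derivations, which
commute with every constant field. -/
theorem dir_comm_of_sign_neg {w : C} (hw : e.sign w = -w) (a b : τ) (u : C) :
    S.dir a u * S.dir b w = S.dir b w * S.dir a u := by
  -- The map `w ↦ w - e.sign w` is twice the projection onto odd degrees. It is linear in an
  -- arbitrary `w`, so induction over the basis is available.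
  have key : ∀ w : C, S.dir a u * S.dir b (w - e.sign w) = S.dir b (w - e.sign w) * S.dir a u := by
    intro w
    refine e.induction (p := fun w => S.dir a u * S.dir b (w - e.sign w) =
      S.dir b (w - e.sign w) * S.dir a u) (by simp) ?_ ?_ ?_ w
    · intro x y hx hy
      rw [map_add e.sign, add_sub_add_comm, map_add, mul_add, hx, hy, add_mul]
    · intro r x hx
      rw [map_smul, ← smul_sub, map_smul, mul_smul_comm, hx, smul_mul_assoc]
    intro j
    rcases Nat.even_or_odd (e.deg j) with h | h
    · rw [e.sign_basis, h.neg_one_pow]; simp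
    · refine e.induction (p := fun u => S.dir a u * S.dir b (e.basis j - e.sign (e.basis j)) =
        S.dir b (e.basis j - e.sign (e.basis j)) * S.dir a u) (by simp) ?_ ?_ ?_ u
      · intro x y hx hy; rw [map_add, add_mul, hx, hy, mul_add]
      · intro r x hx; rw [map_smul, smul_mul_assoc, hx, mul_smul_comm]
      intro i
      have h2 : e.basis j - e.sign (e.basis j) = (2 : ℝ) • e.basis j := by
        rw [e.sign_basis, h.neg_one_pow, neg_one_smul, sub_neg_eq_add, two_smul]
      rw [h2, map_smul, mul_smul_comm, smul_mul_assoc]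
      congr 1
      ext f
      simp only [dir_basis, Op.of_apply, Op.mul_apply]
      rw [S.pderiv_comm]
      have : Even (ghost e.deg τ (j, b)) := by
        have h' : Odd (e.deg j : ℤ) := by exact_mod_cast h
        exact odd_one.sub_odd h'
      rw [(this.mul_left _).neg_one_zpow, one_smul]
  have h2 : w = (1 / 2 : ℝ) • (w - e.sign w) := by
    rw [hw, sub_neg_eq_add, ← two_smul ℝ, smul_smul]; norm_num
  rw [h2, map_smul, mul_smul_comm, key, smul_mul_assoc]

theorem dir_comm_of_sign {w : C} (hw : e.sign w = w) (a b : τ) (u : C) :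
    S.dir a u * S.dir b w = -(S.dir b w * S.dir a (e.sign u)) := by
  have key : ∀ w : C, S.dir a u * S.dir b (w + e.sign w) =
      -(S.dir b (w + e.sign w) * S.dir a (e.sign u)) := by
    intro w
    refine e.induction (p := fun w => S.dir a u * S.dir b (w + e.sign w) =
      -(S.dir b (w + e.sign w) * S.dir a (e.sign u))) (by simp) ?_ ?_ ?_ w
    · intro x y hx hy
      rw [map_add e.sign, add_add_add_comm, map_add, mul_add, hx, hy, add_mul, neg_add]
    · intro r x hx
      rw [map_smul, ← smul_add, map_smul, mul_smul_comm, hx, smul_mul_assoc, smul_neg]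
    intro j
    rcases Nat.even_or_odd (e.deg j) with h | h
    · refine e.induction (p := fun u => S.dir a u * S.dir b (e.basis j + e.sign (e.basis j)) =
        -(S.dir b (e.basis j + e.sign (e.basis j)) * S.dir a (e.sign u))) (by simp) ?_ ?_ ?_ u
      · intro x y hx hy
        rw [map_add (S.dir a), add_mul, hx, hy, map_add e.sign, map_add (S.dir a), mul_add, neg_add]
      · intro r x hx
        rw [map_smul, smul_mul_assoc, hx, map_smul, map_smul, mul_smul_comm, smul_neg]
      intro i
      have h2 : e.basis j + e.sign (e.basis j) = (2 : ℝ) • e.basis j := by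
        rw [e.sign_basis, h.neg_one_pow, one_smul, two_smul]
      rw [h2, map_smul, mul_smul_comm, smul_mul_assoc, ← smul_neg]
      congr 1
      ext f
      simp only [dir_basis, Op.of_apply, Op.mul_apply, e.sign_basis, map_smul, Op.neg_apply,
        Op.smul_apply]
      rw [S.pderiv_comm]
      have : Odd (ghost e.deg τ (j, b)) := by
        have h' : Even (e.deg j : ℤ) := by exact_mod_cast h
        exact odd_one.sub_even h'
      rw [neg_one_zpow_ghost _ _ _ this, neg_smul]
    · rw [e.sign_basis, h.neg_one_pow]; simp
  have h2 : w = (1 / 2 : ℝ) • (w + e.sign w) := by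
    rw [hw, ← two_smul ℝ, smul_smul]; norm_num
  rw [h2, map_smul, mul_smul_comm, key, smul_mul_assoc, smul_neg]

variable [Fintype I] [DecidableEq I] [Fintype τ] (D : DGFrobenius 𝒜)

/-- The second order operator with kernel `∑ N ē^m ⊗ e_m` and Lie algebra matrix `ρ`. -/
def lap (N : C →ₗ[ℝ] C) (ρ : Matrix τ τ ℝ) : Op A :=
  ∑ a, ∑ b, ρ a b • ∑ m, S.dir a (N (D.dual e m)) * S.dir b (e.basis m)

theorem lap_add (N N' : C →ₗ[ℝ] C) (ρ : Matrix τ τ ℝ) :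
    S.lap D (N + N') ρ = S.lap D N ρ + S.lap D N' ρ := by
  simp [lap, -dir_basis, add_mul, Finset.sum_add_distrib]

theorem lap_smul (r : ℝ) (N : C →ₗ[ℝ] C) (ρ : Matrix τ τ ℝ) :
    S.lap D (r • N) ρ = r • S.lap D N ρ := by
  simp only [lap, LinearMap.smul_apply, map_smul, smul_mul_assoc, ← Finset.smul_sum]
  simp only [Finset.smul_sum, smul_comm r]

theorem lap_neg (N : C →ₗ[ℝ] C) (ρ : Matrix τ τ ℝ) : S.lap D (-N) ρ = -S.lap D N ρ := by
  rw [← neg_one_smul ℝ N, lap_smul, neg_one_smul]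

theorem lap_sub (N N' : C →ₗ[ℝ] C) (ρ : Matrix τ τ ℝ) :
    S.lap D (N - N') ρ = S.lap D N ρ - S.lap D N' ρ := by
  rw [sub_eq_add_neg, lap_add, lap_neg, sub_eq_add_neg]

theorem lap_zero (ρ : Matrix τ τ ℝ) : S.lap D (0 : C →ₗ[ℝ] C) ρ = 0 := by simp [lap]

theorem lap_neg_right (N : C →ₗ[ℝ] C) (ρ : Matrix τ τ ℝ) : S.lap D N (-ρ) = -S.lap D N ρ := by
  simp [lap, -dir_basis]

/-- Commutation of constant vector fields with even second order operators. -/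
theorem dir_mul_lap_of_odd {N : C →ₗ[ℝ] C} (hN : ∀ a, e.sign (N a) = -N (e.sign a))
    (ρ : Matrix τ τ ℝ) (c : τ) (u : C) : S.dir c u * S.lap D N ρ = S.lap D N ρ * S.dir c u := by
  simp only [lap, Finset.mul_sum, Finset.sum_mul, mul_smul_comm, smul_mul_assoc]
  refine Finset.sum_congr rfl fun a _ => Finset.sum_congr rfl fun b _ => ?_
  congr 1
  refine Finset.sum_congr rfl fun m _ => ?_
  rcases Nat.even_or_odd (e.deg m) with h | h
  · have h1 : e.sign (e.basis m) = e.basis m := by rw [e.sign_basis, h.neg_one_pow, one_smul]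
    have h2 : e.sign (N (D.dual e m)) = N (D.dual e m) := by
      rw [hN, D.sign_dual, h.neg_one_pow, neg_one_smul, map_neg, neg_neg]
    rw [← mul_assoc, S.dir_comm_of_sign h2, neg_mul, mul_assoc, S.dir_comm_of_sign h1, e.sign_sign,
      mul_neg, neg_neg, mul_assoc]
  · have h1 : e.sign (e.basis m) = -e.basis m := by rw [e.sign_basis, h.neg_one_pow, neg_one_smul]
    have h2 : e.sign (N (D.dual e m)) = -N (D.dual e m) := by
      rw [hN, D.sign_dual, h.neg_one_pow, neg_neg, one_smul]
    rw [← mul_assoc, S.dir_comm_of_sign_neg h2, mul_assoc, S.dir_comm_of_sign_neg h1, mul_assoc]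

/-- The kernel Σ ē^m ⊗ e_m has total degree three, so an `N` that preserves parity gives an odd
operator, while a propagator, which reverses parity, gives an even one. -/
theorem dir_mul_lap_of_even {N : C →ₗ[ℝ] C} (hN : ∀ a, e.sign (N a) = N (e.sign a))
    (ρ : Matrix τ τ ℝ) (c : τ) (u : C) :
    S.dir c u * S.lap D N ρ = -(S.lap D N ρ * S.dir c (e.sign u)) := by
  simp only [lap, Finset.mul_sum, Finset.sum_mul, mul_smul_comm, smul_mul_assoc,
    ← Finset.sum_neg_distrib, ← smul_neg]
  refine Finset.sum_congr rfl fun a _ => Finset.sum_congr rfl fun b _ => ?_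
  congr 1
  refine Finset.sum_congr rfl fun m _ => ?_
  rcases Nat.even_or_odd (e.deg m) with h | h
  · have h1 : e.sign (e.basis m) = e.basis m := by rw [e.sign_basis, h.neg_one_pow, one_smul]
    have h2 : e.sign (N (D.dual e m)) = -N (D.dual e m) := by
      rw [hN, D.sign_dual, h.neg_one_pow, neg_one_smul, map_neg]
    rw [← mul_assoc, S.dir_comm_of_sign_neg h2, mul_assoc, S.dir_comm_of_sign h1,
      mul_neg, mul_assoc]
  · have h1 : e.sign (e.basis m) = -e.basis m := by rw [e.sign_basis, h.neg_one_pow, neg_one_smul]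
    have h2 : e.sign (N (D.dual e m)) = N (D.dual e m) := by
      rw [hN, D.sign_dual, h.neg_one_pow, neg_neg, one_smul]
    rw [← mul_assoc, S.dir_comm_of_sign h2, neg_mul, mul_assoc, S.dir_comm_of_sign_neg h1,
      mul_assoc]

/-- Even second order operators commute with all operators that commute with the constant vector
fields. -/
theorem lap_mul_comm {N N' : C →ₗ[ℝ] C} (hN : ∀ a, e.sign (N a) = -N (e.sign a))
    (ρ ρ' : Matrix τ τ ℝ) : S.lap D N ρ * S.lap D N' ρ' = S.lap D N' ρ' * S.lap D N ρ := by
  conv_lhs => rw [lap.eq_def S D N']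
  conv_rhs => rw [lap.eq_def S D N']
  simp only [Finset.mul_sum, Finset.sum_mul, mul_smul_comm, smul_mul_assoc]
  refine Finset.sum_congr rfl fun a _ => Finset.sum_congr rfl fun b _ => ?_
  congr 1
  refine Finset.sum_congr rfl fun m _ => ?_
  rw [← mul_assoc, ← S.dir_mul_lap_of_odd D hN, mul_assoc, ← S.dir_mul_lap_of_odd D hN, mul_assoc]

/-- An odd operator `Y` that behaves like the linear vector field with matrix `N ⊗ ρ`. -/
def IsOddField (Y : Op A) (N : C →ₗ[ℝ] C) (ρ : Matrix τ τ ℝ) : Prop :=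
  ∀ b u, S.dir b u * Y = ∑ d, ρ b d • S.dir d (N u) - Y * S.dir b (e.sign u)

/-- `N'` is the transpose of `N` for the pairing. -/
def _root_.AbstractCS.DGFrobenius.IsTranspose (D : DGFrobenius 𝒜) (N N' : C →ₗ[ℝ] C) : Prop :=
  ∀ u w, D.π (N u) w = D.π u (N' w)

/-- Bilinear maps on `C` given by composing constant vector fields. -/
def dirMul (a b : τ) : C →ₗ[ℝ] C →ₗ[ℝ] Op A :=
  (LinearMap.mul ℝ (Op A)).compl₁₂ (S.dir a) (S.dir b)

theorem sum_dual_transpose {P N N' : C →ₗ[ℝ] C} (h : D.IsTranspose N N') (a b : τ) :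
    ∑ m, S.dir a (P (D.dual e m)) * S.dir b (N (e.basis m)) =
      ∑ m, S.dir a (P (N' (D.dual e m))) * S.dir b (e.basis m) :=
  D.sum_dual_basis_transpose e h ((S.dirMul a b).comp P)

theorem isTranspose_sign : D.IsTranspose e.sign (-e.sign) := fun u w => by
  rw [D.π_sign]; simp

/-- `Y` passes the two derivatives one after the other, and each passage leaves behind a constant
field. For the leg `e_m` the matrix `NY` is carried over to the dual leg as the transpose `NYt`; for
the dual leg it acts in place, with an `e.sign` because `Y` has already passed the other leg. -/
theorem lap_mul_oddField {Y : Op A} {NY NYt : C →ₗ[ℝ] C} {ρY : Matrix τ τ ℝ}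
    (hY : S.IsOddField Y NY ρY) (ht : D.IsTranspose NY NYt) (N : C →ₗ[ℝ] C) (ρ : Matrix τ τ ℝ) :
    S.lap D N ρ * Y = S.lap D (N ∘ₗ NYt) (ρ * ρY) + S.lap D (NY ∘ₗ N ∘ₗ e.sign) (ρY.transpose * ρ)
      - Y * S.lap D (e.sign ∘ₗ N ∘ₗ e.sign) ρ := by
  have step : ∀ a b, (∑ m, S.dir a (N (D.dual e m)) * S.dir b (e.basis m)) * Y =
      ∑ d, ρY b d • (∑ m, S.dir a (N (NYt (D.dual e m))) * S.dir d (e.basis m)) +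
      ∑ d, ρY a d • (∑ m, S.dir d (NY (N (e.sign (D.dual e m)))) * S.dir b (e.basis m)) -
      Y * (∑ m, S.dir a (e.sign (N (e.sign (D.dual e m)))) * S.dir b (e.basis m)) := by
    intro a b
    have h1 : ∀ d, ∑ m, S.dir a (N (NYt (D.dual e m))) * S.dir d (e.basis m) =
        ∑ m, S.dir a (N (D.dual e m)) * S.dir d (NY (e.basis m)) := fun d =>
      (S.sum_dual_transpose D ht a d).symm
    have h2 : ∀ d, ∑ m, S.dir d (NY (N (e.sign (D.dual e m)))) * S.dir b (e.basis m) =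
        -∑ m, S.dir d (NY (N (D.dual e m))) * S.dir b (e.sign (e.basis m)) := by
      intro d
      have := S.sum_dual_transpose D (P := NY ∘ₗ N) (isTranspose_sign (e := e) D) d b
      simp only [LinearMap.comp_apply, LinearMap.neg_apply, map_neg, neg_mul,
        Finset.sum_neg_distrib] at this
      rw [this, neg_neg]
    have h3 : ∑ m, S.dir a (e.sign (N (e.sign (D.dual e m)))) * S.dir b (e.basis m) =
        -∑ m, S.dir a (e.sign (N (D.dual e m))) * S.dir b (e.sign (e.basis m)) := by
      have := S.sum_dual_transpose D (P := e.sign ∘ₗ N) (isTranspose_sign (e := e) D) a b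
      simp only [LinearMap.comp_apply, LinearMap.neg_apply, map_neg, neg_mul,
        Finset.sum_neg_distrib] at this
      rw [this, neg_neg]
    simp only [h1, h2, h3]
    have h4 : ∀ m, S.dir a (N (D.dual e m)) * S.dir b (e.basis m) * Y =
        ∑ d, ρY b d • (S.dir a (N (D.dual e m)) * S.dir d (NY (e.basis m))) -
        (∑ d, ρY a d • (S.dir d (NY (N (D.dual e m))) * S.dir b (e.sign (e.basis m))) -
        Y * (S.dir a (e.sign (N (D.dual e m))) * S.dir b (e.sign (e.basis m)))) := by
      intro m
      rw [mul_assoc, hY, mul_sub, ← mul_assoc _ Y, hY, sub_mul, Finset.mul_sum, Finset.sum_mul,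
        mul_assoc]
      simp only [mul_smul_comm, smul_mul_assoc]
    simp only [Finset.sum_mul, h4, Finset.sum_sub_distrib, mul_neg, smul_neg,
      Finset.sum_neg_distrib, Finset.smul_sum, Finset.mul_sum]
    rw [Finset.sum_comm]
    conv_lhs => enter [2, 1]; rw [Finset.sum_comm]
    abel
  have e1 : S.lap D (N ∘ₗ NYt) (ρ * ρY) = ∑ a, ∑ b, ρ a b •
      ∑ d, ρY b d • (∑ m, S.dir a (N (NYt (D.dual e m))) * S.dir d (e.basis m)) := by
    simp only [lap, Matrix.mul_apply, Finset.sum_smul, LinearMap.comp_apply, mul_smul]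
    refine Finset.sum_congr rfl fun a _ => ?_
    rw [Finset.sum_comm]
    exact Finset.sum_congr rfl fun b _ => by rw [Finset.smul_sum]
  have e2 : S.lap D (NY ∘ₗ N ∘ₗ e.sign) (ρY.transpose * ρ) = ∑ a, ∑ b, ρ a b •
      ∑ d, ρY a d • (∑ m, S.dir d (NY (N (e.sign (D.dual e m)))) * S.dir b (e.basis m)) := by
    have h : ∀ a b, ρ a b •
        ∑ d, ρY a d • (∑ m, S.dir d (NY (N (e.sign (D.dual e m)))) * S.dir b (e.basis m)) =
        ∑ d, (ρY a d * ρ a b) •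
          (∑ m, S.dir d (NY (N (e.sign (D.dual e m)))) * S.dir b (e.basis m)) := by
      intro a b
      rw [Finset.smul_sum]
      exact Finset.sum_congr rfl fun d _ => by rw [smul_smul, mul_comm]
    simp only [h, lap, Matrix.mul_apply, Finset.sum_smul, LinearMap.comp_apply,
      Matrix.transpose_apply]
    rw [Finset.sum_comm]
    conv_rhs => rw [Finset.sum_comm]
    refine Finset.sum_congr rfl fun b _ => ?_
    rw [Finset.sum_comm]
  rw [e1, e2, lap.eq_def S D N, lap.eq_def S D (e.sign ∘ₗ N ∘ₗ e.sign)]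
  simp only [Finset.sum_mul, smul_mul_assoc, step, smul_sub, smul_add, Finset.sum_add_distrib,
    Finset.sum_sub_distrib, Finset.mul_sum, mul_smul_comm, LinearMap.comp_apply]

end SuperCalculus

end AbstractCS

/-! ### The algebra of propagators. -/

namespace AbstractCS

variable {C : Type*} [Ring C] [Algebra ℝ C] {𝒜 : ℕ → Submodule ℝ C} [GradedAlgebra 𝒜]
  {I : Type*}

namespace DGFrobenius

variable (D : DGFrobenius 𝒜) (e : HomogeneousBasis 𝒜 I) [Fintype I] [DecidableEq I]

/-- The projection onto harmonic representatives `1`, `v` of the classes in degrees `0`, `3`. -/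
def harmonic (v : C) : C →ₗ[ℝ] C :=
  (D.π.flip v).smulRight 1 + (D.π.flip 1).smulRight v

theorem harmonic_apply (v a : C) : D.harmonic v a = D.π a v • (1 : C) + D.π a 1 • v := by
  simp [harmonic]

/-- Relaxed induction data when cohomology is spanned by the classes of `1` and `v`. -/
structure IsPropagator (v : C) (K : C →ₗ[ℝ] C) : Prop where
  v_mem : v ∈ 𝒜 3
  d_v : D.d v = 0
  π_one_v : D.π 1 v = 1
  mem : ∀ i a, a ∈ 𝒜 (i + 1) → K a ∈ 𝒜 i
  mem_zero : ∀ a, a ∈ 𝒜 0 → K a = 0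
  homotopy : ∀ a, D.d (K a) + K (D.d a) = a - D.harmonic v a
  symm : ∀ a b, D.π (K a) b = D.π a (K (e.sign b))
  map_one : K 1 = 0
  map_v : K v = 0

variable {D e}

theorem one_mem_zero : (1 : C) ∈ 𝒜 0 := SetLike.GradedOne.one_mem

variable (D e) in
theorem sign_d (a : C) : e.sign (D.d a) = -D.d (e.sign a) :=
  e.sign_comp_odd (fun i a ha => ⟨i + 1, D.d_mem i a ha, by simp [← add_assoc, ← two_mul]⟩) a

variable (D e) in
theorem π_d_left (a b : C) : D.π (D.d a) b = -D.π a (D.d (e.sign b)) := by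
  have key : ∀ a, D.π (D.d a) b = -D.π (e.sign a) (D.d b) := by
    intro a
    refine e.induction (p := fun a => D.π (D.d a) b = -D.π (e.sign a) (D.d b)) (by simp)
      ?_ ?_ ?_ a
    · intro x y hx hy; simp only [map_add, LinearMap.add_apply, hx, hy, neg_add]
    · intro r x hx; simp only [map_smul, LinearMap.smul_apply, hx, smul_neg]
    · intro i
      have := D.π_d _ _ b (e.mem i)
      rw [e.sign_basis, map_smul, LinearMap.smul_apply, smul_eq_mul]
      linarith
  rw [key, D.π_sign, sign_d D e]
  simp

theorem π_one_d (D : DGFrobenius 𝒜) (a : C) : D.π 1 (D.d a) = 0 := by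
  have := D.π_d 0 1 a one_mem_zero
  rw [D.d_one] at this
  simpa using this

namespace IsPropagator

variable {v v₀ v₁ : C} {K K₀ K₁ : C →ₗ[ℝ] C}

theorem π_one_one (D : DGFrobenius 𝒜) : D.π (1 : C) 1 = 0 :=
  D.π_degree 0 0 _ _ one_mem_zero one_mem_zero (by norm_num)

theorem sign_K (h : D.IsPropagator e v K) (a : C) : e.sign (K a) = -K (e.sign a) := by
  refine e.sign_comp_odd (fun i a ha => ?_) a
  cases i with
  | zero => exact ⟨1, by rw [h.mem_zero a ha]; exact Submodule.zero_mem _, by norm_num⟩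
  | succ i => exact ⟨i, h.mem i a ha, by simp [add_right_comm, ← two_mul]⟩

theorem K_harmonic (h : D.IsPropagator e v K) (a : C) : K (D.harmonic v a) = 0 := by
  rw [harmonic_apply, map_add, map_smul, map_smul, h.map_one, h.map_v, smul_zero, smul_zero,
    add_zero]

theorem harmonic_K (h : D.IsPropagator e v K) (a : C) : D.harmonic v (K a) = 0 := by
  have hv : e.sign v = -v := by rw [e.sign_of_mem h.v_mem]; norm_num
  rw [harmonic_apply, h.symm, h.symm, hv, e.sign_one, map_neg, h.map_v, h.map_one]
  simp

theorem dK (h : D.IsPropagator e v K) (a : C) : D.d (K a) = a - D.harmonic v a - K (D.d a) := by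
  rw [← h.homotopy a]; abel

/-- A closed operator of degree `-3` that annihilates harmonic representatives vanishes. -/
theorem eq_zero_of_closed (h : D.IsPropagator e v K) {N : C →ₗ[ℝ] C}
    (h0 : ∀ i a, a ∈ 𝒜 i → i ≠ 3 → N a = 0) (hP : ∀ a, N (D.harmonic v a) = 0)
    (hd : ∀ a, D.d (N a) + N (D.d a) = 0) (a : C) : N a = 0 := by
  refine e.induction (p := fun a => N a = 0) (by simp) ?_ ?_ ?_ a
  · intro x y hx hy; rw [map_add, hx, hy, add_zero]
  · intro r x hx; rw [map_smul, hx, smul_zero]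
  intro i
  by_cases hi : e.deg i = 3
  · have hmem := e.mem i
    rw [hi] at hmem
    have hda : D.d (e.basis i) = 0 :=
      D.eq_zero_of_mem_of_lt e (by norm_num) (D.d_mem _ _ hmem)
    have h1 := h.homotopy (e.basis i)
    rw [hda, map_zero, add_zero] at h1
    -- In top degree a vector is exact plus harmonic. On the exact part N(dKa) = -dN(Ka), which
    -- vanishes because Ka has degree two.
    have h2 : e.basis i = D.d (K (e.basis i)) + D.harmonic v (e.basis i) := by rw [h1]; abel
    have h3 := hd (K (e.basis i))
    rw [h0 2 _ (h.mem 2 _ hmem) (by norm_num), map_zero, zero_add] at h3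
    rw [h2, map_add, h3, hP, add_zero]
  · exact h0 _ _ (e.mem i) hi

theorem triple_eq_zero (h₀ : D.IsPropagator e v₀ K₀) (h₁ : D.IsPropagator e v₁ K₁)
    {v₂ : C} {K₂ : C →ₗ[ℝ] C} (h₂ : D.IsPropagator e v₂ K₂) {i : ℕ} {a : C} (ha : a ∈ 𝒜 i)
    (hi : i ≠ 3) : K₀ (K₁ (K₂ a)) = 0 := by
  rcases i with _ | _ | _ | _ | i
  · rw [h₂.mem_zero a ha]; simp
  · rw [h₁.mem_zero _ (h₂.mem _ a ha), map_zero]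
  · rw [h₀.mem_zero _ (h₁.mem _ _ (h₂.mem _ a ha))]
  · exact absurd rfl hi
  · rw [D.eq_zero_of_mem_of_lt e (by omega) ha]; simp

/-- Moving `d` through the product removes one propagator at a time with alternating sign; the
harmonic terms drop out, since the projector and a propagator annihilate each other in both orders.
-/
theorem d_triple {K₂ : C →ₗ[ℝ] C} (h₀ : D.IsPropagator e v K₀) (h₁ : D.IsPropagator e v K₁)
    (h₂ : D.IsPropagator e v K₂) (a : C) :
    D.d (K₀ (K₁ (K₂ a))) + K₀ (K₁ (K₂ (D.d a))) = K₁ (K₂ a) - K₀ (K₂ a) + K₀ (K₁ a) := by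
  simp only [h₀.dK, h₁.dK, h₂.dK, map_sub, h₁.harmonic_K, h₂.harmonic_K, h₁.K_harmonic,
    map_zero]
  abel

/-- By `d_triple` both triple products have the same graded commutator K₁K₁ with d, so their
difference is closed of degree -3 and `eq_zero_of_closed` applies. The companion with K₀K₀ in front
works in the same way. -/
theorem K₀_K₁_K₁ (h₀ : D.IsPropagator e v K₀) (h₁ : D.IsPropagator e v K₁) (a : C) :
    K₀ (K₁ (K₁ a)) = K₁ (K₁ (K₁ a)) := by
  have := h₀.eq_zero_of_closed (N := K₀ ∘ₗ K₁ ∘ₗ K₁ - K₁ ∘ₗ K₁ ∘ₗ K₁) ?_ ?_ ?_ a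
  · simpa [sub_eq_zero] using this
  · intro i a ha hi
    simp [triple_eq_zero h₀ h₁ h₁ ha hi, triple_eq_zero h₁ h₁ h₁ ha hi]
  · intro a; simp [h₁.K_harmonic]
  · intro a
    have e1 := d_triple h₀ h₁ h₁ a
    have e2 := d_triple h₁ h₁ h₁ a
    simp only [LinearMap.sub_apply, LinearMap.comp_apply, map_sub]
    rw [sub_add_sub_comm, e1, e2]
    abel

theorem K₀_K₀_K₁ (h₀ : D.IsPropagator e v K₀) (h₁ : D.IsPropagator e v K₁) (a : C) :
    K₀ (K₀ (K₁ a)) = K₀ (K₀ (K₀ a)) := by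
  have := h₀.eq_zero_of_closed (N := K₀ ∘ₗ K₀ ∘ₗ K₁ - K₀ ∘ₗ K₀ ∘ₗ K₀) ?_ ?_ ?_ a
  · simpa [sub_eq_zero] using this
  · intro i a ha hi
    simp [triple_eq_zero h₀ h₀ h₁ ha hi, triple_eq_zero h₀ h₀ h₀ ha hi]
  · intro a; simp [h₁.K_harmonic, h₀.K_harmonic]
  · intro a
    have e1 := d_triple h₀ h₀ h₁ a
    have e2 := d_triple h₀ h₀ h₀ a
    simp only [LinearMap.sub_apply, LinearMap.comp_apply, map_sub]
    rw [sub_add_sub_comm, e1, e2]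
    abel

/-- Both sides have graded commutator K₀K₀ - K₁K₁ with d: the mixed terms K₀K₁ + K₁K₀ are common to
the two products on the left. -/
theorem K₁_K₀_K₁_sub (h₀ : D.IsPropagator e v K₀) (h₁ : D.IsPropagator e v K₁) (a : C) :
    K₁ (K₀ (K₁ a)) - K₀ (K₁ (K₀ a)) = K₀ (K₀ (K₀ a)) - K₁ (K₁ (K₁ a)) := by
  have := h₀.eq_zero_of_closed (N := K₁ ∘ₗ K₀ ∘ₗ K₁ - K₀ ∘ₗ K₁ ∘ₗ K₀ -
    (K₀ ∘ₗ K₀ ∘ₗ K₀ - K₁ ∘ₗ K₁ ∘ₗ K₁)) ?_ ?_ ?_ a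
  · simpa [sub_eq_zero] using this
  · intro i a ha hi
    simp [triple_eq_zero h₀ h₁ h₀ ha hi, triple_eq_zero h₁ h₀ h₁ ha hi,
      triple_eq_zero h₀ h₀ h₀ ha hi, triple_eq_zero h₁ h₁ h₁ ha hi]
  · intro a; simp [h₁.K_harmonic, h₀.K_harmonic]
  · intro a
    have e1 := d_triple h₀ h₁ h₀ a
    have e2 := d_triple h₁ h₀ h₁ a
    have e3 := d_triple h₀ h₀ h₀ a
    have e4 := d_triple h₁ h₁ h₁ a
    simp only [LinearMap.sub_apply, LinearMap.comp_apply, map_sub]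
    have : ∀ x1 x2 x3 x4 y1 y2 y3 y4 : C, (x1 - x2 - (x3 - x4)) + (y1 - y2 - (y3 - y4)) =
      ((x1 + y1) - (x2 + y2)) - ((x3 + y3) - (x4 + y4)) := by intros; abel
    rw [this, e1, e2, e3, e4]
    abel

/-- The chain homotopy between two propagators with the same harmonic representatives. -/
theorem sub_eq_commutator (h₀ : D.IsPropagator e v K₀) (h₁ : D.IsPropagator e v K₁) (a : C) :
    D.d (K₀ (K₁ a)) - K₀ (K₁ (D.d a)) = K₁ a - K₀ a := by
  simp only [h₀.dK, h₁.dK, map_sub, h₁.harmonic_K, h₀.K_harmonic]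
  abel

/-- Every propagator can be replaced by a strict one with the same harmonic representatives. -/
theorem strictify (h : D.IsPropagator e v K) :
    D.IsPropagator e v (K ∘ₗ D.d ∘ₗ K) ∧ ∀ a, (K ∘ₗ D.d ∘ₗ K) ((K ∘ₗ D.d ∘ₗ K) a) = 0 := by
  refine ⟨⟨h.v_mem, h.d_v, h.π_one_v, ?_, ?_, ?_, ?_, ?_, ?_⟩, ?_⟩
  · intro i a ha
    cases i with
    | zero =>
      exact h.mem _ _ (D.d_mem _ _ (h.mem _ _ ha))
    | succ i => exact h.mem _ _ (D.d_mem _ _ (h.mem _ _ ha))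
  · intro a ha; simp [h.mem_zero a ha]
  · intro a
    simp only [LinearMap.comp_apply, h.dK, map_sub, D.d_d, h.harmonic_K, h.K_harmonic,
      map_zero]
    abel
  · intro a b
    simp only [LinearMap.comp_apply]
    rw [h.symm, π_d_left D e, h.symm, sign_d D e]
    simp [h.sign_K]
  · simp [h.map_one]
  · simp [h.map_v]
  -- K² commutes with d, because [d,K] = 1 - P and PK = KP = 0. Hence (KdK)² = K·K²·d·d·K = 0.
  · intro a
    simp only [LinearMap.comp_apply, h.dK, map_sub, D.d_d, h.harmonic_K, h.K_harmonic,
      map_zero]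
    abel

/-- The rank two correction of a propagator under a change of the harmonic representative. -/
def _root_.AbstractCS.DGFrobenius.shift (D : DGFrobenius 𝒜) (w : C) : C →ₗ[ℝ] C :=
  (D.π.flip w).smulRight 1 - (D.π.flip 1).smulRight w

theorem shift_apply (D : DGFrobenius 𝒜) (w a : C) :
    D.shift w a = D.π a w • (1 : C) - D.π a 1 • w := by simp [shift]

theorem π_K_one (h : D.IsPropagator e v K) (a : C) : D.π (K a) 1 = 0 := by
  rw [h.symm, e.sign_one, h.map_one, map_zero]

/-- Change of the harmonic representative in degree three. -/
theorem add_shift (h : D.IsPropagator e v K) (hv₁ : v₁ ∈ 𝒜 3) (hd : D.d v₁ = 0)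
    (hπ : D.π 1 v₁ = 1) : D.IsPropagator e v₁ (K + D.shift (K v₁)) := by
  have hw : K v₁ ∈ 𝒜 2 := h.mem _ _ hv₁
  have hsw : e.sign (K v₁) = K v₁ := by rw [e.sign_of_mem hw]; norm_num
  -- The harmonic part of `v₁` is `v`, so `K v₁` is a primitive of the change of representative.
  -- This makes the correction convert the old projector into the new one.
  have hdw : D.d (K v₁) = v₁ - v := by
    rw [h.dK, hd, map_zero, sub_zero, harmonic_apply, D.π_degree 3 3 _ _ hv₁ h.v_mem (by norm_num),
      D.π_comm e, hπ]
    simp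
  have h1w : D.π 1 (K v₁) = 0 := D.π_degree 0 2 _ _ one_mem_zero hw (by norm_num)
  refine ⟨hv₁, hd, hπ, ?_, ?_, ?_, ?_, ?_, ?_⟩
  · intro i a ha
    rw [LinearMap.add_apply, shift_apply]
    refine Submodule.add_mem _ (h.mem _ _ ha) (Submodule.sub_mem _ ?_ ?_)
    · by_cases hi : i = 0
      · subst hi; exact Submodule.smul_mem _ _ one_mem_zero
      · rw [D.π_degree _ _ _ _ ha hw (by omega), zero_smul]; exact Submodule.zero_mem _
    · by_cases hi : i = 2
      · subst hi; exact Submodule.smul_mem _ _ hw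
      · rw [D.π_degree _ _ _ _ ha one_mem_zero (by omega), zero_smul]; exact Submodule.zero_mem _
  · intro a ha
    rw [LinearMap.add_apply, shift_apply, h.mem_zero _ ha, D.π_degree _ _ _ _ ha hw (by norm_num),
      D.π_degree _ _ _ _ ha one_mem_zero (by norm_num)]
    simp
  · intro a
    have e1 : D.π (D.d a) (K v₁) = D.π a v - D.π a v₁ := by
      rw [π_d_left D e, hsw, hdw, map_sub]; ring
    have e2 : D.π (D.d a) 1 = 0 := by rw [π_d_left D e, e.sign_one, D.d_one]; simp
    simp only [LinearMap.add_apply, shift_apply, map_add, map_sub, map_smul, D.d_one, hdw, e1, e2,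
      h.dK, harmonic_apply]
    module
  · intro a b
    simp only [LinearMap.add_apply, shift_apply, map_add, map_sub, map_smul, LinearMap.sub_apply,
      LinearMap.smul_apply, smul_eq_mul, h.symm a b, D.π_sign, hsw, e.sign_one]
    rw [D.π_comm e 1 b, D.π_comm e (K v₁) b]
    ring
  · rw [LinearMap.add_apply, shift_apply, h.map_one, h1w, π_one_one]; simp
  · rw [LinearMap.add_apply, shift_apply, D.π_degree 3 2 _ _ hv₁ hw (by norm_num), D.π_comm e, hπ]
    simp

/-- Products of strict propagators that differ by a shift vanish. -/
theorem shift_mul (h : D.IsPropagator e v K) (hK : ∀ a, K (K a) = 0) (hv₁ : v₁ ∈ 𝒜 3) (a : C) :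
    K (D.shift (K v₁) a) = 0 ∧ D.shift (K v₁) (K a) = 0 ∧
      D.shift (K v₁) (D.shift (K v₁) a) = 0 := by
  have hw : K v₁ ∈ 𝒜 2 := h.mem _ _ hv₁
  have hsw : e.sign (K v₁) = K v₁ := by rw [e.sign_of_mem hw]; norm_num
  have h1w : D.π 1 (K v₁) = 0 := D.π_degree 0 2 _ _ one_mem_zero hw (by norm_num)
  have hw1 : D.π (K v₁) 1 = 0 := h.π_K_one v₁
  have hww : D.π (K v₁) (K v₁) = 0 := D.π_degree 2 2 _ _ hw hw (by norm_num)
  refine ⟨?_, ?_, ?_⟩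
  · rw [shift_apply, map_sub, map_smul, map_smul, hK, h.map_one]; simp
  · rw [shift_apply, h.π_K_one, h.symm, hsw, hK]; simp
  · simp only [shift_apply, map_sub, map_smul, h1w, hw1, hww, π_one_one]
    simp

end IsPropagator

end DGFrobenius

end AbstractCS

/-! ### Derivatives of the cubic action. -/

namespace AbstractCS

variable {C : Type*} [Ring C] [Algebra ℝ C] {𝒜 : ℕ → Submodule ℝ C} [GradedAlgebra 𝒜]
  {I τ : Type*} {e : HomogeneousBasis 𝒜 I} {A : Type*} [Ring A] [Algebra ℝ A]

theorem smul_algebraMap (r s : ℝ) : r • algebraMap ℝ A s = algebraMap ℝ A (r * s) := by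
  rw [map_mul, Algebra.smul_def]

namespace SuperCalculus

variable (S : SuperCalculus (ghost e.deg τ) A)

theorem dir_mul_of_even {n : ℕ} {g : ℤ} (hg : Even g) {f : A} (hf : f ∈ S.wt n g) (b : τ) (u : C)
    (f' : A) : S.dir b u (f * f') = S.dir b u f * f' + f * S.dir b u f' := by
  refine e.induction (p := fun u => S.dir b u (f * f') = S.dir b u f * f' + f * S.dir b u f')
    (by simp) ?_ ?_ ?_ u
  · intro x y hx hy
    simp only [map_add, Op.add_apply, hx, hy, add_mul, mul_add]; abel
  · intro r x hx
    simp only [map_smul, Op.smul_apply, hx, smul_add, smul_mul_assoc, mul_smul_comm]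
  · intro i
    rw [S.dir_basis, Op.of_apply, S.leibniz hf, (hg.mul_left _).neg_one_zpow, one_smul]
    rfl

variable [Fintype I] [DecidableEq I] [Fintype τ] (D : DGFrobenius 𝒜)

theorem dir_eq_sum (b : τ) (u : C) :
    S.dir b u = ∑ i, e.basis.repr u i • Op.of (S.pderiv (i, b)) := by
  conv_lhs => rw [← e.basis.sum_repr u, map_sum]
  simp

theorem dir_mem {n : ℕ} {g : ℤ} {f : A} (hf : f ∈ S.wt (n + 1) g) {i : ℕ} {u : C} (hu : u ∈ 𝒜 i)
    (b : τ) : S.dir b u f ∈ S.wt n (g - 1 + i) := by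
  rw [dir_eq_sum, Op.sum_apply]
  refine Submodule.sum_mem _ fun j _ => ?_
  by_cases h : e.basis.repr u j = 0
  · rw [h, zero_smul]; exact Submodule.zero_mem _
  · have hd := e.deg_eq_of_repr_ne_zero hu h
    have := S.pderiv_mem hf (j, b)
    rw [Op.smul_apply, Op.of_apply]
    refine Submodule.smul_mem _ _ ?_
    convert this using 2
    rw [ghost, hd]; ring

theorem dir_of_mem_zero {g : ℤ} {f : A} (hf : f ∈ S.wt 0 g) (b : τ) (u : C) :
    S.dir b u f = 0 := by
  obtain ⟨r, rfl⟩ := S.exists_const_of_mem hf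
  exact S.dir_algebraMap b u r

theorem eq_zero_of_dir [Nonempty τ] {n : ℕ} {g : ℤ} {f : A} (hf : f ∈ S.wt (n + 1) g)
    (h : ∀ b i, S.dir b (e.basis i) f = 0) : f = 0 := by
  refine S.eq_zero_of_pderiv hf fun x => ?_
  have := h x.2 x.1
  rwa [S.dir_basis] at this

theorem lap_one (N : C →ₗ[ℝ] C) (ρ : Matrix τ τ ℝ) : S.lap D N ρ 1 = 0 := by
  simp [lap, S.pderiv_one]

theorem lap_apply (N : C →ₗ[ℝ] C) (ρ : Matrix τ τ ℝ) (f : A) :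
    S.lap D N ρ f =
      ∑ a, ∑ b, ρ a b • ∑ m, S.dir a (N (D.dual e m)) (S.dir b (e.basis m) f) := by
  simp [lap, -dir_basis]

/-- The two directions have total degree 3 - s, and each derivative changes the ghost number by its
degree minus one. -/
theorem lap_mem {N : C →ₗ[ℝ] C} {s : ℕ} (hN : ∀ i a, a ∈ 𝒜 (i + s) → N a ∈ 𝒜 i)
    (hN0 : ∀ i a, i < s → a ∈ 𝒜 i → N a = 0) (ρ : Matrix τ τ ℝ) {n : ℕ} {g : ℤ} {f : A}
    (hf : f ∈ S.wt (n + 2) g) : S.lap D N ρ f ∈ S.wt n (g + 1 - s) := by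
  rw [lap_apply]
  refine Submodule.sum_mem _ fun a _ => Submodule.sum_mem _ fun b _ => Submodule.smul_mem _ _ <|
    Submodule.sum_mem _ fun m _ => ?_
  have h1 := S.dir_mem hf (e.mem m) b
  have hm := D.dual_mem e m
  have hm3 : e.deg m ≤ 3 := by
    by_contra h
    exact e.basis.ne_zero m (D.eq_zero_of_mem_of_lt e (by omega) (e.mem m))
  by_cases hs : 3 - e.deg m < s
  · rw [hN0 _ _ hs hm, map_zero]; exact Submodule.zero_mem _
  · have h2 : N (D.dual e m) ∈ 𝒜 (3 - e.deg m - s) :=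
      hN _ _ (by rwa [Nat.sub_add_cancel (by omega)])
    have := S.dir_mem h1 h2 a
    convert this using 2
    rw [Nat.cast_sub (by omega), Nat.cast_sub hm3]
    push_cast
    ring

theorem lap_of_mem_lt (N : C →ₗ[ℝ] C) (ρ : Matrix τ τ ℝ) {n : ℕ} (hn : n < 2) {g : ℤ} {f : A}
    (hf : f ∈ S.wt n g) : S.lap D N ρ f = 0 := by
  rw [lap_apply]
  refine Finset.sum_eq_zero fun a _ => Finset.sum_eq_zero fun b _ => ?_
  rw [Finset.sum_eq_zero, smul_zero]
  intro m _
  interval_cases n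
  · rw [S.dir_of_mem_zero hf, map_zero]
  · rw [S.dir_of_mem_zero (S.dir_mem hf (e.mem m) b)]

/-- The linear form on operators of degree `-3` that is given by the trace over `C⁰` of their
composition with the multiplication by `v`. -/
def _root_.AbstractCS.DGFrobenius.vtrace (D : DGFrobenius 𝒜) (e : HomogeneousBasis 𝒜 I) (v : C)
    (N : C →ₗ[ℝ] C) : ℝ :=
  ∑ m, D.π v (e.basis m * N (D.dual e m))

/-- `c` is the cubic function with structure constants `f` on `𝔤 ⊗ C[1]`, given by its third
derivatives. -/
structure IsCubic (f : τ → τ → τ → ℝ) (c : A) : Prop where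
  swap₁₂ : ∀ a b d, f a b d = -f b a d
  swap₂₃ : ∀ a b d, f a b d = -f a d b
  mem : c ∈ S.wt 3 0
  third : ∀ i j k a b d, S.dir a (e.basis i) (S.dir b (e.basis j) (S.dir d (e.basis k) c)) =
    algebraMap ℝ A (-(-1) ^ (e.deg j * (e.deg i + 1)) * f a b d *
      D.π (e.basis k) (e.basis j * e.basis i))

namespace IsCubic

variable {S D} {f : τ → τ → τ → ℝ} {c : A} (hc : S.IsCubic D f c)

include hc

theorem third_of_mem {i j : ℕ} {u w : C} (hu : u ∈ 𝒜 i) (hw : w ∈ 𝒜 j) (z : C) (a b d : τ) :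
    S.dir a u (S.dir b w (S.dir d z c)) =
      algebraMap ℝ A (-(-1) ^ (j * (i + 1)) * f a b d * D.π z (w * u)) := by
  refine e.induction (p := fun z => S.dir a u (S.dir b w (S.dir d z c)) =
      algebraMap ℝ A (-(-1) ^ (j * (i + 1)) * f a b d * D.π z (w * u))) (by simp) ?_ ?_ ?_ z
  · intro x y hx hy
    simp only [map_add, Op.add_apply, hx, hy, LinearMap.add_apply, mul_add]
  · intro r x hx
    simp only [map_smul, Op.smul_apply, hx, LinearMap.smul_apply, smul_eq_mul,
      smul_algebraMap]
    congr 1; ring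
  intro k
  rw [dir_eq_sum S a u, dir_eq_sum S b w]
  conv_rhs => rw [← e.basis.sum_repr u, ← e.basis.sum_repr w, Finset.sum_mul_sum]
  simp only [Op.sum_apply, map_sum, Finset.mul_sum, Op.smul_apply, map_smul]
  refine Finset.sum_congr rfl fun j' _ => ?_
  rw [Finset.smul_sum]
  refine Finset.sum_congr rfl fun i' _ => ?_
  have := hc.third i' j' k a b d
  rw [S.dir_basis a i', S.dir_basis b j'] at this
  by_cases h1 : e.basis.repr u i' = 0
  · simp [h1]
  by_cases h2 : e.basis.repr w j' = 0
  · simp [h2]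
  have h3 := e.deg_eq_of_repr_ne_zero hu h1
  have h4 := e.deg_eq_of_repr_ne_zero hw h2
  rw [this, h3, h4]
  simp only [smul_algebraMap, mul_smul_comm, smul_mul_assoc, map_smul, smul_eq_mul]
  congr 1; ring

theorem third_eq_zero {a b d : τ} (h : f a b d = 0) (u w z : C) :
    S.dir a u (S.dir b w (S.dir d z c)) = 0 := by
  refine e.induction (p := fun u => S.dir a u (S.dir b w (S.dir d z c)) = 0) (by simp) ?_ ?_ ?_ u
  · intro x y hx hy; simp only [map_add, Op.add_apply, hx, hy, add_zero]
  · intro r x hx; simp only [map_smul, Op.smul_apply, hx, smul_zero]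
  intro i
  refine e.induction (p := fun w => S.dir a (e.basis i) (S.dir b w (S.dir d z c)) = 0)
    (by simp) ?_ ?_ ?_ w
  · intro x y hx hy; simp only [map_add, Op.add_apply, hx, hy, add_zero]
  · intro r x hx; simp only [map_smul, Op.smul_apply, hx, smul_zero]
  intro j
  rw [hc.third_of_mem (e.mem i) (e.mem j), h]
  simp

theorem f_self₁₂ (a b : τ) : f a a b = 0 := by have := hc.swap₁₂ a a b; linarith
theorem f_self₂₃ (a b : τ) : f a b b = 0 := by have := hc.swap₂₃ a b b; linarith
theorem f_cyc (a b d : τ) : f b d a = f a b d := by rw [hc.swap₂₃, hc.swap₁₂, neg_neg]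

theorem third_one (u w : C) (a b d : τ) :
    S.dir a u (S.dir b w (S.dir d 1 c)) =
      algebraMap ℝ A (-f a b d * D.π (e.sign w) u) := by
  refine e.induction (p := fun u => S.dir a u (S.dir b w (S.dir d 1 c)) =
      algebraMap ℝ A (-f a b d * D.π (e.sign w) u)) (by simp) ?_ ?_ ?_ u
  · intro x y hx hy; simp only [map_add, Op.add_apply, hx, hy, mul_add]
  · intro r x hx
    simp only [map_smul, Op.smul_apply, hx, smul_eq_mul, smul_algebraMap]
    congr 1; ring
  intro i
  refine e.induction (p := fun w => S.dir a (e.basis i) (S.dir b w (S.dir d 1 c)) =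
      algebraMap ℝ A (-f a b d * D.π (e.sign w) (e.basis i))) (by simp) ?_ ?_ ?_ w
  · intro x y hx hy; simp only [map_add, Op.add_apply, hx, hy, mul_add, LinearMap.add_apply]
  · intro r x hx
    simp only [map_smul, Op.smul_apply, hx, smul_eq_mul, smul_algebraMap,
      LinearMap.smul_apply]
    congr 1; ring
  intro j
  rw [hc.third_of_mem (e.mem i) (e.mem j), e.sign_basis, D.π_mul, one_mul, map_smul,
    LinearMap.smul_apply, smul_eq_mul]
  by_cases h : e.deg j + e.deg i = 3
  · have hs : (-1 : ℝ) ^ (e.deg j * (e.deg i + 1)) = (-1) ^ e.deg j := by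
      have : e.deg j ≤ 3 := by omega
      have h2 : e.deg i = 3 - e.deg j := by omega
      rw [h2]
      interval_cases e.deg j <;> norm_num
    rw [hs]
    congr 1; ring
  · rw [D.π_basis_eq_zero e h]; simp

/-- Since `v` has top degree, only components of `u` and `w` of degree zero contribute, and for them
the sign is trivial. -/
theorem third_v {v : C} (hv : v ∈ 𝒜 3) (u w : C) (a b d : τ) :
    S.dir a u (S.dir b w (S.dir d v c)) = algebraMap ℝ A (-f a b d * D.π v (w * u)) := by
  refine e.induction (p := fun u => S.dir a u (S.dir b w (S.dir d v c)) =
      algebraMap ℝ A (-f a b d * D.π v (w * u))) (by simp) ?_ ?_ ?_ u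
  · intro x y hx hy; simp only [map_add, Op.add_apply, hx, hy, mul_add]
  · intro r x hx
    simp only [map_smul, Op.smul_apply, hx, smul_eq_mul, smul_algebraMap,
      mul_smul_comm]
    congr 1; ring
  intro i
  refine e.induction (p := fun w => S.dir a (e.basis i) (S.dir b w (S.dir d v c)) =
      algebraMap ℝ A (-f a b d * D.π v (w * e.basis i))) (by simp) ?_ ?_ ?_ w
  · intro x y hx hy; simp only [map_add, Op.add_apply, hx, hy, mul_add, add_mul]
  · intro r x hx
    simp only [map_smul, Op.smul_apply, hx, smul_eq_mul, smul_algebraMap,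
      smul_mul_assoc]
    congr 1; ring
  intro j
  rw [hc.third_of_mem (e.mem i) (e.mem j)]
  by_cases h : e.deg j = 0
  · rw [h]; simp
  · rw [D.π_degree _ _ _ _ hv (SetLike.GradedMul.mul_mem (e.mem j) (e.mem i)) (by omega)]; simp

theorem lap_dir_v {v : C} (hv : v ∈ 𝒜 3) (N : C →ₗ[ℝ] C) (ρ : Matrix τ τ ℝ) (d : τ) :
    S.lap D N ρ (S.dir d v c) =
      algebraMap ℝ A (-(∑ a, ∑ b, ρ a b * f a b d) * D.vtrace e v N) := by
  rw [lap_apply]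
  simp only [hc.third_v hv, ← map_sum (algebraMap ℝ A), smul_algebraMap, ← Finset.mul_sum]
  congr 1
  rw [DGFrobenius.vtrace, ← Finset.sum_neg_distrib, Finset.sum_mul]
  refine Finset.sum_congr rfl fun a _ => ?_
  rw [← Finset.sum_neg_distrib, Finset.sum_mul]
  refine Finset.sum_congr rfl fun b _ => by ring

variable [DecidableEq τ]

/-- Absence of tadpoles: closing two legs of one vertex contracts two indices of the antisymmetric
`f`. -/
theorem lap_dir_eq_zero (N : C →ₗ[ℝ] C) (d : τ) (u : C) : S.lap D N 1 (S.dir d u c) = 0 := by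
  rw [lap_apply]
  refine Finset.sum_eq_zero fun a _ => Finset.sum_eq_zero fun b _ => ?_
  by_cases hab : a = b
  · subst hab
    rw [Finset.sum_eq_zero, smul_zero]
    intro m _
    exact hc.third_eq_zero (hc.f_self₁₂ a d) _ _ _
  · rw [Matrix.one_apply_ne hab, zero_smul]

theorem dir_dir_same [Nonempty τ] (b : τ) {i j : ℕ} {u w : C} (hu : u ∈ 𝒜 i) (hw : w ∈ 𝒜 j) :
    S.dir b u (S.dir b w c) = 0 :=
  S.eq_zero_of_dir (S.dir_mem (S.dir_mem hc.mem hw b) hu b) fun a _ =>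
    hc.third_eq_zero (hc.f_self₂₃ a b) _ _ _

theorem comm_of_mem {n : ℕ} {g : ℤ} {f' : A} (hf : f' ∈ S.wt n g) : f' * c = c * f' := by
  rw [S.mul_comm_of_mem hf hc.mem]; simp

theorem comm (b : τ) (u : C) : S.dir b u c * c = c * S.dir b u c := by
  refine e.induction (p := fun u => S.dir b u c * c = c * S.dir b u c) (by simp) ?_ ?_ ?_ u
  · intro x y hx hy; simp only [map_add, Op.add_apply, add_mul, mul_add, hx, hy]
  · intro r x hx; simp only [map_smul, Op.smul_apply, smul_mul_assoc, mul_smul_comm, hx]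
  · intro i; exact hc.comm_of_mem (S.dir_mem hc.mem (e.mem i) b)

theorem dir_sq (b : τ) (u : C) : S.dir b u (c * c) = (2 : ℝ) • (c * S.dir b u c) := by
  rw [S.dir_mul_even hc.mem, hc.comm, two_smul]

theorem dir_pow (b : τ) {i : ℕ} {u : C} (hu : u ∈ 𝒜 i) (n : ℕ) :
    S.dir b u (c ^ (n + 1)) = ((n : ℝ) + 1) • (S.dir b u c * c ^ n) := by
  induction n with
  | zero => simp
  | succ n ih =>
    rw [pow_succ', S.dir_mul_even hc.mem, ih, mul_smul_comm, ← mul_assoc,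
      ← hc.comm_of_mem (S.dir_mem hc.mem hu b), mul_assoc, ← pow_succ', Nat.cast_succ,
      add_smul ((n : ℝ) + 1), one_smul, add_comm]

end IsCubic

end SuperCalculus

end AbstractCS

/-! ### Commutators of Laplacians with functions and with linear vector fields. -/

namespace AbstractCS

variable {C : Type*} [Ring C] [Algebra ℝ C] {𝒜 : ℕ → Submodule ℝ C} [GradedAlgebra 𝒜]
  {I τ : Type*} {e : HomogeneousBasis 𝒜 I} {A : Type*} [Ring A] [Algebra ℝ A]

namespace SuperCalculus

variable (S : SuperCalculus (ghost e.deg τ) A) [Fintype I] [DecidableEq I] [Fintype τ]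
  [DecidableEq τ] (D : DGFrobenius 𝒜)

theorem mul_smul' (r : ℝ) (f : A) : mul (r • f) = r • mul f := by ext; simp

theorem mul_sum' {ι : Type*} (s : Finset ι) (f : ι → A) : mul (∑ i ∈ s, f i) = ∑ i ∈ s, mul (f i) := by
  ext; simp [Finset.sum_mul]

theorem lap_one_right (N : C →ₗ[ℝ] C) :
    S.lap D N 1 = ∑ b, ∑ m, S.dir b (N (D.dual e m)) * S.dir b (e.basis m) := by
  rw [lap]
  refine Finset.sum_congr rfl fun a _ => ?_
  rw [Finset.sum_eq_single a]
  · rw [Matrix.one_apply_eq, one_smul]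
  · intro b _ hb; rw [Matrix.one_apply_ne hb.symm, zero_smul]
  · simp

theorem dir_coord (b : τ) (u : C) (j : I) (c : τ) :
    S.dir b u (S.coord (j, c)) = algebraMap ℝ A (if b = c then e.basis.repr u j else 0) := by
  classical
  rw [dir_eq_sum, Op.sum_apply]
  simp only [Op.smul_apply, Op.of_apply, S.pderiv_coord, Prod.mk.injEq]
  by_cases h : b = c
  · subst h
    simp [Algebra.algebraMap_eq_smul_one]
  · simp [h]

theorem dir_mul_coord_odd {j : I} (hj : Odd (e.deg j)) (b c : τ) (u : C) :
    S.dir b u * mul (S.coord (j, c)) =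
      (if b = c then e.basis.repr u j else 0) • (1 : Op A) + mul (S.coord (j, c)) * S.dir b u := by
  have hg : Even (ghost e.deg τ (j, c)) := odd_one.sub_odd (by exact_mod_cast hj)
  ext f
  rw [Op.mul_apply, mul_apply', S.dir_mul_of_even hg (S.coord_mem _), dir_coord,
    ← Algebra.smul_def]
  rfl

theorem dir_mul_coord_even {j : I} (hj : Even (e.deg j)) (b c : τ) (u : C) :
    S.dir b u * mul (S.coord (j, c)) =
      (if b = c then e.basis.repr u j else 0) • (1 : Op A) -
        mul (S.coord (j, c)) * S.dir b (e.sign u) := by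
  have hg : Odd (ghost e.deg τ (j, c)) := odd_one.sub_even (by exact_mod_cast hj)
  ext f
  rw [Op.mul_apply, mul_apply', S.dir_mul_odd hg (S.coord_mem _), dir_coord,
    ← Algebra.smul_def]
  rfl

variable {D} {v : C} {K : C →ₗ[ℝ] C}

/-- Either derivative may hit the coordinate. The two contributions agree by the symmetry of the
propagator, whence the factor 2. -/
theorem lap_mul_coord (h : D.IsPropagator e v K) (j : I) (c : τ) :
    S.lap D K 1 * mul (S.coord (j, c)) =
      mul (S.coord (j, c)) * S.lap D K 1 + (2 : ℝ) • S.dir c (K (D.dual e j)) := by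
  have h1 : ∑ m, e.basis.repr (e.basis m) j • S.dir c (K (D.dual e m)) =
      S.dir c (K (D.dual e j)) := by
    simp [Finsupp.single_apply]
  have h2 : ∑ m, e.basis.repr (K (D.dual e m)) j • e.basis m = K (e.sign (D.dual e j)) := by
    conv_rhs => rw [← D.sum_π_dual_basis e (K (e.sign (D.dual e j)))]
    refine Finset.sum_congr rfl fun m _ => ?_
    rw [D.repr_eq_π_dual, D.π_comm e, h.symm]
  rw [lap_one_right]
  rcases Nat.even_or_odd (e.deg j) with hj | hj
  · have hs : e.sign (D.dual e j) = -D.dual e j := by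
      rw [D.sign_dual, hj.neg_one_pow, neg_one_smul]
    have step : ∀ b m, S.dir b (K (D.dual e m)) * S.dir b (e.basis m) * mul (S.coord (j, c)) =
        (if b = c then e.basis.repr (e.basis m) j • S.dir c (K (D.dual e m)) else 0) -
        (if b = c then e.basis.repr (K (D.dual e m)) j • S.dir c (e.sign (e.basis m)) else 0) +
        mul (S.coord (j, c)) *
          (S.dir b (e.sign (K (D.dual e m))) * S.dir b (e.sign (e.basis m))) := by
      intro b m
      rw [mul_assoc, S.dir_mul_coord_even hj, mul_sub, ← mul_assoc _ (mul _),
        S.dir_mul_coord_even hj, sub_mul, mul_smul_comm, smul_mul_assoc, mul_one, one_mul, mul_assoc]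
      by_cases hbc : b = c
      · subst hbc; simp only [if_true]; abel
      · simp only [hbc, if_false, zero_smul]; abel
    have h3 : ∀ b, ∑ m, S.dir b (e.sign (K (D.dual e m))) * S.dir b (e.sign (e.basis m)) =
        ∑ m, S.dir b (K (D.dual e m)) * S.dir b (e.basis m) := by
      intro b
      have := S.sum_dual_transpose D (P := e.sign ∘ₗ K) (isTranspose_sign (e := e) D) b b
      simp only [LinearMap.comp_apply, LinearMap.neg_apply] at this
      rw [this]
      refine Finset.sum_congr rfl fun m _ => ?_
      have hs : e.sign (K (-e.sign (D.dual e m))) = K (D.dual e m) := by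
        rw [map_neg K, map_neg e.sign, h.sign_K, e.sign_sign, neg_neg]
      rw [hs]
    have h4 : ∑ m, e.basis.repr (K (D.dual e m)) j • S.dir c (e.sign (e.basis m)) =
        -S.dir c (K (D.dual e j)) := by
      have := congrArg (fun x => S.dir c (e.sign x)) h2
      simp only [map_sum, map_smul] at this
      rw [this, h.sign_K, e.sign_sign, map_neg]
    simp only [Finset.sum_mul, step, Finset.sum_add_distrib, Finset.sum_sub_distrib,
      ← Finset.mul_sum, h3]
    rw [Finset.sum_comm, Finset.sum_comm (f := fun b m => if b = c then
      e.basis.repr (K (D.dual e m)) j • S.dir c (e.sign (e.basis m)) else 0)]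
    simp only [Finset.sum_ite_eq', Finset.mem_univ, if_true, h1, h4, two_smul]
    abel
  · have hs : e.sign (D.dual e j) = D.dual e j := by
      rw [D.sign_dual, hj.neg_one_pow, neg_neg, one_smul]
    have step : ∀ b m, S.dir b (K (D.dual e m)) * S.dir b (e.basis m) * mul (S.coord (j, c)) =
        (if b = c then e.basis.repr (e.basis m) j • S.dir c (K (D.dual e m)) else 0) +
        (if b = c then e.basis.repr (K (D.dual e m)) j • S.dir c (e.basis m) else 0) +
        mul (S.coord (j, c)) * (S.dir b (K (D.dual e m)) * S.dir b (e.basis m)) := by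
      intro b m
      rw [mul_assoc, S.dir_mul_coord_odd hj, mul_add, ← mul_assoc _ (mul _),
        S.dir_mul_coord_odd hj, add_mul, mul_smul_comm, smul_mul_assoc, mul_one, one_mul, mul_assoc]
      by_cases hbc : b = c
      · subst hbc; simp only [if_true]; abel
      · simp only [hbc, if_false, zero_smul]; abel
    have h4 : ∑ m, e.basis.repr (K (D.dual e m)) j • S.dir c (e.basis m) =
        S.dir c (K (D.dual e j)) := by
      have := congrArg (fun x => S.dir c x) h2
      simp only [map_sum, map_smul] at this
      rw [this, hs]
    simp only [Finset.sum_mul, step, Finset.sum_add_distrib, ← Finset.mul_sum]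
    rw [Finset.sum_comm, Finset.sum_comm (f := fun b m => if b = c then
      e.basis.repr (K (D.dual e m)) j • S.dir c (e.basis m) else 0)]
    simp only [Finset.sum_ite_eq', Finset.mem_univ, if_true, h1, h4, two_smul]
    abel

theorem lap_mul_linear (h : D.IsPropagator e v K) {ℓ : A} {κ : I → τ → ℝ}
    (hℓ : ℓ = ∑ j, ∑ c, κ j c • S.coord (j, c)) :
    S.lap D K 1 * mul ℓ - mul ℓ * S.lap D K 1 =
      (2 : ℝ) • ∑ j, ∑ c, κ j c • S.dir c (K (D.dual e j)) := by
  subst hℓ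
  simp only [mul_sum', mul_smul', Finset.mul_sum, Finset.sum_mul, mul_smul_comm, smul_mul_assoc,
    S.lap_mul_coord h, ← Finset.sum_sub_distrib, ← smul_sub, add_sub_cancel_left, Finset.smul_sum]
  exact Finset.sum_congr rfl fun j _ => Finset.sum_congr rfl fun c _ => smul_comm _ _ _

/-- The matrix of `ad T_d` for the structure constants `f`. -/
def ad (f : τ → τ → τ → ℝ) (d : τ) : Matrix τ τ ℝ := Matrix.of fun b a => f a b d

variable (D) in
/-- The commutator of the Laplacian of `K` with the derivative of `c` along the unit. -/
def unitField (c : A) (K : C →ₗ[ℝ] C) (d : τ) : Op A :=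
  S.lap D K 1 * mul (S.dir d 1 c) - mul (S.dir d 1 c) * S.lap D K 1

namespace IsCubic

variable {S} {f : τ → τ → τ → ℝ} {c : A} (hc : S.IsCubic D f c)

include hc

theorem dir_one_mem (d : τ) : S.dir d 1 c ∈ S.wt 2 (-1) := by
  simpa using S.dir_mem hc.mem DGFrobenius.one_mem_zero d

theorem dir_dir_one (b d : τ) (u : C) : S.dir b u (S.dir d 1 c) =
    ∑ j, ∑ a, (-f a b d * D.π (e.sign u) (e.basis j)) • S.coord (j, a) := by
  refine e.induction (p := fun u => S.dir b u (S.dir d 1 c) =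
    ∑ j, ∑ a, (-f a b d * D.π (e.sign u) (e.basis j)) • S.coord (j, a)) (by simp) ?_ ?_ ?_ u
  · intro x y hx hy
    simp only [map_add, Op.add_apply, hx, hy, LinearMap.add_apply, mul_add, add_smul,
      Finset.sum_add_distrib]
  · intro r x hx
    simp only [map_smul, Op.smul_apply, hx, LinearMap.smul_apply, smul_eq_mul, Finset.smul_sum,
      smul_smul]
    refine Finset.sum_congr rfl fun j _ => Finset.sum_congr rfl fun a _ => ?_
    congr 1; ring
  intro i
  have := S.euler (S.dir_mem (hc.dir_one_mem d) (e.mem i) b)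
  rw [Nat.cast_one, one_smul] at this
  rw [← this, Fintype.sum_prod_type]
  refine Finset.sum_congr rfl fun j _ => Finset.sum_congr rfl fun a _ => ?_
  have h3 := hc.third_one (e.basis j) (e.basis i) a b d
  rw [S.dir_basis a j, Op.of_apply] at h3
  rw [h3, ← Algebra.commutes, Algebra.smul_def]

/-- A constant field commutes with the Laplacian, so it acts only on `S.dir d 1 c`. The derivative
of that quadratic function is linear, and a Laplacian has a constant field as commutator with a
linear function (`lap_mul_linear`). -/
theorem unitField_isOddField (h : D.IsPropagator e v K) (d : τ) :
    S.IsOddField (S.unitField D c K d) ((-2 : ℝ) • K ∘ₗ e.sign) (ad f d) := by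
  intro b u
  have hmul : ∀ u, S.dir b u * mul (S.dir d 1 c) =
      mul (S.dir b u (S.dir d 1 c)) - mul (S.dir d 1 c) * S.dir b (e.sign u) := by
    intro u; ext g
    rw [Op.mul_apply, mul_apply', S.dir_mul_odd (by decide) (hc.dir_one_mem d)]
    rfl
  have hlin := S.lap_mul_linear h (hc.dir_dir_one b d u)
  have hsum : ∑ j, ∑ a, (-f a b d * D.π (e.sign u) (e.basis j)) • S.dir a (K (D.dual e j)) =
      -∑ a, f a b d • S.dir a (K (e.sign u)) := by
    rw [Finset.sum_comm, ← Finset.sum_neg_distrib]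
    refine Finset.sum_congr rfl fun a _ => ?_
    conv_rhs => rw [← D.sum_π_basis_dual e (e.sign u)]
    simp only [map_sum, map_smul, Finset.smul_sum, smul_smul, ← Finset.sum_neg_distrib]
    refine Finset.sum_congr rfl fun j _ => ?_
    rw [← neg_smul, D.π_comm e (e.basis j)]
    congr 1; ring
  rw [hsum] at hlin
  have hcomm := fun u => S.dir_mul_lap_of_odd D h.sign_K (1 : Matrix τ τ ℝ) b u
  have : S.dir b u * S.unitField D c K d =
      (S.lap D K 1 * mul (S.dir b u (S.dir d 1 c)) - mul (S.dir b u (S.dir d 1 c)) * S.lap D K 1)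
      - S.unitField D c K d * S.dir b (e.sign u) := by
    rw [unitField, mul_sub, ← mul_assoc, hcomm, mul_assoc, hmul, ← mul_assoc, hmul, sub_mul,
      mul_assoc (mul _) (S.dir b _), hcomm]
    noncomm_ring
  rw [this, hlin]
  congr 1
  simp only [ad, Matrix.of_apply, LinearMap.smul_apply, LinearMap.comp_apply, map_smul,
    Finset.smul_sum, ← Finset.sum_neg_distrib]
  refine Finset.sum_congr rfl fun a _ => ?_
  rw [smul_neg, smul_smul, smul_smul, ← neg_smul]
  congr 1; ring

theorem unitField_one (d : τ) : S.unitField D c K d 1 = 0 := by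
  rw [unitField, Op.sub_apply, Op.mul_apply, Op.mul_apply, mul_apply', mul_one, lap_one,
    map_zero, sub_zero, hc.lap_dir_eq_zero]

theorem unitField_algebraMap (d : τ) (r : ℝ) : S.unitField D c K d (algebraMap ℝ A r) = 0 := by
  rw [Algebra.algebraMap_eq_smul_one, map_smul, hc.unitField_one, smul_zero]

theorem transpose_ad (d : τ) : (ad f d).transpose = -ad f d := by
  ext a b
  simp only [ad, Matrix.transpose_apply, Matrix.of_apply, Matrix.neg_apply]
  exact hc.swap₁₂ _ _ _

theorem lap_mul_unitField_of_odd (h : D.IsPropagator e v K) {N : C →ₗ[ℝ] C}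
    (hN : ∀ a, e.sign (N a) = -N (e.sign a)) (ρ : Matrix τ τ ℝ) (d : τ) :
    S.lap D N ρ * S.unitField D c K d = S.unitField D c K d * S.lap D N ρ -
      (2 : ℝ) • (S.lap D (N ∘ₗ K) (ρ * ad f d) + S.lap D (K ∘ₗ N) (ad f d * ρ)) := by
  have ht : D.IsTranspose ((-2 : ℝ) • K ∘ₗ e.sign) ((-2 : ℝ) • K) := by
    intro u w
    simp only [LinearMap.smul_apply, LinearMap.comp_apply, map_smul, smul_eq_mul]
    rw [h.symm, D.π_sign, h.sign_K, e.sign_sign, map_neg, neg_neg]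
  rw [S.lap_mul_oddField D (hc.unitField_isOddField h d) ht N ρ, hc.transpose_ad]
  have e1 : N ∘ₗ ((-2 : ℝ) • K) = (-2 : ℝ) • (N ∘ₗ K) := by ext; simp
  have e2 : ((-2 : ℝ) • K ∘ₗ e.sign) ∘ₗ N ∘ₗ e.sign = (2 : ℝ) • (K ∘ₗ N) := by
    ext a; simp [hN]
  have e3 : e.sign ∘ₗ N ∘ₗ e.sign = -N := by ext a; simp [hN]
  rw [e1, e2, e3, lap_smul, lap_smul, lap_neg, neg_mul, lap_neg_right]
  simp only [mul_neg, neg_smul, smul_add, smul_neg]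
  abel

theorem lap_mul_unitField_of_even (h : D.IsPropagator e v K) {N : C →ₗ[ℝ] C}
    (hN : ∀ a, e.sign (N a) = N (e.sign a)) (ρ : Matrix τ τ ℝ) (d : τ) :
    S.lap D N ρ * S.unitField D c K d = -(S.unitField D c K d * S.lap D N ρ) -
      (2 : ℝ) • (S.lap D (N ∘ₗ K) (ρ * ad f d) - S.lap D (K ∘ₗ N) (ad f d * ρ)) := by
  have ht : D.IsTranspose ((-2 : ℝ) • K ∘ₗ e.sign) ((-2 : ℝ) • K) := by
    intro u w
    simp only [LinearMap.smul_apply, LinearMap.comp_apply, map_smul, smul_eq_mul]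
    rw [h.symm, D.π_sign, h.sign_K, e.sign_sign, map_neg, neg_neg]
  rw [S.lap_mul_oddField D (hc.unitField_isOddField h d) ht N ρ, hc.transpose_ad]
  have e1 : N ∘ₗ ((-2 : ℝ) • K) = (-2 : ℝ) • (N ∘ₗ K) := by ext; simp
  have e2 : ((-2 : ℝ) • K ∘ₗ e.sign) ∘ₗ N ∘ₗ e.sign = (-2 : ℝ) • (K ∘ₗ N) := by
    ext a; simp [hN]
  have e3 : e.sign ∘ₗ N ∘ₗ e.sign = N := by ext a; simp [hN]
  rw [e1, e2, e3, lap_smul, lap_smul, neg_mul, lap_neg_right]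
  simp only [neg_smul, smul_neg, smul_sub]
  abel

end IsCubic

variable (D) in
/-- The cohomological vector field induced by the differential. -/
def diffField : Op A := ∑ b, ∑ j, mul (S.coord (j, b)) * S.dir b (D.d (e.sign (e.basis j)))

theorem diffField_isOddField : S.IsOddField (S.diffField D) (D.d ∘ₗ e.sign) 1 := by
  intro b u
  have step : ∀ a j, S.dir b u * (mul (S.coord (j, a)) * S.dir a (D.d (e.sign (e.basis j)))) =
      (if b = a then e.basis.repr u j • S.dir a (D.d (e.sign (e.basis j))) else 0) -
      mul (S.coord (j, a)) * S.dir a (D.d (e.sign (e.basis j))) * S.dir b (e.sign u) := by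
    intro a j
    have hs : e.sign (D.d (e.sign (e.basis j))) = -D.d (e.basis j) := by
      rw [DGFrobenius.sign_d D e, e.sign_sign]
    rcases Nat.even_or_odd (e.deg j) with hj | hj
    · rw [e.sign_basis, hj.neg_one_pow, one_smul] at hs ⊢
      rw [← mul_assoc, S.dir_mul_coord_even hj, sub_mul, mul_assoc, S.dir_comm_of_sign_neg hs,
        smul_mul_assoc, one_mul, mul_assoc]
      split_ifs <;> simp
    · rw [e.sign_basis, hj.neg_one_pow, neg_one_smul, map_neg] at hs ⊢
      rw [← mul_assoc, S.dir_mul_coord_odd hj, add_mul, mul_assoc, S.dir_comm_of_sign hs,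
        smul_mul_assoc, one_mul, mul_assoc, mul_neg, sub_eq_add_neg]
      split_ifs <;> simp
  simp only [diffField, Finset.mul_sum, step, Finset.sum_sub_distrib, ← Finset.sum_mul]
  congr 1
  rw [Finset.sum_comm]
  simp only [Finset.sum_ite_eq, Finset.mem_univ, if_true]
  rw [Finset.sum_eq_single b (by intro a _ ha; rw [Matrix.one_apply_ne ha.symm, zero_smul])
    (by simp), Matrix.one_apply_eq, one_smul, LinearMap.comp_apply]
  conv_rhs => rw [← e.basis.sum_repr u]
  simp only [map_sum, map_smul]

theorem diffField_algebraMap (r : ℝ) : S.diffField D (algebraMap ℝ A r) = 0 := by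
  simp [diffField, S.dir_algebraMap]

theorem isTranspose_d_sign : D.IsTranspose (D.d ∘ₗ e.sign) (-D.d) := by
  intro u w
  rw [LinearMap.comp_apply, DGFrobenius.π_d_left D e, D.π_sign, DGFrobenius.sign_d D e, e.sign_sign]
  simp

/-- Commuting with `diffField` replaces the kernel `N` by its graded commutator with `d`; for a
propagator this is the identity minus the harmonic projector. -/
theorem lap_mul_diffField_of_odd {N : C →ₗ[ℝ] C} (hN : ∀ a, e.sign (N a) = -N (e.sign a)) :
    S.lap D N 1 * S.diffField D =
      S.diffField D * S.lap D N 1 - S.lap D (D.d ∘ₗ N + N ∘ₗ D.d) 1 := by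
  rw [S.lap_mul_oddField D S.diffField_isOddField isTranspose_d_sign]
  have e1 : N ∘ₗ (-D.d) = -(N ∘ₗ D.d) := by ext; simp
  have e2 : (D.d ∘ₗ e.sign) ∘ₗ N ∘ₗ e.sign = -(D.d ∘ₗ N) := by ext a; simp [hN]
  have e3 : e.sign ∘ₗ N ∘ₗ e.sign = -N := by ext a; simp [hN]
  rw [e1, e2, e3]
  simp only [lap_neg, lap_add, mul_one, Matrix.transpose_one, mul_neg]
  abel

theorem lap_mul_diffField_of_even {N : C →ₗ[ℝ] C} (hN : ∀ a, e.sign (N a) = N (e.sign a)) :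
    S.lap D N 1 * S.diffField D + S.diffField D * S.lap D N 1 =
      S.lap D (D.d ∘ₗ N - N ∘ₗ D.d) 1 := by
  rw [S.lap_mul_oddField D S.diffField_isOddField isTranspose_d_sign]
  have e1 : N ∘ₗ (-D.d) = -(N ∘ₗ D.d) := by ext; simp
  have e2 : (D.d ∘ₗ e.sign) ∘ₗ N ∘ₗ e.sign = D.d ∘ₗ N := by ext a; simp [hN]
  have e3 : e.sign ∘ₗ N ∘ₗ e.sign = N := by ext a; simp [hN]
  rw [e1, e2, e3]
  simp only [lap_neg, lap_sub, mul_one, Matrix.transpose_one]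
  abel

end SuperCalculus

end AbstractCS

/-! ### Variation of the two-loop vacuum diagram. -/

namespace AbstractCS

variable {C : Type*} [Ring C] [Algebra ℝ C] {𝒜 : ℕ → Submodule ℝ C} [GradedAlgebra 𝒜]
  {I τ : Type*} {e : HomogeneousBasis 𝒜 I} {A : Type*} [Ring A] [Algebra ℝ A]

theorem DGFrobenius.vtrace_sub [Fintype I] [DecidableEq I] (D : DGFrobenius 𝒜) (v : C)
    (N N' : C →ₗ[ℝ] C) : D.vtrace e v (N - N') = D.vtrace e v N - D.vtrace e v N' := by
  simp only [vtrace, LinearMap.sub_apply, mul_sub, map_sub, Finset.sum_sub_distrib]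

namespace SuperCalculus

theorem lap_lap_comm (S : SuperCalculus (ghost e.deg τ) A) [Fintype I] [DecidableEq I] [Fintype τ]
    (D : DGFrobenius 𝒜) {N : C →ₗ[ℝ] C} (hN : ∀ a, e.sign (N a) = -N (e.sign a))
    (N' : C →ₗ[ℝ] C) (ρ ρ' : Matrix τ τ ℝ) (g : A) :
    S.lap D N ρ (S.lap D N' ρ' g) = S.lap D N' ρ' (S.lap D N ρ g) := by
  rw [← Op.mul_apply, S.lap_mul_comm D hN, Op.mul_apply]

theorem diffField_lap_of_odd (S : SuperCalculus (ghost e.deg τ) A) [Fintype I] [DecidableEq I]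
    [Fintype τ] [DecidableEq τ] (D : DGFrobenius 𝒜) {N : C →ₗ[ℝ] C}
    (hN : ∀ a, e.sign (N a) = -N (e.sign a)) (g : A) :
    S.diffField D (S.lap D N 1 g) =
      S.lap D N 1 (S.diffField D g) + S.lap D (D.d ∘ₗ N + N ∘ₗ D.d) 1 g := by
  rw [← Op.mul_apply, ← Op.mul_apply, S.lap_mul_diffField_of_odd hN, Op.sub_apply, sub_add_cancel]

theorem lap_diffField_of_even (S : SuperCalculus (ghost e.deg τ) A) [Fintype I] [DecidableEq I]
    [Fintype τ] [DecidableEq τ] (D : DGFrobenius 𝒜) {N : C →ₗ[ℝ] C}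
    (hN : ∀ a, e.sign (N a) = N (e.sign a)) (g : A) :
    S.lap D N 1 (S.diffField D g) + S.diffField D (S.lap D N 1 g) =
      S.lap D (D.d ∘ₗ N - N ∘ₗ D.d) 1 g := by
  rw [← Op.mul_apply, ← Op.mul_apply, ← Op.add_apply, S.lap_mul_diffField_of_even hN]

variable {S : SuperCalculus (ghost e.deg τ) A} [Fintype I] [DecidableEq I] [Fintype τ]
  [DecidableEq τ] {D : DGFrobenius 𝒜} {v : C} {K K₀ K₁ : C →ₗ[ℝ] C}

theorem lap_mem_propagator (h : D.IsPropagator e v K) {n : ℕ} {g : ℤ} {f : A}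
    (hf : f ∈ S.wt (n + 2) g) : S.lap D K 1 f ∈ S.wt n g := by
  simpa using S.lap_mem D (s := 1) h.mem (fun i a hi ha => h.mem_zero a (by
    obtain rfl : i = 0 := by omega
    exact ha)) 1 hf

/-- The harmonic projector has kernel 1 ⊗ v + v ⊗ 1, and the fields along 1 and v commute. -/
theorem lap_harmonic (hv : v ∈ 𝒜 3) :
    S.lap D (D.harmonic v) 1 = (2 : ℝ) • ∑ b, S.dir b 1 * S.dir b v := by
  rw [lap_one_right, Finset.smul_sum]
  refine Finset.sum_congr rfl fun b _ => ?_
  have h1 : ∑ m, D.π (D.dual e m) v • S.dir b (e.basis m) = S.dir b v := by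
    simp only [← map_smul, ← map_sum, D.sum_π_dual_basis]
  have h2 : ∑ m, D.π (D.dual e m) 1 • S.dir b (e.basis m) = S.dir b 1 := by
    simp only [← map_smul, ← map_sum, D.sum_π_dual_basis]
  have hs : e.sign v = -v := by rw [e.sign_of_mem hv]; norm_num
  simp only [DGFrobenius.harmonic_apply, map_add, map_smul, add_mul, Finset.sum_add_distrib,
    smul_mul_assoc, ← mul_smul_comm, ← Finset.mul_sum, h1, h2, S.dir_comm_of_sign_neg hs]
  rw [two_smul, mul_add]

theorem lap_shift {w : C} (hw : w ∈ 𝒜 2) :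
    S.lap D (D.shift w) 1 = (2 : ℝ) • ∑ b, S.dir b 1 * S.dir b w := by
  rw [lap_one_right, Finset.smul_sum]
  refine Finset.sum_congr rfl fun b _ => ?_
  have h1 : ∑ m, D.π (D.dual e m) w • S.dir b (e.basis m) = S.dir b w := by
    simp only [← map_smul, ← map_sum, D.sum_π_dual_basis]
  have h2 : ∑ m, D.π (D.dual e m) 1 • S.dir b (e.basis m) = S.dir b 1 := by
    simp only [← map_smul, ← map_sum, D.sum_π_dual_basis]
  have hs : e.sign w = w := by rw [e.sign_of_mem hw]; norm_num
  have hs1 : e.sign (1 : C) = 1 := by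
    rw [e.sign_of_mem (DGFrobenius.one_mem_zero (𝒜 := 𝒜))]; simp
  simp only [DGFrobenius.IsPropagator.shift_apply, map_sub, map_smul, sub_mul,
    Finset.sum_sub_distrib, smul_mul_assoc, ← mul_smul_comm, ← Finset.mul_sum, h1, h2]
  rw [mul_smul_comm, two_smul, ← sub_eq_zero, S.dir_comm_of_sign hs b b 1, hs1]
  abel

namespace IsCubic

variable {f : τ → τ → τ → ℝ} {c : A} (hc : S.IsCubic D f c)

include hc

/-- The third derivatives are the alternating sum of the terms in which `d` acts on one argument of
π(e_k, e_j e_i). This sum vanishes by the Leibniz rule and the invariance of the pairing. -/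
theorem diffField_apply [Nonempty τ] : S.diffField D c = 0 := by
  have hX : ∀ b u g, S.dir b u (S.diffField D g) =
      S.dir b (D.d (e.sign u)) g - S.diffField D (S.dir b (e.sign u) g) := by
    intro b u g
    have := congrArg (fun o : Op A => o g) (S.diffField_isOddField (D := D) b u)
    simp only [Op.mul_apply, Op.sub_apply, Op.sum_apply, Op.smul_apply] at this
    rw [this, Finset.sum_eq_single b
      (by intro a _ ha; rw [Matrix.one_apply_ne ha.symm, zero_smul])
      (by simp), Matrix.one_apply_eq, one_smul, LinearMap.comp_apply]
  have hmem : S.diffField D c ∈ S.wt 3 1 := by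
    simp only [diffField, Op.sum_apply, Op.mul_apply, mul_apply']
    refine Submodule.sum_mem _ fun b _ => Submodule.sum_mem _ fun j _ => ?_
    have := S.mul_mem (S.coord_mem (j, b)) (S.dir_mem hc.mem (i := e.deg j + 1)
      (u := D.d (e.sign (e.basis j))) (by
        rw [e.sign_basis, map_smul]
        exact Submodule.smul_mem _ _ (D.d_mem _ _ (e.mem j))) b)
    convert this using 2
    simp [ghost]
  refine S.eq_zero_of_dir hmem fun d k => S.eq_zero_of_dir (S.dir_mem hmem (e.mem k) d)
    fun b j => S.eq_zero_of_dir (S.dir_mem (S.dir_mem hmem (e.mem k) d) (e.mem j) b) fun a i => ?_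
  obtain ⟨r, hr⟩ := S.exists_const_of_mem (S.dir_mem (S.dir_mem (S.dir_mem hc.mem (e.mem k) d)
    (e.mem j) b) (e.mem i) a)
  simp only [hX, e.sign_basis, map_smul, map_sub, Op.smul_apply, hr, diffField_algebraMap,
    smul_zero, sub_zero]
  rw [hc.third_of_mem (e.mem i) (e.mem j),
    hc.third_of_mem (e.mem i) (D.d_mem _ _ (e.mem j)),
    hc.third_of_mem (D.d_mem _ _ (e.mem i)) (e.mem j)]
  simp only [smul_algebraMap, ← map_sub]
  rw [← map_zero (algebraMap ℝ A)]
  congr 1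
  -- In total degree two only finitely many sign patterns remain; in any other degree each term
  -- vanishes separately.
  by_cases hd : e.deg i + e.deg j + e.deg k = 2
  · have h1 := D.π_d _ (e.basis k) (e.basis j * e.basis i) (e.mem k)
    rw [D.leibniz _ _ _ (e.mem j), map_add, map_smul, smul_eq_mul] at h1
    have h2 : D.π (D.d (e.basis k)) (e.basis j * e.basis i) = - ((-1) ^ e.deg k *
      (D.π (e.basis k) (D.d (e.basis j) * e.basis i) +
      (-1) ^ e.deg j * D.π (e.basis k) (e.basis j * D.d (e.basis i)))) := by linarith
    rw [h2]
    have hi : e.deg i ≤ 2 := by omega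
    have hj : e.deg j ≤ 2 := by omega
    have hk : e.deg k = 2 - e.deg i - e.deg j := by omega
    rw [hk]
    generalize e.deg i = x at *
    generalize e.deg j = y at *
    interval_cases x <;> interval_cases y <;> first | (exfalso; omega) | (norm_num; try ring)
  · rw [D.π_degree _ _ _ _ (D.d_mem _ _ (e.mem k)) (SetLike.GradedMul.mul_mem (e.mem j) (e.mem i))
      (by omega), D.π_degree _ _ _ _ (e.mem k)
      (SetLike.GradedMul.mul_mem (D.d_mem _ _ (e.mem j)) (e.mem i)) (by omega),
      D.π_degree _ _ _ _ (e.mem k)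
      (SetLike.GradedMul.mul_mem (e.mem j) (D.d_mem _ _ (e.mem i))) (by omega)]
    ring

theorem diffField_sq [Nonempty τ] : S.diffField D (c * c) = 0 := by
  have : S.diffField D (c * c) = (2 : ℝ) • (c * S.diffField D c) := by
    simp only [diffField, Op.sum_apply, Op.mul_apply, mul_apply', hc.dir_sq, Finset.mul_sum,
      Finset.smul_sum, mul_smul_comm, ← mul_assoc, hc.comm_of_mem (S.coord_mem _)]
  rw [this, hc.diffField_apply, mul_zero, smul_zero]

/-- There is no tadpole on the second factor, so only the commutator survives. -/
theorem lap_mul_dir_one (K : C →ₗ[ℝ] C) (d b : τ) (u : C) :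
    S.lap D K 1 (S.dir d 1 c * S.dir b u c) = S.unitField D c K d (S.dir b u c) := by
  rw [unitField, Op.sub_apply, Op.mul_apply, Op.mul_apply, mul_apply', hc.lap_dir_eq_zero,
    map_zero, sub_zero]

theorem dir_one_dir_sq [Nonempty τ] (b : τ) {i : ℕ} {u : C} (hu : u ∈ 𝒜 i) :
    S.dir b 1 (S.dir b u (c * c)) = (2 : ℝ) • (S.dir b 1 c * S.dir b u c) := by
  rw [hc.dir_sq, map_smul, S.dir_mul_even hc.mem, hc.dir_dir_same b DGFrobenius.one_mem_zero hu,
    mul_zero, add_zero]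

theorem lap_ad_dir_v (hv : v ∈ 𝒜 3) (N : C →ₗ[ℝ] C) (b : τ) :
    S.lap D N (ad f b) (S.dir b v c) =
      algebraMap ℝ A ((∑ a, ∑ d, f a d b ^ 2) * D.vtrace e v N) := by
  rw [hc.lap_dir_v hv, ← Finset.sum_neg_distrib]
  congr 2
  refine Finset.sum_congr rfl fun a _ => ?_
  rw [← Finset.sum_neg_distrib]
  refine Finset.sum_congr rfl fun d _ => ?_
  rw [ad, Matrix.of_apply, hc.swap₁₂ d a b]
  ring

theorem lap_even_unitField_dir_v (h : D.IsPropagator e v K) {N : C →ₗ[ℝ] C}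
    (hN : ∀ a, e.sign (N a) = N (e.sign a)) (b : τ) :
    S.lap D N 1 (S.unitField D c K b (S.dir b v c)) =
      algebraMap ℝ A (-2 * (∑ a, ∑ d, f a d b ^ 2) * D.vtrace e v (N ∘ₗ K - K ∘ₗ N)) := by
  have := congrArg (fun o : Op A => o (S.dir b v c)) (hc.lap_mul_unitField_of_even h hN 1 b)
  simp only [Op.mul_apply, Op.sub_apply, Op.neg_apply, Op.smul_apply, hc.lap_dir_eq_zero, map_zero,
    neg_zero, zero_sub, mul_one, one_mul, hc.lap_ad_dir_v h.v_mem] at this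
  rw [this, D.vtrace_sub, ← map_sub, smul_algebraMap, ← map_neg]
  congr 1; ring

variable (hCME : S.lap D LinearMap.id 1 (c * c) = 0)

include hCME

/-- The identity part vanishes by the classical master equation `hCME`. In -4 one factor 2 comes
from the two orders of 1 and v, the other from the two factors of c·c. -/
theorem lap_id_sub_harmonic_sq [Nonempty τ] (hv : v ∈ 𝒜 3) :
    S.lap D (LinearMap.id - D.harmonic v) 1 (c * c) =
      (-4 : ℝ) • ∑ b, S.dir b 1 c * S.dir b v c := by
  rw [lap_sub, Op.sub_apply, hCME, lap_harmonic hv, Op.smul_apply, Op.sum_apply, zero_sub]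
  simp only [Op.mul_apply, hc.dir_one_dir_sq _ hv, ← Finset.smul_sum]
  rw [smul_smul, ← neg_smul]
  norm_num

/-- The variation of a two-loop diagram under a change of one of the three propagators. -/
theorem lap_sub_lap_lap_sq [Nonempty τ] (h₀ : D.IsPropagator e v K₀)
    (h₁ : D.IsPropagator e v K₁) {Q R : C →ₗ[ℝ] C} (hQ : D.IsPropagator e v Q)
    (hR : D.IsPropagator e v R) :
    S.lap D (K₁ - K₀) 1 (S.lap D Q 1 (S.lap D R 1 (c * c))) =
      algebraMap ℝ A (8 * (∑ a, ∑ b, ∑ d, f a b d ^ 2) *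
        (D.vtrace e v (K₀ ∘ₗ K₁ ∘ₗ Q - Q ∘ₗ K₀ ∘ₗ K₁) +
          D.vtrace e v (K₀ ∘ₗ K₁ ∘ₗ R - R ∘ₗ K₀ ∘ₗ K₁))) := by
  -- K₀K₁ is a homotopy between the two propagators. It has even parity, so `S.lap D M 1` is odd and
  -- the Laplacian of K₁ - K₀ is its anticommutator with `diffField`.
  set M := K₀ ∘ₗ K₁ with hM
  have hMs : ∀ a, e.sign (M a) = M (e.sign a) := by
    intro a; rw [hM, LinearMap.comp_apply, h₀.sign_K, h₁.sign_K]; simp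
  have hdM : K₁ - K₀ = D.d ∘ₗ M - M ∘ₗ D.d := by
    ext a; simp [hM, ← h₀.sub_eq_commutator h₁]
  have hXK : ∀ {K : C →ₗ[ℝ] C}, D.IsPropagator e v K → ∀ g, S.diffField D (S.lap D K 1 g) =
      S.lap D K 1 (S.diffField D g) + S.lap D (LinearMap.id - D.harmonic v) 1 g := by
    intro K hK g
    have h2 : D.d ∘ₗ K + K ∘ₗ D.d = LinearMap.id - D.harmonic v := by
      ext a; simpa using hK.homotopy a
    rw [S.diffField_lap_of_odd D hK.sign_K, h2]
  have hcomm : ∀ g, S.lap D (LinearMap.id - D.harmonic v) 1 (S.lap D R 1 g) =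
      S.lap D R 1 (S.lap D (LinearMap.id - D.harmonic v) 1 g) := fun g =>
    (S.lap_lap_comm D hR.sign_K _ 1 1 g).symm
  have hcc : c * c ∈ S.wt (0 + 2 + 2 + 2) 0 := by simpa using S.mul_mem hc.mem hc.mem
  -- Three Laplacians use up all six legs of c·c, and `diffField` kills constants.
  have hconst : S.diffField D (S.lap D M 1 (S.lap D Q 1 (S.lap D R 1 (c * c)))) = 0 := by
    have := S.lap_mem D (N := M) (s := 2)
      (fun i a ha => by
        rw [hM, LinearMap.comp_apply]
        exact h₀.mem i _ (h₁.mem (i + 1) a ha))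
      (fun i a hi ha => by
        rw [hM, LinearMap.comp_apply]
        interval_cases i
        · rw [h₁.mem_zero a ha, map_zero]
        · exact h₀.mem_zero _ (h₁.mem 0 a ha)) 1
      (lap_mem_propagator hQ (lap_mem_propagator hR hcc))
    obtain ⟨r, hr⟩ := S.exists_const_of_mem this
    rw [hr, diffField_algebraMap]
  have h1 := S.lap_diffField_of_even D hMs (S.lap D Q 1 (S.lap D R 1 (c * c)))
  rw [hconst, add_zero, ← hdM] at h1
  have h2 : ∀ {N : C →ₗ[ℝ] C}, D.IsPropagator e v N →
      S.lap D M 1 (S.lap D N 1 ((-4 : ℝ) • ∑ b, S.dir b 1 c * S.dir b v c)) =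
      algebraMap ℝ A (8 * (∑ a, ∑ b, ∑ d, f a b d ^ 2) * D.vtrace e v (M ∘ₗ N - N ∘ₗ M)) := by
    intro N hN
    rw [map_smul, map_smul, map_sum, map_sum]
    have h3 : ∀ b, S.lap D M 1 (S.lap D N 1 (S.dir b 1 c * S.dir b v c)) =
        algebraMap ℝ A (-2 * (∑ a, ∑ d, f a d b ^ 2) * D.vtrace e v (M ∘ₗ N - N ∘ₗ M)) := by
      intro b
      rw [hc.lap_mul_dir_one, hc.lap_even_unitField_dir_v hN hMs]
    have hF : ∑ a, ∑ b, ∑ d, f a b d ^ 2 = ∑ b, ∑ a, ∑ d, f a d b ^ 2 := by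
      rw [Finset.sum_comm (f := fun b a => ∑ d, f a d b ^ 2)]
      exact Finset.sum_congr rfl fun a _ => Finset.sum_comm
    rw [Finset.sum_congr rfl fun b _ => h3 b, ← map_sum (algebraMap ℝ A), smul_algebraMap,
      ← Finset.sum_mul, ← Finset.mul_sum, ← hF]
    congr 1; ring
  -- `diffField` annihilates c·c, so what is left are the two terms in which `Q` or `R` is replaced
  -- by the identity minus the projector.
  have h4 : S.diffField D (S.lap D Q 1 (S.lap D R 1 (c * c))) =
      S.lap D Q 1 ((-4 : ℝ) • ∑ b, S.dir b 1 c * S.dir b v c) +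
      S.lap D R 1 ((-4 : ℝ) • ∑ b, S.dir b 1 c * S.dir b v c) := by
    rw [hXK hQ, hXK hR, hc.diffField_sq, map_zero, zero_add, hcomm,
      hc.lap_id_sub_harmonic_sq hCME h₀.v_mem]
  have h5 : ∀ N : C →ₗ[ℝ] C, M ∘ₗ N - N ∘ₗ M = K₀ ∘ₗ K₁ ∘ₗ N - N ∘ₗ K₀ ∘ₗ K₁ := by
    intro N; ext a; simp [hM]
  rw [← h1, h4, map_add, h2 hQ, h2 hR, ← map_add, ← mul_add, h5, h5]

/-- Dependence of the two-loop diagram on the propagator for given harmonic representatives. -/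
theorem lap_cube_sq_sub [Nonempty τ] (h₀ : D.IsPropagator e v K₀) (h₁ : D.IsPropagator e v K₁) :
    S.lap D K₁ 1 (S.lap D K₁ 1 (S.lap D K₁ 1 (c * c))) -
      S.lap D K₀ 1 (S.lap D K₀ 1 (S.lap D K₀ 1 (c * c))) =
    algebraMap ℝ A (48 * (∑ a, ∑ b, ∑ d, f a b d ^ 2) *
      (D.vtrace e v (K₁ ∘ₗ K₁ ∘ₗ K₁) - D.vtrace e v (K₀ ∘ₗ K₀ ∘ₗ K₀))) := by
  have hcomm : ∀ g, S.lap D K₀ 1 (S.lap D K₁ 1 g) = S.lap D K₁ 1 (S.lap D K₀ 1 g) := fun g =>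
    S.lap_lap_comm D h₀.sign_K _ 1 1 g
  -- The factorization x³ - y³ = (x - y)(x² + xy + y²) for commuting Laplacians.
  have e1 : S.lap D K₁ 1 (S.lap D K₁ 1 (S.lap D K₁ 1 (c * c))) -
      S.lap D K₀ 1 (S.lap D K₀ 1 (S.lap D K₀ 1 (c * c))) =
      S.lap D (K₁ - K₀) 1 (S.lap D K₁ 1 (S.lap D K₁ 1 (c * c))) +
      S.lap D (K₁ - K₀) 1 (S.lap D K₁ 1 (S.lap D K₀ 1 (c * c))) +
      S.lap D (K₁ - K₀) 1 (S.lap D K₀ 1 (S.lap D K₀ 1 (c * c))) := by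
    simp only [lap_sub, Op.sub_apply, hcomm]
    abel
  rw [e1, hc.lap_sub_lap_lap_sq hCME h₀ h₁ h₁ h₁, hc.lap_sub_lap_lap_sq hCME h₀ h₁ h₁ h₀,
    hc.lap_sub_lap_lap_sq hCME h₀ h₁ h₀ h₀, ← map_add, ← map_add]
  congr 1
  -- The three variations add up to 3·8 times the trace of K₀K₁K₁ - K₁K₀K₁ + K₀K₁K₀ - K₀K₀K₁. The
  -- triple identities turn this operator into 2(K₁³ - K₀³), and 48 = 3·8·2.
  have m1 : K₀ ∘ₗ K₁ ∘ₗ K₁ = K₁ ∘ₗ K₁ ∘ₗ K₁ := LinearMap.ext (h₀.K₀_K₁_K₁ h₁)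
  have m2 : K₀ ∘ₗ K₀ ∘ₗ K₁ = K₀ ∘ₗ K₀ ∘ₗ K₀ := LinearMap.ext (h₀.K₀_K₀_K₁ h₁)
  have m3 : K₁ ∘ₗ K₀ ∘ₗ K₁ - K₀ ∘ₗ K₁ ∘ₗ K₀ = K₀ ∘ₗ K₀ ∘ₗ K₀ - K₁ ∘ₗ K₁ ∘ₗ K₁ :=
    LinearMap.ext (h₀.K₁_K₀_K₁_sub h₁)
  have m4 := congrArg (D.vtrace e v) m3
  simp only [D.vtrace_sub, m1, m2] at m4 ⊢
  linear_combination (-24) * (∑ a, ∑ b, ∑ d, f a b d ^ 2) * m4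

omit hCME in
/-- The two-loop diagram of a strict propagator does not change under a shift of the harmonic
representatives. -/
theorem lap_cube_sq_shift [Nonempty τ] {v₁ : C} (h : D.IsPropagator e v K)
    (hK : ∀ a, K (K a) = 0) (hv₁ : v₁ ∈ 𝒜 3) (hd : D.d v₁ = 0) (hπ : D.π 1 v₁ = 1)
    (h₁ : K₁ = K + D.shift (K v₁)) :
    S.lap D K₁ 1 (S.lap D K₁ 1 (S.lap D K₁ 1 (c * c))) =
      S.lap D K 1 (S.lap D K 1 (S.lap D K 1 (c * c))) := by
  have hp := h.add_shift hv₁ hd hπ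
  rw [← h₁] at hp
  have hcomm : ∀ {N N' : C →ₗ[ℝ] C}, (∀ a, e.sign (N a) = -N (e.sign a)) → ∀ g,
      S.lap D N 1 (S.lap D N' 1 g) = S.lap D N' 1 (S.lap D N 1 g) := fun hN g =>
    S.lap_lap_comm D hN _ 1 1 g
  have hw : K v₁ ∈ 𝒜 2 := h.mem 2 _ hv₁
  have hsub : K₁ - K = D.shift (K v₁) := by rw [h₁, add_sub_cancel_left]
  -- The shift has a kernel built from 1 and w = K v₁, so it leaves ∂₁c·∂_w c. Applying `R` gives a
  -- unit field on ∂_w c; moving `Q` past it costs only terms with kernels QR and RQ, and on ∂_w c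
  -- itself `Q` is a tadpole.
  have key : ∀ {Q R : C →ₗ[ℝ] C} {v' v'' : C}, D.IsPropagator e v' Q → D.IsPropagator e v'' R →
      Q ∘ₗ R = 0 → R ∘ₗ Q = 0 →
      S.lap D (K₁ - K) 1 (S.lap D Q 1 (S.lap D R 1 (c * c))) = 0 := by
    intro Q R v' v'' hQ hR h1 h2
    rw [← hcomm hQ.sign_K, ← hcomm hR.sign_K, hsub, lap_shift hw, Op.smul_apply, Op.sum_apply]
    simp only [Op.mul_apply, hc.dir_one_dir_sq _ hw, map_smul, map_sum]
    rw [Finset.sum_eq_zero, smul_zero]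
    intro b _
    have := congrArg (fun o : Op A => o (S.dir b (K v₁) c))
      (hc.lap_mul_unitField_of_odd hR hQ.sign_K 1 b)
    simp only [Op.mul_apply, hc.lap_dir_eq_zero, map_zero, h1, h2, lap_zero, add_zero, smul_zero,
      sub_zero] at this
    rw [hc.lap_mul_dir_one R, this, smul_zero]
  have hKK : K ∘ₗ K = 0 := LinearMap.ext hK
  have hs := h.shift_mul hK hv₁
  have h10 : K₁ ∘ₗ K = 0 := by ext a; simp [h₁, hK, (hs a).2.1]
  have h01 : K ∘ₗ K₁ = 0 := by ext a; simp [h₁, hK, (hs a).1]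
  have h11 : K₁ ∘ₗ K₁ = 0 := by
    ext a
    have := congrArg (fun o : C →ₗ[ℝ] C => o (D.shift (K v₁) a)) h10
    simp [h₁, hK, (hs a).1, (hs a).2.1, (hs a).2.2]
  rw [← sub_eq_zero]
  have e1 : S.lap D K₁ 1 (S.lap D K₁ 1 (S.lap D K₁ 1 (c * c))) -
      S.lap D K 1 (S.lap D K 1 (S.lap D K 1 (c * c))) =
      S.lap D (K₁ - K) 1 (S.lap D K₁ 1 (S.lap D K₁ 1 (c * c))) +
      S.lap D (K₁ - K) 1 (S.lap D K₁ 1 (S.lap D K 1 (c * c))) +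
      S.lap D (K₁ - K) 1 (S.lap D K 1 (S.lap D K 1 (c * c))) := by
    have hc' : ∀ g, S.lap D K 1 (S.lap D K₁ 1 g) = S.lap D K₁ 1 (S.lap D K 1 g) :=
      fun g => hcomm h.sign_K g
    simp only [lap_sub, Op.sub_apply, hc']
    abel
  rw [e1, key hp hp h11 h11, key hp h h10 h01, key h h hKK hKK, add_zero, add_zero]

end IsCubic

end SuperCalculus

end AbstractCS

/-! ### Functions on cohomology and restriction of diagrams. -/

namespace AbstractCS

variable {C : Type*} [Ring C] [Algebra ℝ C] {𝒜 : ℕ → Submodule ℝ C} [GradedAlgebra 𝒜]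
  {I τ : Type*} {e : HomogeneousBasis 𝒜 I} {A : Type*} [Ring A] [Algebra ℝ A]
  {B : Type*} [Ring B] [Algebra ℝ B]

namespace SuperCalculus

section Target

variable (S' : SuperCalculus (ghost ![0, 3] τ) B)

theorem ghost_zero (a : τ) : ghost ![0, 3] τ (0, a) = 1 := by simp [ghost]
theorem ghost_one (a : τ) : ghost ![0, 3] τ (1, a) = -2 := by simp [ghost]

/-- Cubic functions of ghost number zero are determined by their mixed third derivatives. -/
theorem eq_zero_of_third_pderiv [Fintype τ] {f : B} (hf : f ∈ S'.wt 3 0)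
    (h : ∀ a b c, S'.pderiv (1, c) (S'.pderiv (0, b) (S'.pderiv (0, a) f)) = 0) : f = 0 := by
  have hz : ∀ (x y z : Fin 2 × τ), (0 : ℤ) - ghost ![0, 3] τ x - ghost ![0, 3] τ y -
      ghost ![0, 3] τ z ≠ 0 → S'.pderiv z (S'.pderiv y (S'.pderiv x f)) = 0 := fun x y z hg =>
    S'.eq_zero_of_mem_wt_zero hg (S'.pderiv_mem (S'.pderiv_mem (S'.pderiv_mem hf x) y) z)
  have h2 : ∀ a b c, S'.pderiv (0, c) (S'.pderiv (1, b) (S'.pderiv (0, a) f)) = 0 := by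
    intro a b c; rw [S'.pderiv_comm, h, smul_zero]
  have h3 : ∀ a b c, S'.pderiv (0, c) (S'.pderiv (0, b) (S'.pderiv (1, a) f)) = 0 := by
    intro a b c; rw [S'.pderiv_comm (0, b), map_smul, h2, smul_zero]
  refine S'.eq_zero_of_pderiv hf fun x => S'.eq_zero_of_pderiv (S'.pderiv_mem hf x) fun y =>
    S'.eq_zero_of_pderiv (S'.pderiv_mem (S'.pderiv_mem hf x) y) fun z => ?_
  obtain ⟨x, a⟩ := x
  obtain ⟨y, b⟩ := y
  obtain ⟨z, c⟩ := z
  fin_cases x <;> fin_cases y <;> fin_cases z <;>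
    first
    | exact h a b c
    | exact h2 a b c
    | exact h3 a b c
    | exact hz _ _ _ (by simp [ghost])

/-- Functions of ghost number zero are combinations of constants and cubic functions. -/
theorem eq_zero_of_mem_wt_ghost_zero (S' : SuperCalculus (ghost ![0, 3] (Fin 3)) B) {n : ℕ}
    (h0 : n ≠ 0) (h3 : n ≠ 3) {f : B} (hf : f ∈ S'.wt n 0) : f = 0 := by
  refine S'.wt_induction (p := fun f => f = 0) rfl (fun f g hf hg => by rw [hf, hg, add_zero])
    (fun r f hf => by rw [hf, smul_zero]) (fun l hl hg => ?_) hf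
  by_contra hne
  have hdup : ∀ x : Fin 3, ¬ List.Duplicate ((0, x) : Fin 2 × Fin 3) l := fun x hx =>
    hne (S'.monomial_eq_zero_of_duplicate (by rw [ghost_zero]; decide) hx)
  -- With p coordinates of ghost number 1 among n, the ghost number is 3p - 2n. Non-repetition of
  -- odd coordinates gives p ≤ 3, so ghost number zero leaves only p = 0, n = 0 and p = 2, n = 3.
  have hsum : ∀ l : List (Fin 2 × Fin 3), (l.map (ghost ![0, 3] (Fin 3))).sum =
      3 * ((l.filter fun x => x.1 = 0).length : ℤ) - 2 * l.length := by
    intro l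
    induction l with
    | nil => simp
    | cons x l ih =>
      obtain ⟨i, a⟩ := x
      rw [List.map_cons, List.sum_cons, ih]
      fin_cases i
      · simp [ghost_zero]; ring
      · simp [ghost_one]; ring
  have hnd : (l.filter fun x => x.1 = 0).Nodup := by
    rw [List.nodup_iff_forall_not_duplicate]
    rintro ⟨i, a⟩ hx
    have hi : i = 0 := by simpa using List.of_mem_filter hx.mem
    subst hi
    exact hdup a (hx.mono_sublist List.filter_sublist)
  have hle : (l.filter fun x => x.1 = 0).length ≤ 3 := by
    rw [← List.toFinset_card_of_nodup hnd]
    calc _ ≤ (Finset.univ.image fun a : Fin 3 => ((0, a) : Fin 2 × Fin 3)).card :=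
          Finset.card_le_card fun x hx => by
            simp only [List.mem_toFinset, List.mem_filter, decide_eq_true_eq] at hx
            exact Finset.mem_image.mpr ⟨x.2, Finset.mem_univ _, Prod.ext hx.2.symm rfl⟩
      _ ≤ 3 := Finset.card_image_le.trans (by simp)
  have key : ∀ m : ℕ, m ≤ 3 → (0 : ℤ) = 3 * m - 2 * n → False := by omega
  exact key _ hle (by rw [← hg, hsum, hl])

end Target

/-- `φ` is the pull-back to the functions on the span of `1` and `v`. -/
structure IsRestriction (S : SuperCalculus (ghost e.deg τ) A)
    (S' : SuperCalculus (ghost ![0, 3] τ) B) (v : C) (φ : A →ₐ[ℝ] B) : Prop where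
  map_mem : ∀ {n : ℕ} {g : ℤ} {f : A}, f ∈ S.wt n g → φ f ∈ S'.wt n g
  pderiv_zero : ∀ b f, S'.pderiv (0, b) (φ f) = φ (S.dir b 1 f)
  pderiv_one : ∀ b f, S'.pderiv (1, b) (φ f) = φ (S.dir b v f)

variable {S : SuperCalculus (ghost e.deg τ) A} {S' : SuperCalculus (ghost ![0, 3] τ) B}
  [Fintype I] [DecidableEq I] [Fintype τ] [DecidableEq τ] {D : DGFrobenius 𝒜} {v : C}
  {K : C →ₗ[ℝ] C} {φ : A →ₐ[ℝ] B} {f : τ → τ → τ → ℝ} {c : A}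

theorem pow_lap_mem (h : D.IsPropagator e v K) (E : ℕ) {n : ℕ} {g : ℤ} {f : A}
    (hf : f ∈ S.wt (n + 2 * E) g) : (S.lap D K 1 ^ E) f ∈ S.wt n g := by
  induction E generalizing n with
  | zero => simpa using hf
  | succ E ih =>
    rw [pow_succ', Op.mul_apply]
    exact lap_mem_propagator h (ih (by convert hf using 2; ring))

theorem pow_lap_of_lt (h : D.IsPropagator e v K) (E : ℕ) {n : ℕ} {g : ℤ} {f : A}
    (hf : f ∈ S.wt n g) (hn : n < 2 * E) : (S.lap D K 1 ^ E) f = 0 := by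
  induction E generalizing n f with
  | zero => omega
  | succ E ih =>
    rw [pow_succ, Op.mul_apply]
    rcases Nat.lt_or_ge n 2 with h2 | h2
    · rw [S.lap_of_mem_lt D K 1 h2 hf, map_zero]
    · obtain ⟨m, rfl⟩ := Nat.exists_eq_add_of_le' h2
      exact ih (lap_mem_propagator h hf) (by omega)

theorem dir_pow_lap (h : D.IsPropagator e v K) (E : ℕ) (b : τ) (u : C) (g : A) :
    S.dir b u ((S.lap D K 1 ^ E) g) = (S.lap D K 1 ^ E) (S.dir b u g) := by
  induction E generalizing g with
  | zero => simp
  | succ E ih =>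
    rw [pow_succ, Op.mul_apply, ih, ← Op.mul_apply (S.dir b u),
      S.dir_mul_lap_of_odd D h.sign_K, Op.mul_apply, Op.mul_apply]

namespace IsCubic

variable (hc : S.IsCubic D f c)

include hc

theorem dir_unitField (h : D.IsPropagator e v K) (d b : τ) {u : C} (hu : K (e.sign u) = 0)
    (g : A) : S.dir b u (S.unitField D c K d g) = -S.unitField D c K d (S.dir b (e.sign u) g) := by
  rw [← Op.mul_apply, hc.unitField_isOddField h d b u, Op.sub_apply, Op.mul_apply]
  simp [hu]

theorem unitField_mem (h : D.IsPropagator e v K) (d : τ) {n : ℕ} {g : ℤ} {f' : A}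
    (hf : f' ∈ S.wt n g) : S.unitField D c K d f' ∈ S.wt n (g - 1) := by
  rw [unitField, Op.sub_apply, Op.mul_apply, Op.mul_apply, mul_apply', mul_apply']
  refine Submodule.sub_mem _ (lap_mem_propagator h ?_) ?_
  · convert S.mul_mem (hc.dir_one_mem d) hf using 2 <;> ring
  · rcases Nat.lt_or_ge n 2 with h2 | h2
    · rw [S.lap_of_mem_lt D K 1 h2 hf, mul_zero]; exact Submodule.zero_mem _
    · obtain ⟨m, rfl⟩ := Nat.exists_eq_add_of_le' h2
      convert S.mul_mem (hc.dir_one_mem d) (lap_mem_propagator h hf) using 2 <;> ring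

/-- The unit field is built from K, which kills 1 and v; derivatives along these directions
therefore pass through it up to sign. By induction on the degree all derivatives of the restriction
vanish. -/
theorem map_unitField (h : D.IsPropagator e v K) (hφ : S.IsRestriction S' v φ) (d : τ) {n : ℕ}
    {g : ℤ} {f' : A} (hf : f' ∈ S.wt n g) : φ (S.unitField D c K d f') = 0 := by
  induction n generalizing g f' with
  | zero =>
    obtain ⟨r, rfl⟩ := S.exists_const_of_mem hf
    rw [hc.unitField_algebraMap, map_zero]
  | succ n ih =>
    refine S'.eq_zero_of_pderiv (hφ.map_mem (hc.unitField_mem h d hf)) ?_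
    have hs1 : e.sign (1 : C) = 1 := by
      rw [e.sign_of_mem (DGFrobenius.one_mem_zero (𝒜 := 𝒜))]; simp
    have hsv : e.sign v = -v := by rw [e.sign_of_mem h.v_mem]; norm_num
    rintro ⟨x, b⟩
    fin_cases x
    · have := ih (S.dir_mem hf DGFrobenius.one_mem_zero b)
      change S'.pderiv (0, b) _ = 0
      rw [hφ.pderiv_zero, hc.dir_unitField h d b (by rw [hs1, h.map_one]), hs1, map_neg, this,
        neg_zero]
    · have := ih (S.dir_mem hf h.v_mem b)
      change S'.pderiv (1, b) _ = 0
      rw [hφ.pderiv_one, hc.dir_unitField h d b (by rw [hsv, map_neg, h.map_v, neg_zero]), hsv,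
        map_neg (S.dir b), Op.neg_apply, map_neg, map_neg, map_neg, this, neg_neg]

theorem lap_mul_unitField (h : D.IsPropagator e v K) (d : τ) :
    S.lap D K 1 * S.unitField D c K d = S.unitField D c K d * S.lap D K 1 -
      (4 : ℝ) • S.lap D (K ∘ₗ K) (ad f d) := by
  rw [hc.lap_mul_unitField_of_odd h h.sign_K, one_mul, mul_one, ← two_smul ℝ, smul_smul]
  norm_num

theorem lap_mul_mul_dir_one (d : τ) :
    S.lap D K 1 * mul (S.dir d 1 c) = mul (S.dir d 1 c) * S.lap D K 1 + S.unitField D c K d := by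
  rw [unitField, add_sub_cancel]

/-- For K² = 0 the second commutator of the Laplacian with ∂₁c vanishes, so only the first-order
term of the binomial expansion is left. The value of `E - 1` at `E = 0` is irrelevant, because the
coefficient is zero. -/
theorem pow_lap_mul_of_strict (h : D.IsPropagator e v K) (hK : ∀ a, K (K a) = 0) (d : τ) (E : ℕ) :
    S.lap D K 1 ^ E * mul (S.dir d 1 c) = mul (S.dir d 1 c) * S.lap D K 1 ^ E +
      (E : ℝ) • (S.unitField D c K d * S.lap D K 1 ^ (E - 1)) := by
  have hKK : K ∘ₗ K = 0 := LinearMap.ext hK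
  have hcomm := hc.lap_mul_unitField h d
  rw [hKK, lap_zero, smul_zero, sub_zero] at hcomm
  induction E with
  | zero => simp
  | succ E ih =>
    rw [pow_succ', mul_assoc, ih, mul_add, ← mul_assoc, hc.lap_mul_mul_dir_one, add_mul,
      mul_smul_comm, ← mul_assoc, hcomm, mul_assoc, mul_assoc, Nat.add_sub_cancel]
    rcases E with _ | E
    · simp
    · rw [Nat.add_sub_cancel, ← pow_succ', ← pow_succ', add_assoc]
      congr 1
      push_cast
      module

theorem map_pow_lap_of_strict (h : D.IsPropagator e v K) (hK : ∀ a, K (K a) = 0)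
    (hφ : S.IsRestriction S' v φ) (d : τ) (E V : ℕ) :
    φ ((S.lap D K 1 ^ E) (S.dir d 1 c * c ^ V)) =
      φ (S.dir d 1 c) * φ ((S.lap D K 1 ^ E) (c ^ V)) := by
  have hV : c ^ V ∈ S.wt (3 * V) 0 := S.pow_mem hc.mem V
  have h0 : φ (S.unitField D c K d ((S.lap D K 1 ^ (E - 1)) (c ^ V))) = 0 := by
    rcases Nat.lt_or_ge (3 * V) (2 * (E - 1)) with h1 | h1
    · rw [pow_lap_of_lt h _ hV h1, map_zero, map_zero]
    · obtain ⟨m, hm⟩ := Nat.exists_eq_add_of_le' h1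
      rw [hm] at hV
      exact hc.map_unitField h hφ d (pow_lap_mem h _ hV)
  rw [← mul_apply' (S.dir d 1 c), ← Op.mul_apply, hc.pow_lap_mul_of_strict h hK, Op.add_apply,
    Op.smul_apply, Op.mul_apply, Op.mul_apply, mul_apply', map_add, map_smul, h0, smul_zero,
    add_zero, map_mul]

/-- Binomial expansion in iterated commutators: the first has multiplicity 3, the second is -4 times
the operator with kernel K² and has multiplicity 3, and the third vanishes because that operator
commutes with the Laplacian. -/
theorem pow_three_lap_mul (h : D.IsPropagator e v K) (d : τ) :
    S.lap D K 1 ^ 3 * mul (S.dir d 1 c) = mul (S.dir d 1 c) * S.lap D K 1 ^ 3 +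
      (3 : ℝ) • (S.unitField D c K d * S.lap D K 1 ^ 2) -
      (12 : ℝ) • (S.lap D (K ∘ₗ K) (ad f d) * S.lap D K 1) := by
  have e1 := hc.lap_mul_mul_dir_one (K := K) d
  have e2 := hc.lap_mul_unitField h d
  have e3 : S.lap D K 1 * S.lap D (K ∘ₗ K) (ad f d) = S.lap D (K ∘ₗ K) (ad f d) * S.lap D K 1 :=
    S.lap_mul_comm D h.sign_K _ _
  generalize S.lap D K 1 = Δ at *
  generalize S.unitField D c K d = H at *
  generalize S.lap D (K ∘ₗ K) (ad f d) = G at *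
  generalize mul (S.dir d 1 c) = q at *
  have s2 : Δ * (Δ * q) = q * Δ * Δ + (2 : ℝ) • (H * Δ) - (4 : ℝ) • G := by
    rw [e1, mul_add, ← mul_assoc, e1, e2, add_mul, two_smul]
    abel
  have : Δ ^ 3 * q = Δ * (Δ * (Δ * q)) := by noncomm_ring
  rw [this, s2, mul_sub, mul_add, mul_smul_comm, mul_smul_comm, ← mul_assoc, ← mul_assoc,
    ← mul_assoc, e1, e2, e3]
  simp only [add_mul, sub_mul, smul_mul_assoc]
  have e4 : Δ ^ 3 = Δ * Δ * Δ := by noncomm_ring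
  rw [e4, sq]
  simp only [mul_assoc, smul_sub, smul_smul]
  module

theorem lap_apply_self [Nonempty τ] (h : D.IsPropagator e v K) : S.lap D K 1 c = 0 := by
  refine S.eq_zero_of_dir (n := 0) (g := 0) (lap_mem_propagator h hc.mem) fun b i => ?_
  rw [← Op.mul_apply, S.dir_mul_lap_of_odd D h.sign_K, Op.mul_apply, hc.lap_dir_eq_zero]

/-- The first factor is linear, and its commutator with the Laplacian is a constant field along K v
= 0; the Laplacian of `c` alone is a tadpole. -/
theorem lap_dir_v_dir_one_mul [Nonempty τ] (h : D.IsPropagator e v K) (b d : τ) :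
    S.lap D K 1 (S.dir b v (S.dir d 1 c) * c) = 0 := by
  have := S.lap_mul_linear h (hc.dir_dir_one b d v)
  have hsv : e.sign v = -v := by rw [e.sign_of_mem h.v_mem]; norm_num
  have h0 : ∀ a, ∑ j, (-f a b d * D.π (e.sign v) (e.basis j)) • S.dir a (K (D.dual e j)) = 0 := by
    intro a
    have h1 := congrArg (fun x => S.dir a (K x)) (D.sum_π_basis_dual e v)
    simp only [map_sum, map_smul, h.map_v, map_zero] at h1
    simp only [hsv, map_neg, LinearMap.neg_apply, mul_neg, neg_mul, neg_neg, ← smul_smul,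
      ← Finset.smul_sum, D.π_comm e v, h1, smul_zero]
  rw [Finset.sum_comm, Finset.sum_eq_zero fun a _ => h0 a, smul_zero, sub_eq_zero] at this
  rw [← mul_apply', ← Op.mul_apply, this, Op.mul_apply, hc.lap_apply_self h, map_zero]

theorem lap_sq_unitField_dir_v (h : D.IsPropagator e v K) (a b d : τ) :
    S.lap D (K ∘ₗ K) (ad f a) (S.unitField D c K b (S.dir d v c)) =
      algebraMap ℝ A (2 * (∑ x, ∑ y, (ad f a * ad f b - ad f b * ad f a) x y * f x y d) *
        D.vtrace e v (K ∘ₗ K ∘ₗ K)) := by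
  have hKK : ∀ x, e.sign ((K ∘ₗ K) x) = (K ∘ₗ K) (e.sign x) := by
    intro x; simp [h.sign_K]
  rw [← Op.mul_apply, hc.lap_mul_unitField_of_even h hKK, Op.sub_apply, Op.neg_apply,
    Op.mul_apply, hc.lap_dir_v h.v_mem, hc.unitField_algebraMap, Op.smul_apply, Op.sub_apply,
    hc.lap_dir_v h.v_mem, hc.lap_dir_v h.v_mem, ← map_sub, smul_algebraMap, neg_zero, zero_sub,
    ← map_neg, LinearMap.comp_assoc]
  congr 1
  simp only [Matrix.sub_apply, sub_mul, Finset.sum_sub_distrib]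
  ring

/-- The mixed third derivatives of the two-loop correction of the cubic term. -/
theorem dir_dir_lap_sq_lap [Nonempty τ] (h : D.IsPropagator e v K) (a b d : τ) :
    S.dir d v (S.dir b 1 (S.lap D (K ∘ₗ K) (ad f a) (S.lap D K 1 (c ^ 2)))) =
      algebraMap ℝ A (-4 * (∑ x, ∑ y, (ad f a * ad f b - ad f b * ad f a) x y * f x y d) *
        D.vtrace e v (K ∘ₗ K ∘ₗ K)) := by
  have hKK : ∀ x, e.sign ((K ∘ₗ K) x) = (K ∘ₗ K) (e.sign x) := by
    intro x; simp [h.sign_K]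
  have hs1 : e.sign (1 : C) = 1 := by
    rw [e.sign_of_mem (DGFrobenius.one_mem_zero (𝒜 := 𝒜))]; simp
  have hsv : e.sign v = -v := by rw [e.sign_of_mem h.v_mem]; norm_num
  have c1 : ∀ g, S.dir b 1 (S.lap D (K ∘ₗ K) (ad f a) g) =
      -S.lap D (K ∘ₗ K) (ad f a) (S.dir b 1 g) := by
    intro g
    rw [← Op.mul_apply, S.dir_mul_lap_of_even D hKK, hs1, Op.neg_apply, Op.mul_apply]
  have c2 : ∀ g, S.dir d v (S.lap D (K ∘ₗ K) (ad f a) g) =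
      S.lap D (K ∘ₗ K) (ad f a) (S.dir d v g) := by
    intro g
    rw [← Op.mul_apply, S.dir_mul_lap_of_even D hKK, hsv, map_neg, mul_neg, neg_neg, Op.mul_apply]
  have c3 : ∀ x u g, S.dir x u (S.lap D K 1 g) = S.lap D K 1 (S.dir x u g) := by
    intro x u g
    rw [← Op.mul_apply, S.dir_mul_lap_of_odd D h.sign_K, Op.mul_apply]
  have c4 : S.dir d v (S.dir b 1 (c ^ 2)) =
      (2 : ℝ) • (S.dir d v (S.dir b 1 c) * c + S.dir b 1 c * S.dir d v c) := by
    rw [sq, hc.dir_sq, map_smul, ← hc.comm, S.dir_mul_odd (by decide) (hc.dir_one_mem b), hsv,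
      map_neg, Op.neg_apply, mul_neg, sub_neg_eq_add]
  rw [c1, map_neg, c2, c3, c3, c4, map_smul, map_add, hc.lap_dir_v_dir_one_mul h, zero_add,
    hc.lap_mul_dir_one, map_smul, hc.lap_sq_unitField_dir_v h, smul_algebraMap, ← map_neg]
  congr 1; ring

theorem lap_cube_mem_const (h : D.IsPropagator e v K) :
    ∃ θ : ℝ, (S.lap D K 1 ^ 3) (c ^ 2) = algebraMap ℝ A θ :=
  S.exists_const_of_mem (pow_lap_mem h 3 (g := 0) (S.pow_mem hc.mem 2))

/-- The third derivatives of the two-loop correction of the cubic term. -/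
theorem third_lap_cube [Nonempty τ] (h : D.IsPropagator e v K) (hφ : S.IsRestriction S' v φ)
    {θ : ℝ} (hθ : (S.lap D K 1 ^ 3) (c ^ 2) = algebraMap ℝ A θ) (a b d : τ) :
    S'.pderiv (1, d) (S'.pderiv (0, b) (S'.pderiv (0, a) (φ ((S.lap D K 1 ^ 3) (c ^ 3))))) =
      algebraMap ℝ B (3 * θ * f a b d +
        144 * (∑ x, ∑ y, (ad f a * ad f b - ad f b * ad f a) x y * f x y d) *
        D.vtrace e v (K ∘ₗ K ∘ₗ K)) := by
  have hHmem : ∃ n g, (S.lap D K 1 ^ 2) (c ^ 2) ∈ S.wt n g :=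
    ⟨2, 0, pow_lap_mem h 2 (S.pow_mem hc.mem 2)⟩
  obtain ⟨n, g, hg⟩ := hHmem
  have hpow : S.dir a 1 (c ^ 3) = (3 : ℝ) • (S.dir a 1 c * c ^ 2) := by
    rw [hc.dir_pow a DGFrobenius.one_mem_zero 2]; norm_num
  -- Differentiating c³ gives a factor 3, so the 12 of `pow_three_lap_mul` becomes 36; the term with
  -- the unit field on the left is killed by the restriction.
  have h1 : S'.pderiv (0, a) (φ ((S.lap D K 1 ^ 3) (c ^ 3))) =
      φ ((3 * θ) • S.dir a 1 c - (36 : ℝ) • S.lap D (K ∘ₗ K) (ad f a) (S.lap D K 1 (c ^ 2))) := by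
    rw [hφ.pderiv_zero, dir_pow_lap h, hpow, ← mul_apply' (S.dir a 1 c), map_smul,
      ← Op.mul_apply, hc.pow_three_lap_mul h, Op.sub_apply, Op.add_apply, Op.smul_apply,
      Op.smul_apply, Op.mul_apply, Op.mul_apply, Op.mul_apply, mul_apply', hθ, map_smul, map_sub,
      map_add, map_smul, hc.map_unitField h hφ a hg, map_sub, map_smul, map_smul, map_smul,
      ← Algebra.commutes, ← Algebra.smul_def, map_smul]
    module
  rw [h1, hφ.pderiv_zero, hφ.pderiv_one]
  simp only [map_sub, map_smul]
  rw [hc.dir_dir_lap_sq_lap h, hc.third_one]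
  have hs1 : e.sign (1 : C) = 1 := by
    rw [e.sign_of_mem (DGFrobenius.one_mem_zero (𝒜 := 𝒜))]; simp
  rw [hs1, h.π_one_v, φ.commutes, φ.commutes, smul_algebraMap, smul_algebraMap, ← map_sub,
    hc.swap₁₂ d b a, hc.f_cyc]
  congr 1
  ring

end IsCubic

end SuperCalculus

end AbstractCS

/-! ### Rotation invariance and invariant tensors in three dimensions. -/

namespace AbstractCS

variable {C : Type*} [Ring C] [Algebra ℝ C] {𝒜 : ℕ → Submodule ℝ C} [GradedAlgebra 𝒜]
  {I τ : Type*} {e : HomogeneousBasis 𝒜 I} {A : Type*} [Ring A] [Algebra ℝ A]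
  {B : Type*} [Ring B] [Algebra ℝ B]

namespace SuperCalculus

section Rotation

variable (S : SuperCalculus (ghost e.deg τ) A) [Fintype I] [DecidableEq I] [Fintype τ]
  [DecidableEq τ] (D : DGFrobenius 𝒜) {v : C} {K : C →ₗ[ℝ] C} {ρ : Matrix τ τ ℝ}

/-- The linear vector field induced by a matrix acting on the Lie algebra. -/
def rotField (ρ : Matrix τ τ ℝ) : Op A :=
  ∑ x, ∑ y, ρ x y • ∑ j, mul (S.coord (j, x)) * S.dir y (e.basis j)

theorem dir_mul_rotField (ρ : Matrix τ τ ℝ) (b : τ) (u : C) :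
    S.dir b u * S.rotField ρ = ∑ y, ρ b y • S.dir y u + S.rotField ρ * S.dir b u := by
  have step : ∀ x y j, S.dir b u * (mul (S.coord (j, x)) * S.dir y (e.basis j)) =
      (if b = x then e.basis.repr u j • S.dir y (e.basis j) else 0) +
      mul (S.coord (j, x)) * S.dir y (e.basis j) * S.dir b u := by
    intro x y j
    have hs := e.sign_basis j
    rcases Nat.even_or_odd (e.deg j) with hj | hj
    · rw [hj.neg_one_pow, one_smul] at hs
      rw [← mul_assoc, S.dir_mul_coord_even hj, sub_mul, mul_assoc, S.dir_comm_of_sign hs,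
        e.sign_sign, smul_mul_assoc, one_mul, mul_neg, sub_neg_eq_add, mul_assoc]
      split_ifs <;> simp
    · rw [hj.neg_one_pow, neg_one_smul] at hs
      rw [← mul_assoc, S.dir_mul_coord_odd hj, add_mul, mul_assoc, S.dir_comm_of_sign_neg hs,
        smul_mul_assoc, one_mul, mul_assoc]
      split_ifs <;> simp
  simp only [rotField, Finset.mul_sum, mul_smul_comm, step, Finset.sum_add_distrib, smul_add,
    Finset.sum_mul, smul_mul_assoc]
  congr 1
  rw [Finset.sum_eq_single b]
  · refine Finset.sum_congr rfl fun y _ => ?_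
    simp only [if_true]
    conv_rhs => rw [← e.basis.sum_repr u]
    simp only [map_sum, map_smul]
  · intro x _ hx; simp [hx.symm]
  · simp

/-- Infinitesimal rotations preserve the contraction δ_ab of the Lie algebra indices. -/
theorem lap_mul_rotField (hρ : ρ.transpose = -ρ) (N : C →ₗ[ℝ] C) :
    S.lap D N 1 * S.rotField ρ = S.rotField ρ * S.lap D N 1 := by
  have h1 : ∀ b m, S.dir b (N (D.dual e m)) * S.dir b (e.basis m) * S.rotField ρ =
      ∑ y, ρ b y • (S.dir b (N (D.dual e m)) * S.dir y (e.basis m)) +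
      ∑ y, ρ b y • (S.dir y (N (D.dual e m)) * S.dir b (e.basis m)) +
      S.rotField ρ * (S.dir b (N (D.dual e m)) * S.dir b (e.basis m)) := by
    intro b m
    rw [mul_assoc, dir_mul_rotField, mul_add, ← mul_assoc, dir_mul_rotField, add_mul, ← add_assoc]
    simp only [Finset.mul_sum, Finset.sum_mul, mul_smul_comm, smul_mul_assoc, mul_assoc]
  have h2 : ∀ m, ∑ b, ∑ y, ρ b y • (S.dir y (N (D.dual e m)) * S.dir b (e.basis m)) =
      -∑ b, ∑ y, ρ b y • (S.dir b (N (D.dual e m)) * S.dir y (e.basis m)) := by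
    intro m
    rw [Finset.sum_comm, ← Finset.sum_neg_distrib]
    refine Finset.sum_congr rfl fun b _ => ?_
    rw [← Finset.sum_neg_distrib]
    refine Finset.sum_congr rfl fun y _ => ?_
    rw [← neg_smul]
    congr 1
    exact congrFun (congrFun hρ b) y
  simp only [lap_one_right, Finset.sum_mul, Finset.mul_sum, h1, Finset.sum_add_distrib]
  have h3 : ∑ b, ∑ m, ∑ y, ρ b y • (S.dir b (N (D.dual e m)) * S.dir y (e.basis m)) +
      ∑ b, ∑ m, ∑ y, ρ b y • (S.dir y (N (D.dual e m)) * S.dir b (e.basis m)) = 0 := by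
    rw [Finset.sum_comm, Finset.sum_comm (f := fun b m => ∑ y, ρ b y •
      (S.dir y (N (D.dual e m)) * S.dir b (e.basis m))), ← Finset.sum_add_distrib]
    refine Finset.sum_eq_zero fun m _ => ?_
    rw [h2, add_neg_cancel]
  rw [h3, zero_add]

theorem rotField_algebraMap (r : ℝ) : S.rotField ρ (algebraMap ℝ A r) = 0 := by
  simp [rotField, S.dir_algebraMap, -dir_basis]

theorem dir_rotField (b : τ) (u : C) (g : A) :
    S.dir b u (S.rotField ρ g) = ∑ y, ρ b y • S.dir y u g + S.rotField ρ (S.dir b u g) := by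
  rw [← Op.mul_apply, dir_mul_rotField, Op.add_apply, Op.sum_apply, Op.mul_apply]
  simp only [Op.smul_apply]

theorem rotField_pow_lap (hρ : ρ.transpose = -ρ) (N : C →ₗ[ℝ] C) (E : ℕ) (g : A) :
    S.rotField ρ ((S.lap D N 1 ^ E) g) = (S.lap D N 1 ^ E) (S.rotField ρ g) := by
  induction E generalizing g with
  | zero => simp
  | succ E ih =>
    rw [pow_succ, Op.mul_apply, ih, Op.mul_apply, ← Op.mul_apply (S.rotField ρ),
      ← S.lap_mul_rotField D hρ, Op.mul_apply]

variable {S D} {f : τ → τ → τ → ℝ} {c : A}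

namespace IsCubic

theorem rotField_apply [Nonempty τ] (hc : S.IsCubic D f c)
    (hρ : ∀ a b d, ∑ x, (ρ a x * f x b d + ρ b x * f a x d + ρ d x * f a b x) = 0) :
    S.rotField ρ c = 0 := by
  have hmem : S.rotField ρ c ∈ S.wt 3 0 := by
    rw [rotField]
    simp only [Op.sum_apply, Op.smul_apply, Op.mul_apply, mul_apply']
    refine Submodule.sum_mem _ fun x _ => Submodule.sum_mem _ fun y _ => Submodule.smul_mem _ _ <|
      Submodule.sum_mem _ fun j _ => ?_
    have := S.mul_mem (S.coord_mem (j, x)) (S.dir_mem hc.mem (e.mem j) y)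
    convert this using 2
    simp [ghost]
  refine S.eq_zero_of_dir hmem fun d k => S.eq_zero_of_dir (S.dir_mem hmem (e.mem k) d)
    fun b j => S.eq_zero_of_dir (S.dir_mem (S.dir_mem hmem (e.mem k) d) (e.mem j) b) fun a i => ?_
  simp only [S.dir_rotField, map_add, map_sum, map_smul]
  simp only [hc.third_of_mem (e.mem i) (e.mem j), rotField_algebraMap, add_zero, smul_algebraMap,
    ← map_sum, ← map_add]
  rw [← map_zero (algebraMap ℝ A), ← Finset.sum_add_distrib, ← Finset.sum_add_distrib]
  congr 1
  have := congrArg (fun t => -(-1) ^ (e.deg j * (e.deg i + 1)) *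
    D.π (e.basis k) (e.basis j * e.basis i) * t) (hρ a b d)
  simp only [Finset.mul_sum, mul_zero] at this
  rw [← this]
  exact Finset.sum_congr rfl fun x _ => by ring

theorem rotField_pow [Nonempty τ] (hc : S.IsCubic D f c)
    (hρ : ∀ a b d, ∑ x, (ρ a x * f x b d + ρ b x * f a x d + ρ d x * f a b x) = 0) (V : ℕ) :
    S.rotField ρ (c ^ V) = 0 := by
  have hmul : ∀ g, S.rotField ρ (c * g) = S.rotField ρ c * g + c * S.rotField ρ g := by
    intro g
    simp only [rotField, Op.sum_apply, Op.smul_apply, Op.mul_apply, mul_apply',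
      S.dir_mul_even hc.mem, mul_add, Finset.sum_add_distrib, smul_add, Finset.sum_mul,
      Finset.mul_sum, smul_mul_assoc, mul_smul_comm, ← mul_assoc, hc.comm_of_mem (S.coord_mem _)]
  induction V with
  | zero => rw [pow_zero, ← map_one (algebraMap ℝ A), rotField_algebraMap]
  | succ V ih => rw [pow_succ', hmul, ih, hc.rotField_apply hρ, zero_mul, mul_zero, add_zero]

end IsCubic

end Rotation

section FinThree

/-- Totally antisymmetric tensors in three dimensions. -/
theorem exists_eq_of_antisymm {f : Fin 3 → Fin 3 → Fin 3 → ℝ} (h₁ : ∀ a b d, f a b d = -f b a d)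
    (h₂ : ∀ a b d, f a b d = -f a d b) (a b d : Fin 3) :
    f a b d = f 0 1 2 * (((a : ℕ) - (b : ℕ) : ℝ) * ((b : ℕ) - (d : ℕ)) * ((d : ℕ) - (a : ℕ)) / 2) := by
  have h11 : ∀ a b, f a a b = 0 := fun a b => by have := h₁ a a b; linarith
  have h22 : ∀ a b, f a b b = 0 := fun a b => by have := h₂ a b b; linarith
  have h12 : ∀ a b, f a b a = 0 := fun a b => by rw [h₂, h11, neg_zero]
  have e1 := h₁ 1 0 2
  have e2 := h₂ 0 2 1
  have e3 := h₂ 1 2 0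
  have e4 := h₁ 2 0 1
  have e5 := h₁ 2 1 0
  fin_cases a <;> fin_cases b <;> fin_cases d <;> simp [h11, h22, h12] <;> linarith

/-- Rotation invariants in Λ²V ⊗ V for dim V = 3 are spanned by ε. The invariance equations at the
index pairs (0,1) and (0,2) already determine the tensor by linear arithmetic. -/
theorem eq_of_invariant {z : Fin 3 → Fin 3 → Fin 3 → ℝ} {ε : Fin 3 → Fin 3 → Fin 3 → ℝ}
    (hε : ∀ a b d, ε a b d =
      ((a : ℕ) - (b : ℕ) : ℝ) * ((b : ℕ) - (d : ℕ)) * ((d : ℕ) - (a : ℕ)) / 2)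
    (hz : ∀ a b d, z a b d = -z b a d)
    (hinv : ∀ s a b d, ∑ x, (ε x a s * z x b d + ε x b s * z a x d + ε x d s * z a b x) = 0)
    (a b d : Fin 3) : z a b d = z 0 1 2 * ε a b d := by
  have hz0 : ∀ a d, z a a d = 0 := fun a d => by have := hz a a d; linarith
  simp only [Fin.sum_univ_three, hε] at hinv
  have a1 := fun d => hz 1 0 d
  have a2 := fun d => hz 2 0 d
  have a3 := fun d => hz 2 1 d
  have i1 := hinv 1 0 1 0
  have i2 := hinv 2 0 1 0
  have i3 := hinv 0 0 1 0
  have i4 := hinv 0 0 1 1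
  have i5 := hinv 0 0 1 2
  have i6 := hinv 1 0 1 1
  have i7 := hinv 1 0 1 2
  have i8 := hinv 2 0 1 1
  have i9 := hinv 2 0 1 2
  have j1 := hinv 0 0 2 0
  have j2 := hinv 0 0 2 1
  have j3 := hinv 0 0 2 2
  have j4 := hinv 1 0 2 0
  have j5 := hinv 1 0 2 1
  have j6 := hinv 1 0 2 2
  have j7 := hinv 2 0 2 0
  have j8 := hinv 2 0 2 1
  have j9 := hinv 2 0 2 2
  clear hinv
  norm_num [hz0, a1, a2, a3] at i1 i2 i3 i4 i5 i6 i7 i8 i9 j1 j2 j3 j4 j5 j6 j7 j8 j9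
  rw [hε]
  fin_cases a <;> fin_cases b <;> fin_cases d <;> simp [hz0, a1, a2, a3] <;> linarith

end FinThree

end SuperCalculus

end AbstractCS

/-! ### Evaluation of diagrams with three Lie algebra indices. -/

namespace AbstractCS

variable {C : Type*} [Ring C] [Algebra ℝ C] {𝒜 : ℕ → Submodule ℝ C} [GradedAlgebra 𝒜]
  {I : Type*} {e : HomogeneousBasis 𝒜 I} {A : Type*} [Ring A] [Algebra ℝ A]
  {B : Type*} [Ring B] [Algebra ℝ B]

/-- The Levi-Civita symbol. -/
def leviCivita (a b d : Fin 3) : ℤ :=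
  ((a : ℕ) - (b : ℕ) : ℤ) * ((b : ℕ) - (d : ℕ)) * ((d : ℕ) - (a : ℕ)) / 2

theorem leviCivita_cast (a b d : Fin 3) : (leviCivita a b d : ℝ) =
    ((a : ℕ) - (b : ℕ) : ℝ) * ((b : ℕ) - (d : ℕ)) * ((d : ℕ) - (a : ℕ)) / 2 := by
  fin_cases a <;> fin_cases b <;> fin_cases d <;> norm_num [leviCivita]

theorem leviCivita_jacobi : ∀ s a b d : Fin 3,
    ∑ x, (leviCivita x a s * leviCivita x b d + leviCivita x b s * leviCivita a x d +
      leviCivita x d s * leviCivita a b x) = 0 := by decide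

theorem leviCivita_ad : ∀ a b d : Fin 3, ∑ x, ∑ y, (∑ z, (leviCivita z x a * leviCivita y z b -
    leviCivita z x b * leviCivita y z a)) * leviCivita x y d = -2 * leviCivita a b d := by decide

theorem leviCivita_normSq : ∑ a, ∑ b, ∑ d, leviCivita a b d ^ 2 = 6 := by decide

namespace SuperCalculus

variable {S : SuperCalculus (ghost e.deg (Fin 3)) A} {S' : SuperCalculus (ghost ![0, 3] (Fin 3)) B}
  [Fintype I] [DecidableEq I] {D : DGFrobenius 𝒜} {v : C}
  {K : C →ₗ[ℝ] C} {φ : A →ₐ[ℝ] B} {f : Fin 3 → Fin 3 → Fin 3 → ℝ} {c : A}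

namespace IsCubic

variable (hc : S.IsCubic D f c)

include hc

theorem f_eq (a b d : Fin 3) : f a b d = f 0 1 2 * (leviCivita a b d : ℝ) := by
  rw [leviCivita_cast]; exact exists_eq_of_antisymm hc.swap₁₂ hc.swap₂₃ a b d

/-- In dimension three a totally antisymmetric tensor is a multiple of ε, so this reduces to a
finite identity for ε. -/
theorem jacobi (s a b d : Fin 3) :
    ∑ x, (ad f s a x * f x b d + ad f s b x * f a x d + ad f s d x * f a b x) = 0 := by
  have := congrArg (fun z : ℤ => f 0 1 2 ^ 2 * (z : ℝ)) (leviCivita_jacobi s a b d)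
  simp only [Int.cast_sum, Int.cast_add, Int.cast_mul, Int.cast_zero, mul_zero,
    Finset.mul_sum] at this
  rw [← this]
  refine Finset.sum_congr rfl fun x _ => ?_
  simp only [ad, Matrix.of_apply]
  rw [hc.f_eq x a, hc.f_eq x b, hc.f_eq x b, hc.f_eq a x, hc.f_eq x d, hc.f_eq a b]
  ring

theorem sum_ad_commutator (a b d : Fin 3) :
    ∑ x, ∑ y, (ad f a * ad f b - ad f b * ad f a) x y * f x y d =
      -2 * f 0 1 2 ^ 2 * f a b d := by
  have := congrArg (fun z : ℤ => f 0 1 2 ^ 3 * (z : ℝ)) (leviCivita_ad a b d)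
  simp only [Int.cast_sum, Int.cast_mul, Int.cast_sub, Int.cast_neg, Int.cast_ofNat,
    Finset.mul_sum] at this
  have e1 : -2 * f 0 1 2 ^ 2 * f a b d = f 0 1 2 ^ 3 * (-2 * (leviCivita a b d : ℝ)) := by
    rw [hc.f_eq a b d]; ring
  rw [e1, ← this]
  refine Finset.sum_congr rfl fun x _ => Finset.sum_congr rfl fun y _ => ?_
  rw [Matrix.sub_apply, Matrix.mul_apply, Matrix.mul_apply, ← Finset.sum_sub_distrib,
    Finset.sum_mul, Finset.sum_mul, Finset.mul_sum]
  refine Finset.sum_congr rfl fun z _ => ?_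
  simp only [ad, Matrix.of_apply]
  rw [hc.f_eq z x a, hc.f_eq y z b, hc.f_eq z x b, hc.f_eq y z a, hc.f_eq x y d]
  ring

theorem normSq : ∑ a, ∑ b, ∑ d, f a b d ^ 2 = 6 * f 0 1 2 ^ 2 := by
  have := congrArg (fun z : ℤ => f 0 1 2 ^ 2 * (z : ℝ)) leviCivita_normSq
  simp only [Int.cast_sum, Int.cast_pow, Int.cast_ofNat, Finset.mul_sum] at this
  rw [mul_comm 6, ← this]
  refine Finset.sum_congr rfl fun a _ => Finset.sum_congr rfl fun b _ =>
    Finset.sum_congr rfl fun d _ => ?_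
  rw [hc.f_eq a b d, mul_pow]

variable (h : D.IsPropagator e v K) (hφ : S.IsRestriction S' v φ)

include h hφ

theorem third_pderiv_map (a b d : Fin 3) :
    S'.pderiv (1, d) (S'.pderiv (0, b) (S'.pderiv (0, a) (φ c))) = algebraMap ℝ B (f a b d) := by
  have hs1 : e.sign (1 : C) = 1 := by
    rw [e.sign_of_mem (DGFrobenius.one_mem_zero (𝒜 := 𝒜))]; simp
  rw [hφ.pderiv_zero, hφ.pderiv_zero, hφ.pderiv_one, hc.third_one, hs1, h.π_one_v, φ.commutes,
    hc.swap₁₂ d b a, hc.f_cyc]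
  congr 1; ring

theorem eq_smul_map {w : B} (hw : w ∈ S'.wt 3 0) {r : ℝ}
    (hr : ∀ a b d, S'.pderiv (1, d) (S'.pderiv (0, b) (S'.pderiv (0, a) w)) =
      algebraMap ℝ B (r * f a b d)) : w = r • φ c := by
  rw [← sub_eq_zero]
  refine S'.eq_zero_of_third_pderiv
    (Submodule.sub_mem _ hw (Submodule.smul_mem _ _ (hφ.map_mem hc.mem))) fun a b d => ?_
  simp only [map_sub, map_smul, hr, hc.third_pderiv_map h hφ, smul_algebraMap, sub_self]

omit h in
-- The square would have degree six, and ghost number zero allows only degrees 0 and 3.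
theorem map_mul_self : φ c * φ c = 0 := by
  have hmem := S'.mul_mem (hφ.map_mem hc.mem) (hφ.map_mem hc.mem)
  rw [add_zero] at hmem
  exact eq_zero_of_mem_wt_ghost_zero S' (by decide) (by decide) hmem

/-- Each diagram with values in the cubic functions is a multiple of the restriction of `c`. -/
theorem exists_map_pow_lap (hf : f 0 1 2 ≠ 0) {V E : ℕ} (hVE : 3 * V = 2 * E + 3) :
    ∃ r : ℝ, φ ((S.lap D K 1 ^ E) (c ^ V)) = r • φ c := by
  have hmem : (S.lap D K 1 ^ E) (c ^ V) ∈ S.wt 3 0 :=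
    pow_lap_mem h E (by convert S.pow_mem hc.mem V using 2; omega)
  have hrot : ∀ s, S.rotField (ad f s) ((S.lap D K 1 ^ E) (c ^ V)) = 0 := by
    intro s
    rw [S.rotField_pow_lap D (hc.transpose_ad s), hc.rotField_pow (hc.jacobi s), map_zero]
  generalize (S.lap D K 1 ^ E) (c ^ V) = w at hmem hrot
  have hs1 : e.sign (1 : C) = 1 := by
    rw [e.sign_of_mem (DGFrobenius.one_mem_zero (𝒜 := 𝒜))]; simp
  have hex : ∀ a b d, ∃ z : ℝ, S.dir d v (S.dir b 1 (S.dir a 1 w)) = algebraMap ℝ A z :=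
    fun a b d => S.exists_const_of_mem (S.dir_mem (S.dir_mem (S.dir_mem hmem
      DGFrobenius.one_mem_zero a) DGFrobenius.one_mem_zero b) h.v_mem d)
  choose z hz using hex
  have hz12 : ∀ a b d, z a b d = -z b a d := by
    intro a b d
    apply S.algebraMap_injective
    rw [map_neg, ← hz, ← hz, ← Op.mul_apply (S.dir b 1), S.dir_comm_of_sign hs1, hs1, Op.neg_apply,
      map_neg, Op.mul_apply]
  have hinv : ∀ s a b d, ∑ x, (leviCivita x a s * z x b d + leviCivita x b s * z a x d +
      leviCivita x d s * z a b x) = 0 := by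
    intro s a b d
    have h1 : S.dir d v (S.dir b 1 (S.dir a 1 (S.rotField (ad f s) w))) = 0 := by
      rw [hrot, map_zero, map_zero, map_zero]
    simp only [S.dir_rotField, map_add, map_sum, map_smul, hz, rotField_algebraMap, add_zero,
      smul_algebraMap, ← Finset.sum_add_distrib] at h1
    simp only [← map_sum, ← map_add] at h1
    rw [← map_zero (algebraMap ℝ A)] at h1
    have h2 := S.algebraMap_injective h1
    refine (mul_eq_zero.mp (Eq.trans ?_ h2)).resolve_left hf
    rw [Finset.mul_sum]
    refine Finset.sum_congr rfl fun x _ => ?_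
    simp only [ad, Matrix.of_apply]
    rw [hc.f_eq x a, hc.f_eq x b, hc.f_eq x d]
    ring
  have hzε := eq_of_invariant (ε := fun a b d => (leviCivita a b d : ℝ)) leviCivita_cast hz12 hinv
  refine ⟨z 0 1 2 / f 0 1 2, hc.eq_smul_map h hφ (hφ.map_mem hmem) fun a b d => ?_⟩
  rw [hφ.pderiv_zero, hφ.pderiv_zero, hφ.pderiv_one, hz, φ.commutes, hzε, hc.f_eq a b d,
    ← mul_assoc, div_mul_cancel₀ _ hf]

omit h in
theorem map_pow_lap_eq_zero (h : D.IsPropagator e v K) {V E : ℕ} (h0 : 3 * V ≠ 2 * E)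
    (h3 : 3 * V ≠ 2 * E + 3) : φ ((S.lap D K 1 ^ E) (c ^ V)) = 0 := by
  have hV : c ^ V ∈ S.wt (3 * V) 0 := S.pow_mem hc.mem V
  rcases Nat.lt_or_ge (3 * V) (2 * E) with h1 | h1
  · rw [pow_lap_of_lt h E hV h1, map_zero]
  · obtain ⟨m, hm⟩ := Nat.exists_eq_add_of_le' h1
    rw [hm] at hV
    exact S'.eq_zero_of_mem_wt_ghost_zero (n := m) (by omega) (by omega)
      (hφ.map_mem (pow_lap_mem h E hV))

omit hφ in
theorem exists_pow_lap_const {V E : ℕ} (hVE : 3 * V = 2 * E) :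
    ∃ r : ℝ, (S.lap D K 1 ^ E) (c ^ V) = algebraMap ℝ A r :=
  S.exists_const_of_mem (pow_lap_mem h E (g := 0) (by
    convert S.pow_mem hc.mem V using 2; omega))

/-- The derivative along the unit selects one of V+1 vertices. By strictness that vertex decouples,
and the other V vertices form the vacuum diagrams with value `r`. -/
theorem map_pow_lap_succ_of_strict (hK : ∀ a, K (K a) = 0) {V E : ℕ} (hVE : 3 * V = 2 * E) {r : ℝ}
    (hr : (S.lap D K 1 ^ E) (c ^ V) = algebraMap ℝ A r) :
    φ ((S.lap D K 1 ^ E) (c ^ (V + 1))) = (((V : ℝ) + 1) * r) • φ c := by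
  have hmem : (S.lap D K 1 ^ E) (c ^ (V + 1)) ∈ S.wt 3 0 :=
    pow_lap_mem h E (by convert S.pow_mem hc.mem (V + 1) using 2; omega)
  refine hc.eq_smul_map h hφ (hφ.map_mem hmem) fun a b d => ?_
  rw [hφ.pderiv_zero, dir_pow_lap h, hc.dir_pow a DGFrobenius.one_mem_zero, map_smul, map_smul,
    hc.map_pow_lap_of_strict h hK hφ, hr, φ.commutes, ← Algebra.commutes, ← Algebra.smul_def,
    smul_smul, ← hφ.pderiv_zero]
  simp only [map_smul]
  rw [hc.third_pderiv_map h hφ, smul_algebraMap]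

/-- The constant is 144·(-2): the 144 of `third_lap_cube` times the Lie algebra factor of
`sum_ad_commutator`. -/
theorem map_lap_cube {θ : ℝ} (hθ : (S.lap D K 1 ^ 3) (c ^ 2) = algebraMap ℝ A θ) :
    φ ((S.lap D K 1 ^ 3) (c ^ 3)) =
      (3 * θ - 288 * f 0 1 2 ^ 2 * D.vtrace e v (K ∘ₗ K ∘ₗ K)) • φ c := by
  have hmem : (S.lap D K 1 ^ 3) (c ^ 3) ∈ S.wt 3 0 := pow_lap_mem h 3 (S.pow_mem hc.mem 3)
  refine hc.eq_smul_map h hφ (hφ.map_mem hmem) fun a b d => ?_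
  rw [hc.third_lap_cube h hφ hθ, hc.sum_ad_commutator]
  congr 1; ring

end IsCubic

end SuperCalculus

end AbstractCS

/-! ### Formal logarithms with a square-zero perturbation. -/

namespace AbstractCS

section FormalLog

open PowerSeries in
/-- Double series supported on the line `3 V = 2 E + s`. -/
def SupportedOn (s : ℕ) (g : PowerSeries (PowerSeries ℝ)) : Prop :=
  ∀ V E, coeff E (coeff V g) ≠ 0 → 3 * V = 2 * E + s

theorem SupportedOn.mul {s t : ℕ} {g g' : PowerSeries (PowerSeries ℝ)} (hg : SupportedOn s g)
    (hg' : SupportedOn t g') : SupportedOn (s + t) (g * g') := by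
  intro V E h
  rw [PowerSeries.coeff_mul, map_sum] at h
  obtain ⟨⟨i, j⟩, hij, h⟩ := Finset.exists_ne_zero_of_sum_ne_zero h
  rw [PowerSeries.coeff_mul] at h
  obtain ⟨⟨x, y⟩, hxy, h⟩ := Finset.exists_ne_zero_of_sum_ne_zero h
  rw [Finset.HasAntidiagonal.mem_antidiagonal] at hij hxy
  have h1 := hg _ _ (left_ne_zero_of_mul h)
  have h2 := hg' _ _ (right_ne_zero_of_mul h)
  simp only at hij hxy h1 h2
  omega

theorem SupportedOn.pow {g : PowerSeries (PowerSeries ℝ)} (hg : SupportedOn 0 g) (k : ℕ) :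
    SupportedOn 0 (g ^ k) := by
  induction k with
  | zero =>
    intro V E h
    rw [pow_zero, PowerSeries.coeff_one] at h
    split_ifs at h with hV
    · rw [PowerSeries.coeff_one] at h
      split_ifs at h with hE
      · omega
      · exact absurd rfl h
    · exact absurd (map_zero _) h
  | succ k ih => rw [pow_succ]; exact ih.mul hg

theorem add_pow_of_sq_zero {R : Type*} [Ring R] {x y : R} (hxy : Commute x y) (hy : y * y = 0)
    (k : ℕ) : (x + y) ^ (k + 1) = x ^ (k + 1) + ((k : R) + 1) * (x ^ k * y) := by
  induction k with
  | zero => simp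
  | succ k ih =>
    have h1 : x ^ k * y * x = x ^ (k + 1) * y := by
      rw [mul_assoc, ← hxy.eq, ← mul_assoc, ← pow_succ]
    have h2 : x ^ k * y * y = 0 := by rw [mul_assoc, hy, mul_zero]
    have h3 : ((k : R) + 1) * (x ^ k * y) * x = ((k : R) + 1) * (x ^ (k + 1) * y) := by
      rw [mul_assoc, h1]
    have h4 : ((k : R) + 1) * (x ^ k * y) * y = 0 := by rw [mul_assoc, h2, mul_zero]
    rw [pow_succ, ih, add_mul, mul_add, mul_add, h3, h4, ← pow_succ, add_zero, Nat.cast_succ,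
      add_mul ((k : R) + 1) 1, one_mul]
    abel

variable {F : Type*} [Ring F] [Algebra ℝ F]

/-- The scalar part of a logarithm. -/
def logScalar (b : PowerSeries (PowerSeries ℝ)) (V E : ℕ) : ℝ :=
  ∑ k ∈ Finset.Icc 1 V, ((-1 : ℝ) ^ (k + 1) / k) * PowerSeries.coeff E (PowerSeries.coeff V (b ^ k))

/-- The part of a logarithm that is linear in a square-zero perturbation. -/
def logLinear (b a : PowerSeries (PowerSeries ℝ)) (V E : ℕ) : ℝ :=
  ∑ k ∈ Finset.Icc 1 V,
    (-1 : ℝ) ^ (k + 1) * PowerSeries.coeff E (PowerSeries.coeff V (b ^ (k - 1) * a))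

/-- Since W² = 0, the k-th power of b + aW is b^k + k b^(k-1) a W, and the factor k cancels the 1/k
of the logarithm. -/
theorem coeff_formalLog {Z : PowerSeries (PowerSeries F)} {W : F} (hW : W * W = 0)
    {b a : PowerSeries (PowerSeries ℝ)}
    (hZ : ∀ V E, PowerSeries.coeff E (PowerSeries.coeff V (Z - 1)) =
      algebraMap ℝ F (PowerSeries.coeff E (PowerSeries.coeff V b)) +
        PowerSeries.coeff E (PowerSeries.coeff V a) • W) (V E : ℕ) :
    PowerSeries.coeff E (PowerSeries.coeff V (formalLog Z)) =
      algebraMap ℝ F (logScalar b V E) + logLinear b a V E • W := by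
  set P : PowerSeries (PowerSeries ℝ) →+* PowerSeries (PowerSeries F) :=
    PowerSeries.map (PowerSeries.map (algebraMap ℝ F)) with hP
  have hPc : ∀ g V E, PowerSeries.coeff E (PowerSeries.coeff V (P g)) =
      algebraMap ℝ F (PowerSeries.coeff E (PowerSeries.coeff V g)) := by
    intro g V E; rw [hP, PowerSeries.coeff_map, PowerSeries.coeff_map]
  set w : PowerSeries (PowerSeries F) := PowerSeries.C (PowerSeries.C W) with hw
  have hwc : ∀ g V E, PowerSeries.coeff E (PowerSeries.coeff V (g * w)) =
      PowerSeries.coeff E (PowerSeries.coeff V g) * W := by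
    intro g V E; rw [hw, PowerSeries.coeff_mul_C, PowerSeries.coeff_mul_C]
  have hwc' : ∀ g V E, PowerSeries.coeff E (PowerSeries.coeff V (w * g)) =
      W * PowerSeries.coeff E (PowerSeries.coeff V g) := by
    intro g V E; rw [hw, PowerSeries.coeff_C_mul, PowerSeries.coeff_C_mul]
  have hPw : ∀ g, Commute (P g) w := by
    intro g
    ext V E
    rw [hwc, hwc', hPc, Algebra.commutes]
  have hww : w * w = 0 := by rw [hw, ← map_mul, ← map_mul, hW, map_zero, map_zero]
  have hZ' : Z - 1 = P b + P a * w := by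
    ext V E
    rw [hZ, map_add, map_add, hPc, hwc, hPc, Algebra.smul_def]
  have hpow : ∀ k V E : ℕ, PowerSeries.coeff E (PowerSeries.coeff V ((Z - 1) ^ (k + 1))) =
      algebraMap ℝ F (PowerSeries.coeff E (PowerSeries.coeff V (b ^ (k + 1)))) +
        (((k : ℝ) + 1) * PowerSeries.coeff E (PowerSeries.coeff V (b ^ k * a))) • W := by
    intro k V E
    have hc1 : Commute (P b) (P a * w) := by
      refine Commute.mul_right ?_ (hPw b)
      rw [commute_iff_eq, ← map_mul, ← map_mul, mul_comm]
    have hc2 : P a * w * (P a * w) = 0 := by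
      rw [mul_assoc, ← mul_assoc w, ← (hPw a).eq, mul_assoc, hww, mul_zero, mul_zero]
    rw [hZ', add_pow_of_sq_zero hc1 hc2, map_add, map_add, ← map_pow, hPc, ← mul_assoc (P b ^ k),
      ← map_pow, ← map_mul]
    have : ((k : PowerSeries (PowerSeries F)) + 1) * (P (b ^ k * a) * w) =
        P ((k + 1) • (b ^ k * a)) * w := by
      rw [← Nat.cast_succ, ← nsmul_eq_mul, map_nsmul, smul_mul_assoc]
    rw [this, hwc, hPc, map_nsmul, map_nsmul, nsmul_eq_mul, Algebra.smul_def]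
    push_cast
    rfl
  rw [show formalLog Z = PowerSeries.mk _ from rfl, PowerSeries.coeff_mk, map_sum, logScalar, logLinear, map_sum, Finset.sum_smul,
    ← Finset.sum_add_distrib]
  refine Finset.sum_congr rfl fun k hk => ?_
  obtain ⟨k, rfl⟩ := Nat.exists_eq_add_of_le' (Finset.mem_Icc.mp hk).1
  rw [PowerSeries.coeff_smul, hpow, smul_add, smul_algebraMap, smul_smul, Nat.add_sub_cancel]
  congr 2
  have : ((k : ℝ) + 1) ≠ 0 := by positivity
  push_cast
  field_simp

theorem logScalar_support {b : PowerSeries (PowerSeries ℝ)} (hb : SupportedOn 0 b) {V E : ℕ}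
    (h : logScalar b V E ≠ 0) : 3 * V = 2 * E := by
  obtain ⟨k, _, hk⟩ := Finset.exists_ne_zero_of_sum_ne_zero h
  exact hb.pow k V E (right_ne_zero_of_mul hk)

theorem logLinear_support {b a : PowerSeries (PowerSeries ℝ)} (hb : SupportedOn 0 b)
    (ha : SupportedOn 3 a) {V E : ℕ} (h : logLinear b a V E ≠ 0) : 3 * V = 2 * E + 3 := by
  obtain ⟨k, _, hk⟩ := Finset.exists_ne_zero_of_sum_ne_zero h
  simpa using ((hb.pow (k - 1)).mul ha) V E (right_ne_zero_of_mul hk)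

theorem logScalar_zero (b : PowerSeries (PowerSeries ℝ)) (E : ℕ) : logScalar b 0 E = 0 := by
  simp [logScalar]

theorem logLinear_one (b a : PowerSeries (PowerSeries ℝ)) (E : ℕ) :
    logLinear b a 1 E = PowerSeries.coeff E (PowerSeries.coeff 1 a) := by
  simp [logLinear]

theorem SupportedOn.coeff_one {b : PowerSeries (PowerSeries ℝ)} (hb : SupportedOn 0 b) :
    PowerSeries.coeff 1 b = 0 := by
  ext E
  by_contra h
  have := hb 1 E h
  omega

theorem logScalar_two {b : PowerSeries (PowerSeries ℝ)} (hb : SupportedOn 0 b)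
    (hb0 : PowerSeries.coeff 0 b = 0) (E : ℕ) :
    logScalar b 2 E = PowerSeries.coeff E (PowerSeries.coeff 2 b) := by
  have h1 := hb.coeff_one
  have h2 : PowerSeries.coeff 2 (b ^ 2) = 0 := by
    rw [sq, PowerSeries.coeff_mul]
    simp [Finset.Nat.antidiagonal_succ, hb0, h1]
  simp [logScalar, Finset.sum_Icc_succ_top, h2]

/-- The supports force `b` to start with two vertices and `a` with one. So b·a has the single
contribution b₂a₁ at three vertices, and b²·a has none. -/
theorem logLinear_three {b a : PowerSeries (PowerSeries ℝ)} (hb : SupportedOn 0 b)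
    (hb0 : PowerSeries.coeff 0 b = 0) (ha : SupportedOn 3 a) :
    logLinear b a 3 3 = PowerSeries.coeff 3 (PowerSeries.coeff 3 a) -
      PowerSeries.coeff 3 (PowerSeries.coeff 2 b) * PowerSeries.coeff 0 (PowerSeries.coeff 1 a) := by
  have h1 := hb.coeff_one
  have a0 : PowerSeries.coeff 0 a = 0 := by
    ext E
    by_contra h
    have := ha 0 E h
    omega
  have h2 : PowerSeries.coeff 3 (b ^ 2 * a) = 0 := by
    rw [sq, PowerSeries.coeff_mul]
    simp [Finset.Nat.antidiagonal_succ, hb0, h1, a0, PowerSeries.coeff_mul]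
  have h3 : PowerSeries.coeff 3 (b * a) = PowerSeries.coeff 2 b * PowerSeries.coeff 1 a := by
    rw [PowerSeries.coeff_mul]
    simp [Finset.Nat.antidiagonal_succ, hb0, h1, a0]
  have h4 : ∀ E, E ≠ 3 → PowerSeries.coeff E (PowerSeries.coeff 2 b) = 0 := by
    intro E hE
    by_contra h
    have := hb 2 E h
    omega
  have h5 : PowerSeries.coeff 3 (PowerSeries.coeff 2 b * PowerSeries.coeff 1 a) =
      PowerSeries.coeff 3 (PowerSeries.coeff 2 b) *
        PowerSeries.coeff 0 (PowerSeries.coeff 1 a) := by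
    rw [PowerSeries.coeff_mul, Finset.sum_eq_single (3, 0)]
    · rintro ⟨i, j⟩ hij hne
      rw [Finset.HasAntidiagonal.mem_antidiagonal] at hij
      rw [h4 i (by rintro rfl; apply hne; ext <;> simp_all), zero_mul]
    · simp
  simp only [logLinear, Finset.sum_Icc_succ_top (by norm_num : 1 ≤ 3),
    Finset.sum_Icc_succ_top (by norm_num : 1 ≤ 2), Finset.Icc_self, Finset.sum_singleton]
  norm_num [h2, h3, h5]
  ring

theorem coeff_pow_mul_eq_zero {b : PowerSeries (PowerSeries ℝ)}
    (hb0 : PowerSeries.coeff 0 b = 0) (k : ℕ) (g : PowerSeries (PowerSeries ℝ)) {V : ℕ}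
    (hV : V < k) : PowerSeries.coeff V (b ^ k * g) = 0 := by
  have hX : PowerSeries.X ∣ b := by
    rw [PowerSeries.X_dvd_iff, ← PowerSeries.coeff_zero_eq_constantCoeff_apply, hb0]
  exact PowerSeries.X_pow_dvd_iff.mp (Dvd.dvd.mul_right (pow_dvd_pow_of_dvd hX k) g) V hV

/-- If the perturbation is `X (1 + b)`, then the linear part of the logarithm is `X`. -/
theorem logLinear_of_eq {b a : PowerSeries (PowerSeries ℝ)} (hb0 : PowerSeries.coeff 0 b = 0)
    (ha : a = (1 + b) * PowerSeries.X) {V : ℕ} (hV : V ≠ 0) (E : ℕ) :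
    logLinear b a V E = if V = 1 ∧ E = 0 then 1 else 0 := by
  -- The factor 1 + b in `a` makes the finite geometric series telescope. The remainder b^V·X starts
  -- with V+1 vertices and is invisible in the coefficient of order V.
  have h1 : ∑ k ∈ Finset.Icc 1 V, (-1 : ℝ) ^ (k + 1) • (b ^ (k - 1) * a) =
      PowerSeries.X - ((-1 : ℝ) ^ V • b ^ V) * PowerSeries.X := by
    clear hV
    induction V with
    | zero => simp
    | succ V ih =>
      rw [Finset.sum_Icc_succ_top (by omega), ih, ha, Nat.add_sub_cancel]
      simp only [Algebra.smul_def, map_pow, map_neg, map_one]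
      ring
  obtain ⟨V', rfl⟩ := Nat.exists_eq_succ_of_ne_zero hV
  have h2 : PowerSeries.coeff (V' + 1) (((-1 : ℝ) ^ (V' + 1) • b ^ (V' + 1)) * PowerSeries.X) =
      0 := by
    have := coeff_pow_mul_eq_zero hb0 (V' + 1) 1 (Nat.lt_succ_self V')
    rw [mul_one] at this
    rw [PowerSeries.coeff_succ_mul_X, PowerSeries.coeff_smul, this, smul_zero]
  have h3 : logLinear b a (V' + 1) E = PowerSeries.coeff E (PowerSeries.coeff (V' + 1)
      (∑ k ∈ Finset.Icc 1 (V' + 1), (-1 : ℝ) ^ (k + 1) • (b ^ (k - 1) * a))) := by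
    simp only [logLinear, map_sum, PowerSeries.coeff_smul, smul_eq_mul]
  rw [Nat.succ_eq_add_one, h3, h1, map_sub, h2, sub_zero, PowerSeries.coeff_X]
  rcases Nat.eq_zero_or_pos V' with rfl | hV'
  · simp [PowerSeries.coeff_one]
  · simp [hV'.ne']

end FormalLog

end AbstractCS

/-! ### Third derivatives of the concrete cubic action. -/

namespace AbstractCS

theorem neg_one_zpow_ghost_mul {I τ : Type*} (deg : I → ℕ) (x y : I × τ) :
    (-1 : ℝ) ^ (ghost deg τ x * ghost deg τ y) = (-1) ^ ((deg x.1 + 1) * (deg y.1 + 1)) := by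
  have : ghost deg τ x * ghost deg τ y = (((deg x.1 + 1) * (deg y.1 + 1) : ℕ) : ℤ) +
      2 * (-(deg x.1 : ℤ) - deg y.1) := by
    simp only [ghost]; push_cast; ring
  rw [this, SuperCalculus.neg_one_zpow_add, zpow_natCast, zpow_mul]
  norm_num

namespace SuperCalculus

theorem sum_six_comm {M I τ : Type*} [AddCommMonoid M] [Fintype I] [Fintype τ]
    (g : I → I → I → τ → τ → τ → M) :
    ∑ i, ∑ j, ∑ k, ∑ a, ∑ b, ∑ c, g i j k a b c =
      ∑ i, ∑ a, ∑ j, ∑ b, ∑ k, ∑ c, g i j k a b c := by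
  refine Finset.sum_congr rfl fun i _ => ?_
  have : ∀ j, ∑ k, ∑ a, ∑ b, ∑ c, g i j k a b c = ∑ a, ∑ b, ∑ k, ∑ c, g i j k a b c := by
    intro j
    rw [Finset.sum_comm]
    exact Finset.sum_congr rfl fun a _ => Finset.sum_comm
  simp only [this]
  exact Finset.sum_comm

section Symmetric

variable {X : Type*} {gh : X → ℤ} {A : Type*} [Ring A] [Algebra ℝ A] (S : SuperCalculus gh A)
  [Fintype X]

open Classical in
theorem pderiv_coord_mul_coord (t x y : X) : S.pderiv t (S.coord x * S.coord y) =
    (if t = x then S.coord y else 0) +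
      if t = y then (-1 : ℝ) ^ (gh t * gh x) • S.coord x else 0 := by
  rw [S.pderiv_coord_mul, S.pderiv_coord]
  congr 1
  split_ifs <;> simp

open Classical in
theorem pderiv_coord_mul_coord_mul_coord (t x y z : X) :
    S.pderiv t (S.coord x * S.coord y * S.coord z) =
    (if t = x then S.coord y * S.coord z else 0) +
      (if t = y then (-1 : ℝ) ^ (gh t * gh x) • (S.coord x * S.coord z) else 0) +
      if t = z then (-1 : ℝ) ^ (gh t * gh x + gh t * gh y) • (S.coord x * S.coord y) else 0 := by
  rw [mul_assoc, S.pderiv_coord_mul, pderiv_coord_mul_coord, add_assoc]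
  congr 1
  rw [mul_add, smul_add]
  congr 1
  · split_ifs <;> simp
  · split_ifs
    · rw [mul_smul_comm, smul_smul, ← neg_one_zpow_add]
    · simp

/-- The third derivatives of a cubic function with graded symmetric coefficients. -/
theorem third_pderiv_of_symmetric (T : X → X → X → ℝ)
    (h₁₂ : ∀ x y z, T y x z = (-1 : ℝ) ^ (gh x * gh y) * T x y z)
    (h₂₃ : ∀ x y z, T x z y = (-1 : ℝ) ^ (gh y * gh z) * T x y z) (t u w : X) :
    S.pderiv t (S.pderiv u (S.pderiv w
      (∑ x, ∑ y, ∑ z, T x y z • (S.coord x * S.coord y * S.coord z)))) =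
      algebraMap ℝ A (6 * T w u t) := by
  classical
  have e1 : S.pderiv w (∑ x, ∑ y, ∑ z, T x y z • (S.coord x * S.coord y * S.coord z)) =
      (3 : ℝ) • ∑ y, ∑ z, T w y z • (S.coord y * S.coord z) := by
    simp only [map_sum, map_smul, pderiv_coord_mul_coord_mul_coord, smul_add,
      Finset.sum_add_distrib]
    have a1 : ∑ x, ∑ y, ∑ z, T x y z • (if w = x then S.coord y * S.coord z else 0) =
        ∑ y, ∑ z, T w y z • (S.coord y * S.coord z) := by
      rw [Finset.sum_eq_single w (fun x _ hx => by simp [hx.symm]) (by simp)]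
      simp
    have a2 : ∑ x, ∑ y, ∑ z, T x y z •
        (if w = y then (-1 : ℝ) ^ (gh w * gh x) • (S.coord x * S.coord z) else 0) =
        ∑ y, ∑ z, T w y z • (S.coord y * S.coord z) := by
      refine Finset.sum_congr rfl fun x _ => ?_
      rw [Finset.sum_eq_single w (fun x _ hx => by simp [hx.symm]) (by simp)]
      refine Finset.sum_congr rfl fun z _ => ?_
      rw [if_pos rfl, smul_smul, h₁₂ x w z, mul_comm (gh x), mul_comm]
    have a3 : ∑ x, ∑ y, ∑ z, T x y z • (if w = z then
        (-1 : ℝ) ^ (gh w * gh x + gh w * gh y) • (S.coord x * S.coord y) else 0) =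
        ∑ y, ∑ z, T w y z • (S.coord y * S.coord z) := by
      refine Finset.sum_congr rfl fun x _ => Finset.sum_congr rfl fun y _ => ?_
      rw [Finset.sum_eq_single w (fun x _ hx => by simp [hx.symm]) (by simp), if_pos rfl,
        smul_smul, h₁₂ x w y, h₂₃ x y w, neg_one_zpow_add, mul_comm (gh x), mul_comm (gh y)]
      congr 1; ring
    rw [a1, a2, a3]
    module
  have e2 : S.pderiv u (∑ y, ∑ z, T w y z • (S.coord y * S.coord z)) =
      (2 : ℝ) • ∑ z, T w u z • S.coord z := by
    simp only [map_sum, map_smul, pderiv_coord_mul_coord, smul_add, Finset.sum_add_distrib]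
    have a1 : ∑ y, ∑ z, T w y z • (if u = y then S.coord z else 0) = ∑ z, T w u z • S.coord z := by
      rw [Finset.sum_eq_single u (fun x _ hx => by simp [hx.symm]) (by simp)]
      simp
    have a2 : ∑ y, ∑ z, T w y z •
        (if u = z then (-1 : ℝ) ^ (gh u * gh y) • S.coord y else 0) =
        ∑ z, T w u z • S.coord z := by
      refine Finset.sum_congr rfl fun y _ => ?_
      rw [Finset.sum_eq_single u (fun x _ hx => by simp [hx.symm]) (by simp), if_pos rfl,
        smul_smul, h₂₃ w y u, mul_comm (gh y), mul_comm]
    rw [a1, a2, two_smul]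
  rw [e1, map_smul, map_smul, e2, map_smul, map_sum]
  simp only [map_smul, S.pderiv_coord, smul_ite, smul_zero, Finset.sum_ite_eq, Finset.mem_univ,
    if_true]
  rw [Algebra.algebraMap_eq_smul_one, smul_smul, smul_smul]
  norm_num

theorem cubic_mem (T : X → X → X → ℝ) (hT : ∀ x y z, T x y z ≠ 0 → gh x + gh y + gh z = 0) :
    ∑ x, ∑ y, ∑ z, T x y z • (S.coord x * S.coord y * S.coord z) ∈ S.wt 3 0 := by
  refine Submodule.sum_mem _ fun x _ => Submodule.sum_mem _ fun y _ => Submodule.sum_mem _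
    fun z _ => ?_
  by_cases h : T x y z = 0
  · rw [h, zero_smul]; exact Submodule.zero_mem _
  · rw [← hT x y z h]
    have hm := S.mul_mem (S.mul_mem (S.coord_mem x) (S.coord_mem y)) (S.coord_mem z)
    exact Submodule.smul_mem _ _ hm

end Symmetric

end SuperCalculus

section Concrete

variable {C : Type*} [Ring C] [Algebra ℝ C] {𝒜 : ℕ → Submodule ℝ C} [GradedAlgebra 𝒜]
  {I τ L : Type*} [Fintype I] [DecidableEq I] [Fintype τ] [LieRing L] [LieAlgebra ℝ L]
  (D : DGFrobenius 𝒜) (e : HomogeneousBasis 𝒜 I) {κ : LinearMap.BilinForm ℝ L}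
  {T : Module.Basis τ ℝ L}

theorem DGFrobenius.π_mul_eq_zero {i j k : I} (h : e.deg i + e.deg j + e.deg k ≠ 3) :
    D.π (e.basis i) (e.basis j * e.basis k) = 0 :=
  D.π_degree _ _ _ _ (e.mem i) (SetLike.GradedMul.mul_mem (e.mem j) (e.mem k)) (by omega)

/-- The coefficients are graded symmetric under adjacent transpositions: antisymmetry of `f` and
graded commutativity of the product combine to the sign of the shifted coordinates. The 6 orderings
then cancel the factor 1/6. -/
theorem isCubic_cubicAction
    (h₁₂ : ∀ a b d, DGFrobenius.structureConst κ T a b d =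
      -DGFrobenius.structureConst κ T b a d)
    (h₂₃ : ∀ a b d, DGFrobenius.structureConst κ T a b d =
      -DGFrobenius.structureConst κ T a d b) :
    (SuperPoly.calculus (ghost e.deg τ)).IsCubic D (DGFrobenius.structureConst κ T)
      (D.cubicAction e κ T) := by
  set S := SuperPoly.calculus (ghost e.deg τ)
  set f := DGFrobenius.structureConst κ T
  let t : I × τ → I × τ → I × τ → ℝ := fun x y z =>
    (-1 : ℝ) ^ (e.deg y.1 * (e.deg z.1 + 1)) * f x.2 y.2 z.2 *
      D.π (e.basis x.1) (e.basis y.1 * e.basis z.1)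
  have ht : D.cubicAction e κ T =
      (1 / 6 : ℝ) • ∑ x, ∑ y, ∑ z, t x y z • (S.coord x * S.coord y * S.coord z) := by
    rw [DGFrobenius.cubicAction]
    congr 1
    simp only [Fintype.sum_prod_type]
    rw [SuperCalculus.sum_six_comm]
    rfl
  have t0 : ∀ x y z, e.deg x.1 + e.deg y.1 + e.deg z.1 ≠ 3 → t x y z = 0 := fun x y z h => by
    simp only [t]; rw [D.π_mul_eq_zero e h, mul_zero]
  have t12 : ∀ x y z, t y x z = (-1 : ℝ) ^ (ghost e.deg τ x * ghost e.deg τ y) * t x y z := by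
    intro x y z
    by_cases h : e.deg x.1 + e.deg y.1 + e.deg z.1 = 3
    · rw [neg_one_zpow_ghost_mul]
      simp only [t]
      rw [h₁₂ y.2, D.π_mul, D.mul_comm' _ _ _ _ (e.mem y.1) (e.mem x.1), map_smul,
        LinearMap.smul_apply, smul_eq_mul, ← D.π_mul]
      have hx : e.deg x.1 ≤ 3 := by omega
      have hy : e.deg y.1 ≤ 3 := by omega
      have hz : e.deg z.1 = 3 - e.deg x.1 - e.deg y.1 := by omega
      rw [hz]
      generalize e.deg x.1 = p at *
      generalize e.deg y.1 = q at *
      interval_cases p <;> interval_cases q <;> first | (exfalso; omega) | norm_num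
    · rw [t0 x y z h, t0 y x z (by omega), mul_zero]
  have t23 : ∀ x y z, t x z y = (-1 : ℝ) ^ (ghost e.deg τ y * ghost e.deg τ z) * t x y z := by
    intro x y z
    by_cases h : e.deg x.1 + e.deg y.1 + e.deg z.1 = 3
    · rw [neg_one_zpow_ghost_mul]
      simp only [t]
      rw [h₂₃ _ z.2, D.mul_comm' _ _ _ _ (e.mem z.1) (e.mem y.1), map_smul, smul_eq_mul]
      have hy : e.deg y.1 ≤ 3 := by omega
      have hz : e.deg z.1 ≤ 3 := by omega
      generalize e.deg y.1 = p at *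
      generalize e.deg z.1 = q at *
      interval_cases p <;> interval_cases q <;> first | (exfalso; omega) | norm_num
    · rw [t0 x y z h, t0 x z y (by omega), mul_zero]
  refine ⟨h₁₂, h₂₃, ?_, ?_⟩
  · rw [ht]
    refine Submodule.smul_mem _ _ (S.cubic_mem t fun x y z h => ?_)
    have : e.deg x.1 + e.deg y.1 + e.deg z.1 = 3 := by
      by_contra h'; exact h (t0 x y z h')
    simp only [ghost]
    omega
  · intro i j k a b d
    rw [S.dir_basis, S.dir_basis, S.dir_basis, Op.of_apply, Op.of_apply, Op.of_apply, ht, map_smul,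
      map_smul, map_smul, S.third_pderiv_of_symmetric t t12 t23, smul_algebraMap]
    congr 1
    simp only [t]
    rw [h₂₃ d b a, h₁₂ d a b, h₂₃ a d b]
    ring

end Concrete

end AbstractCS

/-! ### The classical master equation. -/

namespace AbstractCS

theorem leviCivita_mul_jacobi : ∀ x y z w : Fin 3,
    ∑ b, (leviCivita y x b * leviCivita w z b + leviCivita z y b * leviCivita w x b +
      leviCivita x z b * leviCivita w y b) = 0 := by decide

namespace SuperCalculus

variable {C : Type*} [Ring C] [Algebra ℝ C] {𝒜 : ℕ → Submodule ℝ C} [GradedAlgebra 𝒜]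
  {I τ : Type*} {e : HomogeneousBasis 𝒜 I} {A : Type*} [Ring A] [Algebra ℝ A]
  [Fintype I] [DecidableEq I] {D : DGFrobenius 𝒜} {c : A}

/-- Relabelling the first three indices cyclically does not change the sum; adding the three
versions gives three times the sum on one side and zero on the other. -/
theorem sum_eq_zero_of_cyclic {X M : Type*} [Fintype X] [AddCommGroup M] [Module ℝ M]
    {F : X → X → X → X → ℝ} {H : X → X → X → X → M}
    (hF : ∀ x y z w, F x y z w + F y z x w + F z x y w = 0)
    (hH : ∀ x y z w, H y z x w = H x y z w) :
    ∑ x, ∑ y, ∑ z, ∑ w, F x y z w • H x y z w = 0 := by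
  have cyc : ∀ g : X → X → X → M, ∑ x, ∑ y, ∑ z, g y z x = ∑ x, ∑ y, ∑ z, g x y z := by
    intro g
    rw [Finset.sum_comm]
    exact Finset.sum_congr rfl fun y _ => Finset.sum_comm
  have h1 := cyc fun x y z => ∑ w, F x y z w • H x y z w
  have h2 := cyc fun x y z => ∑ w, F y z x w • H y z x w
  have h3 : ∑ x, ∑ y, ∑ z, ∑ w, (F x y z w + F y z x w + F z x y w) • H x y z w = 0 := by
    simp only [hF, zero_smul, Finset.sum_const_zero]
  simp only [hH] at h1 h2
  simp only [add_smul, Finset.sum_add_distrib] at h3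
  rw [h2, h1] at h3
  generalize ∑ x, ∑ y, ∑ z, ∑ w, F x y z w • H x y z w = s at h3
  have h4 : (3 : ℝ) • s = 0 := by rw [← h3]; module
  exact (smul_eq_zero.mp h4).resolve_left (by norm_num)

theorem dir_eq_quadratic [Fintype τ] {S : SuperCalculus (ghost e.deg τ) A} {f : τ → τ → τ → ℝ}
    (hc : S.IsCubic D f c) (b : τ) {n : ℕ} {u : C} (hu : u ∈ 𝒜 n) :
    S.dir b u c = (1 / 2 : ℝ) • ∑ x, ∑ y, ((-(-1) ^ (e.deg x.1 * (e.deg y.1 + 1)) *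
      f y.2 x.2 b) * D.π u (e.basis x.1 * e.basis y.1)) • (S.coord x * S.coord y) := by
  have hmem := S.dir_mem hc.mem hu b
  have h1 := S.euler hmem
  have h2 : ∀ x, S.pderiv x (S.dir b u c) = ∑ y, ((-(-1) ^ (e.deg x.1 * (e.deg y.1 + 1)) *
      f y.2 x.2 b) * D.π u (e.basis x.1 * e.basis y.1)) • S.coord y := by
    intro x
    have h3 := S.euler (S.pderiv_mem hmem x)
    rw [Nat.cast_one, one_smul] at h3
    rw [← h3]
    refine Finset.sum_congr rfl fun y _ => ?_
    have h4 := hc.third_of_mem (e.mem y.1) (e.mem x.1) u y.2 x.2 b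
    rw [S.dir_basis, S.dir_basis, Op.of_apply, Op.of_apply] at h4
    rw [h4, ← Algebra.commutes, Algebra.smul_def]
  simp only [h2, Finset.mul_sum, mul_smul_comm] at h1
  rw [h1, smul_smul]
  norm_num

/-- The quartic monomials in the square of the cubic vector field. -/
def quartic (S : SuperCalculus (ghost e.deg τ) A) (D : DGFrobenius 𝒜) (x y z w : I × τ) : A :=
  ((-1) ^ (e.deg x.1 * (e.deg y.1 + 1)) * (-1) ^ (e.deg z.1 * (e.deg w.1 + 1)) *
    D.π (e.basis x.1 * e.basis y.1) (e.basis z.1 * e.basis w.1)) •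
      (S.coord x * S.coord y * (S.coord z * S.coord w))

theorem quartic_eq_zero (S : SuperCalculus (ghost e.deg τ) A) {x y z w : I × τ}
    (hne : e.deg x.1 + e.deg y.1 + e.deg z.1 + e.deg w.1 ≠ 3) : S.quartic D x y z w = 0 := by
  rw [quartic, D.π_degree _ _ _ _ (SetLike.GradedMul.mul_mem (e.mem x.1) (e.mem y.1))
    (SetLike.GradedMul.mul_mem (e.mem z.1) (e.mem w.1)) (by omega), mul_zero, zero_smul]

theorem quartic_swap₁₂ (S : SuperCalculus (ghost e.deg τ) A) (x y z w : I × τ) :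
    S.quartic D y x z w = -S.quartic D x y z w := by
  by_cases hd : e.deg x.1 + e.deg y.1 + e.deg z.1 + e.deg w.1 = 3
  · rw [quartic, quartic, S.coord_mul_comm y x, neg_one_zpow_ghost_mul,
      D.mul_comm' _ _ _ _ (e.mem y.1) (e.mem x.1), map_smul, LinearMap.smul_apply, smul_eq_mul,
      smul_mul_assoc, smul_smul, ← neg_smul]
    congr 1
    have hx : e.deg x.1 ≤ 3 := by omega
    have hy : e.deg y.1 ≤ 3 := by omega
    generalize e.deg x.1 = p at *
    generalize e.deg y.1 = q at *
    interval_cases p <;> interval_cases q <;> norm_num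
  · rw [S.quartic_eq_zero hd, S.quartic_eq_zero (by omega), neg_zero]

theorem neg_one_pow_swap {p q r t : ℕ} (h : p + q + r + t = 3) :
    (-1 : ℝ) ^ (p * (r + 1)) * (-1) ^ (q * (t + 1)) * (-1) ^ (r * q) * (-1) ^ ((r + 1) * (q + 1)) =
      -((-1) ^ (p * (q + 1)) * (-1) ^ (r * (t + 1))) := by
  have hp : p ≤ 3 := by omega
  have hq : q ≤ 3 := by omega
  have hr : r ≤ 3 := by omega
  have ht : t = 3 - p - q - r := by omega
  rw [ht]
  interval_cases p <;> interval_cases q <;> interval_cases r <;>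
    first | (exfalso; omega) | norm_num

/-- Associativity brings the two middle factors together inside the pairing. The signs of the
algebra and of the shifted coordinates then combine to -1, so with `quartic_swap₁₂` the quartic
monomials are cyclically invariant in the first three arguments. -/
theorem quartic_swap₂₃ (S : SuperCalculus (ghost e.deg τ) A) (x y z w : I × τ) :
    S.quartic D x z y w = -S.quartic D x y z w := by
  by_cases hd : e.deg x.1 + e.deg y.1 + e.deg z.1 + e.deg w.1 = 3
  · have h1 : D.π (e.basis x.1 * e.basis z.1) (e.basis y.1 * e.basis w.1) =
        (-1) ^ (e.deg z.1 * e.deg y.1) *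
          D.π (e.basis x.1 * e.basis y.1) (e.basis z.1 * e.basis w.1) := by
      rw [D.π_mul, D.π_mul (e.basis x.1 * e.basis y.1), mul_assoc (e.basis x.1),
        D.mul_comm' _ _ _ _ (e.mem z.1) (e.mem y.1), mul_assoc (e.basis x.1) (e.basis y.1),
        mul_smul_comm, map_smul, LinearMap.smul_apply, smul_eq_mul]
    have h2 : S.coord x * S.coord z * (S.coord y * S.coord w) =
        (-1 : ℝ) ^ ((e.deg z.1 + 1) * (e.deg y.1 + 1)) •
          (S.coord x * S.coord y * (S.coord z * S.coord w)) := by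
      rw [mul_assoc (S.coord x), ← mul_assoc (S.coord z), S.coord_mul_comm z y,
        neg_one_zpow_ghost_mul, smul_mul_assoc, mul_smul_comm, mul_assoc (S.coord x),
        mul_assoc (S.coord y)]
    rw [quartic, quartic, h1, h2, smul_smul, ← neg_smul]
    congr 1
    have h3 := neg_one_pow_swap hd
    linear_combination D.π (e.basis x.1 * e.basis y.1) (e.basis z.1 * e.basis w.1) * h3
  · rw [S.quartic_eq_zero hd, S.quartic_eq_zero (by omega), neg_zero]

theorem sum_sum_mul_sum_sum {X : Type*} [Fintype X] (g g' : X → X → A) :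
    (∑ x, ∑ y, g x y) * (∑ z, ∑ w, g' z w) = ∑ x, ∑ y, ∑ z, ∑ w, g x y * g' z w := by
  rw [Finset.sum_mul]
  refine Finset.sum_congr rfl fun x _ => ?_
  rw [Finset.sum_mul]
  refine Finset.sum_congr rfl fun y _ => ?_
  rw [Finset.mul_sum]
  refine Finset.sum_congr rfl fun z _ => ?_
  rw [Finset.mul_sum]

theorem sum_comm_four {X ι : Type*} [Fintype X] [Fintype ι] (g : ι → X → X → X → X → A) :
    ∑ m, ∑ x, ∑ y, ∑ z, ∑ w, g m x y z w = ∑ x, ∑ y, ∑ z, ∑ w, ∑ m, g m x y z w := by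
  rw [Finset.sum_comm]
  refine Finset.sum_congr rfl fun x _ => ?_
  rw [Finset.sum_comm]
  refine Finset.sum_congr rfl fun y _ => ?_
  rw [Finset.sum_comm]
  refine Finset.sum_congr rfl fun z _ => ?_
  rw [Finset.sum_comm]

/-- Each factor is a quadratic form by Euler's identity, and completeness of the dual bases fuses
the two pairings into one. -/
theorem sum_dir_mul_dir [Fintype τ] {S : SuperCalculus (ghost e.deg τ) A} {f : τ → τ → τ → ℝ}
    (hc : S.IsCubic D f c) (b : τ) :
    ∑ m, S.dir b (D.dual e m) c * S.dir b (e.basis m) c =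
      (1 / 4 : ℝ) • ∑ x, ∑ y, ∑ z, ∑ w, (f y.2 x.2 b * f w.2 z.2 b) • S.quartic D x y z w := by
  have hπ : ∀ U V : C, ∑ m, D.π (D.dual e m) U * D.π (e.basis m) V = D.π U V := by
    intro U V
    have := congrArg (fun t => D.π t V) (D.sum_π_dual_basis e U)
    simpa only [map_sum, LinearMap.sum_apply, map_smul, LinearMap.smul_apply,
      smul_eq_mul] using this
  have step : ∀ m, S.dir b (D.dual e m) c * S.dir b (e.basis m) c =
      (1 / 4 : ℝ) • ∑ x, ∑ y, ∑ z, ∑ w, (D.π (D.dual e m) (e.basis x.1 * e.basis y.1) *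
        D.π (e.basis m) (e.basis z.1 * e.basis w.1)) • ((f y.2 x.2 b * f w.2 z.2 b) •
        (((-1 : ℝ) ^ (e.deg x.1 * (e.deg y.1 + 1)) * (-1) ^ (e.deg z.1 * (e.deg w.1 + 1))) •
          (S.coord x * S.coord y * (S.coord z * S.coord w)))) := by
    intro m
    rw [dir_eq_quadratic hc b (D.dual_mem e m), dir_eq_quadratic hc b (e.mem m),
      smul_mul_smul_comm, sum_sum_mul_sum_sum, show (1 / 2 * (1 / 2) : ℝ) = 1 / 4 by norm_num]
    congr 1
    refine Finset.sum_congr rfl fun x _ => Finset.sum_congr rfl fun y _ =>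
      Finset.sum_congr rfl fun z _ => Finset.sum_congr rfl fun w _ => ?_
    rw [smul_mul_smul_comm, smul_smul, smul_smul]
    congr 1; ring
  rw [Finset.sum_congr rfl fun m _ => step m, ← Finset.smul_sum, sum_comm_four]
  congr 1
  refine Finset.sum_congr rfl fun x _ => Finset.sum_congr rfl fun y _ =>
      Finset.sum_congr rfl fun z _ => Finset.sum_congr rfl fun w _ => ?_
  rw [← Finset.sum_smul, hπ, quartic, smul_smul, smul_smul, smul_smul]
  congr 1; ring

/-- The classical master equation. -/
theorem IsCubic.lap_id_sq {S : SuperCalculus (ghost e.deg (Fin 3)) A}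
    {f : Fin 3 → Fin 3 → Fin 3 → ℝ} (hc : S.IsCubic D f c) :
    S.lap D LinearMap.id 1 (c * c) = 0 := by
  have h1 : ∀ b m, (S.dir b (LinearMap.id (R := ℝ) (D.dual e m)) * S.dir b (e.basis m)) (c * c) =
      (2 : ℝ) • (S.dir b (D.dual e m) c * S.dir b (e.basis m) c) := by
    intro b m
    rw [LinearMap.id_apply, Op.mul_apply, hc.dir_sq, map_smul, S.dir_mul_even hc.mem,
      hc.dir_dir_same b (D.dual_mem e m) (e.mem m), mul_zero, add_zero]
  -- The Jacobi identity kills the cyclic sum of the Lie algebra factors, while the quartic factors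
  -- are cyclically invariant.
  have h2 : ∑ x, ∑ y, ∑ z, ∑ w, (∑ b, f y.2 x.2 b * f w.2 z.2 b) • S.quartic D x y z w = 0 := by
    refine sum_eq_zero_of_cyclic ?_ fun x y z w => by
      rw [S.quartic_swap₂₃, S.quartic_swap₁₂, neg_neg]
    intro x y z w
    have := congrArg (fun t : ℤ => f 0 1 2 ^ 2 * (t : ℝ))
      (leviCivita_mul_jacobi x.2 y.2 z.2 w.2)
    simp only [Int.cast_sum, Int.cast_add, Int.cast_mul, Int.cast_zero, mul_zero,
      Finset.mul_sum] at this
    rw [← this, ← Finset.sum_add_distrib, ← Finset.sum_add_distrib]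
    refine Finset.sum_congr rfl fun b _ => ?_
    rw [hc.f_eq y.2, hc.f_eq w.2 z.2, hc.f_eq z.2, hc.f_eq w.2 x.2, hc.f_eq x.2, hc.f_eq w.2 y.2]
    ring
  rw [lap_one_right, Op.sum_apply]
  simp only [Op.sum_apply, h1, ← Finset.smul_sum, sum_dir_mul_dir hc]
  rw [sum_comm_four]
  simp only [← Finset.sum_smul, h2, smul_zero]

end SuperCalculus

/-! ### Structure constants of an invariant inner product on su(2). -/

section SU2

variable {L : Type*} [LieRing L] [LieAlgebra ℝ L] {κ : LinearMap.BilinForm ℝ L} {τ : Type*}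
  {T : Module.Basis τ ℝ L}

theorem structureConst_swap₂₃ (a b d : τ) : DGFrobenius.structureConst κ T a b d =
    -DGFrobenius.structureConst κ T a d b := by
  rw [DGFrobenius.structureConst, DGFrobenius.structureConst, ← lie_skew, map_neg]

theorem structureConst_swap₁₂ (hκ_inv : ∀ x y z, κ x ⁅y, z⁆ = κ ⁅x, y⁆ z) (a b d : τ) :
    DGFrobenius.structureConst κ T a b d = -DGFrobenius.structureConst κ T b a d := by
  rw [DGFrobenius.structureConst, DGFrobenius.structureConst, hκ_inv, hκ_inv, ← lie_skew, map_neg,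
    LinearMap.neg_apply]

theorem lie_eq_zero_of_structureConst [Fintype τ] [DecidableEq τ]
    (hT : ∀ a b, κ (T a) (T b) = if a = b then 1 else 0)
    (h : ∀ a b d, DGFrobenius.structureConst κ T a b d = 0) (x y : L) : ⁅x, y⁆ = 0 := by
  have hb : ∀ b d, ⁅T b, T d⁆ = 0 := by
    intro b d
    rw [← T.sum_repr ⁅T b, T d⁆]
    refine Finset.sum_eq_zero fun a _ => ?_
    have h1 := h a b d
    rw [DGFrobenius.structureConst, ← T.sum_repr ⁅T b, T d⁆, map_sum] at h1
    simp only [map_smul, hT, smul_eq_mul, mul_ite, mul_one, mul_zero, Finset.sum_ite_eq,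
      Finset.mem_univ, if_true] at h1
    rw [h1, zero_smul]
  rw [← T.sum_repr x, ← T.sum_repr y]
  simp only [sum_lie, lie_sum, smul_lie, lie_smul, hb, smul_zero, Finset.sum_const_zero]

attribute [local instance] LieRing.ofAssociativeRing

theorem su2_not_abelian : ∃ x y : su2, ⁅x, y⁆ ≠ 0 := by
  refine ⟨⟨!![Complex.I, 0; 0, -Complex.I], ?_, ?_⟩, ⟨!![0, 1; -1, 0], ?_, ?_⟩, ?_⟩
  · ext i j; fin_cases i <;> fin_cases j <;> simp
  · simp [Matrix.trace_fin_two]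
  · ext i j; fin_cases i <;> fin_cases j <;> simp
  · simp [Matrix.trace_fin_two]
  · intro h
    have h1 := congrArg (fun x : su2 => (x : Matrix (Fin 2) (Fin 2) ℂ) 0 1) h
    simp [Ring.lie_def] at h1

end SU2

end AbstractCS

/-! ### Independence of the propagator. -/

namespace AbstractCS

variable {C : Type*} [Ring C] [Algebra ℝ C] {𝒜 : ℕ → Submodule ℝ C} [GradedAlgebra 𝒜]

namespace SuperCalculus.IsCubic

variable {I : Type*} [Fintype I] [DecidableEq I] {e : HomogeneousBasis 𝒜 I} {A : Type*} [Ring A]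
  [Algebra ℝ A] {S : SuperCalculus (ghost e.deg (Fin 3)) A} {D : DGFrobenius 𝒜}
  {f : Fin 3 → Fin 3 → Fin 3 → ℝ} {c : A}

theorem two_loop_invariant_of_eq (hc : S.IsCubic D f c) {v : C} {K₀ K₁ : C →ₗ[ℝ] C}
    (h₀ : D.IsPropagator e v K₀) (h₁ : D.IsPropagator e v K₁) {θ₀ θ₁ : ℝ}
    (hθ₀ : (S.lap D K₀ 1 ^ 3) (c ^ 2) = algebraMap ℝ A θ₀)
    (hθ₁ : (S.lap D K₁ 1 ^ 3) (c ^ 2) = algebraMap ℝ A θ₁) :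
    θ₁ - 288 * f 0 1 2 ^ 2 * D.vtrace e v (K₁ ∘ₗ K₁ ∘ₗ K₁) =
      θ₀ - 288 * f 0 1 2 ^ 2 * D.vtrace e v (K₀ ∘ₗ K₀ ∘ₗ K₀) := by
  have := hc.lap_cube_sq_sub hc.lap_id_sq h₀ h₁
  simp only [pow_succ, pow_zero, one_mul, Op.mul_apply] at hθ₀ hθ₁
  rw [hθ₀, hθ₁, ← map_sub, hc.normSq] at this
  have := S.algebraMap_injective this
  linarith

/-- The two-loop combination does not depend on the propagator. -/
theorem two_loop_invariant (hc : S.IsCubic D f c) {v₀ v₁ : C} {K₀ K₁ : C →ₗ[ℝ] C}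
    (h₀ : D.IsPropagator e v₀ K₀) (h₁ : D.IsPropagator e v₁ K₁) {θ₀ θ₁ : ℝ}
    (hθ₀ : (S.lap D K₀ 1 ^ 3) (c ^ 2) = algebraMap ℝ A θ₀)
    (hθ₁ : (S.lap D K₁ 1 ^ 3) (c ^ 2) = algebraMap ℝ A θ₁) :
    θ₁ - 288 * f 0 1 2 ^ 2 * D.vtrace e v₁ (K₁ ∘ₗ K₁ ∘ₗ K₁) =
      θ₀ - 288 * f 0 1 2 ^ 2 * D.vtrace e v₀ (K₀ ∘ₗ K₀ ∘ₗ K₀) := by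
  -- The comparison runs from K₀ to the strict K₀dK₀ with the same v₀, then by a shift to v₁, and
  -- from there to K₁ with the same v₁.
  obtain ⟨hs, hss⟩ := h₀.strictify
  generalize K₀ ∘ₗ D.d ∘ₗ K₀ = K at hs hss
  obtain ⟨θ, hθ⟩ := hc.lap_cube_mem_const hs
  have hp := hs.add_shift h₁.v_mem h₁.d_v h₁.π_one_v
  have hsh := hc.lap_cube_sq_shift hs hss h₁.v_mem h₁.d_v h₁.π_one_v rfl
  have hθ' : (S.lap D (K + D.shift (K v₁)) 1 ^ 3) (c ^ 2) = algebraMap ℝ A θ := by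
    rw [← hθ]
    simpa only [pow_succ, pow_zero, one_mul, Op.mul_apply] using hsh
  -- Both intermediate propagators square to zero, so the correction terms at the shift vanish and
  -- only the equality of the vacuum diagrams is needed.
  have hz : ∀ v, D.vtrace e v (K ∘ₗ K ∘ₗ K) = 0 := by
    intro v; simp [DGFrobenius.vtrace, hss]
  have hz' : ∀ v, D.vtrace e v ((K + D.shift (K v₁)) ∘ₗ (K + D.shift (K v₁)) ∘ₗ
      (K + D.shift (K v₁))) = 0 := by
    intro v
    have h2 : ∀ a, (K + D.shift (K v₁)) ((K + D.shift (K v₁)) a) = 0 := by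
      intro a
      obtain ⟨e1, e2, e3⟩ := hs.shift_mul hss h₁.v_mem a
      simp only [LinearMap.add_apply, map_add, hss, e1, e2, e3, add_zero]
    simp only [DGFrobenius.vtrace, LinearMap.comp_apply, h2, mul_zero, map_zero,
      Finset.sum_const_zero]
  have i1 := hc.two_loop_invariant_of_eq h₀ hs hθ₀ hθ
  have i2 := hc.two_loop_invariant_of_eq hp h₁ hθ' hθ₁
  rw [hz] at i1
  rw [hz'] at i2
  linarith

end SuperCalculus.IsCubic

/-! ### From induction data to propagators and restrictions. -/

namespace DGFrobenius

variable {D : DGFrobenius 𝒜} {I τ : Type*} [Fintype I] [DecidableEq I] [Fintype τ]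
  (e : HomogeneousBasis 𝒜 I) (h : D.DarbouxBasis) (R : D.RelaxedInductionData)

/-- At the unit the left side of the homotopy relation vanishes, so 1 lies in the image of ι; there
are no coboundaries in degree zero to modify it by. -/
theorem RelaxedInductionData.ι_zero : R.ι (h.basis 0) = 1 := by
  obtain ⟨x, hx, -⟩ := R.homotopy 1
  rw [R.K_mem_zero 1 one_mem_zero, D.d_one, map_zero, map_zero, add_zero] at hx
  have h1 : R.ι x = 1 := (sub_eq_zero.mp hx.symm).symm
  have h2 : x = h.basis 0 := by
    rw [← R.cls_ι x, h.basis_zero]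
    simp only [h1]
  rw [← h2, h1]

theorem RelaxedInductionData.ι_one_mem : R.ι (h.basis 1) ∈ 𝒜 3 :=
  R.ι_mem 3 _ (h.toHomogeneous.mem 1)

/-- Two representatives of the class differ by a coboundary, which is orthogonal to 1. -/
theorem RelaxedInductionData.π_one_ι_one : D.π 1 (R.ι (h.basis 1)) = 1 := by
  have h1 := R.cls_ι (h.basis 1)
  rw [h.basis_one] at h1
  rw [cls, cls, Submodule.Quotient.eq] at h1
  obtain ⟨y, hy⟩ := h1
  have h2 : D.d y = R.ι (D.cls h.v h.d_v) - h.v := hy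
  have h3 := π_one_d D y
  rw [h2, map_sub, h.π_one_v] at h3
  rw [h.basis_one]
  linarith

theorem RelaxedInductionData.isPropagator : D.IsPropagator e (R.ι (h.basis 1)) R.K := by
  have hsymm : ∀ a b, D.π (R.K a) b = D.π a (R.K (e.sign b)) := by
    intro a b
    refine e.induction (p := fun a => D.π (R.K a) b = D.π a (R.K (e.sign b))) (by simp) ?_ ?_ ?_ a
    · intro x y hx hy; simp only [map_add, LinearMap.add_apply, hx, hy]
    · intro r x hx; simp only [map_smul, LinearMap.smul_apply, hx]
    intro i
    refine e.induction (p := fun b => D.π (R.K (e.basis i)) b =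
      D.π (e.basis i) (R.K (e.sign b))) (by simp) ?_ ?_ ?_ b
    · intro x y hx hy; simp only [map_add, hx, hy]
    · intro r x hx; simp only [map_smul, hx]
    intro j
    have h1 := R.K_symm _ _ (e.basis j) (e.mem i)
    rw [e.sign_basis, map_smul, map_smul, smul_eq_mul]
    -- K lowers the degree by one, so only total degree four contributes; there the two degrees have
    -- equal parity and the two forms of the symmetry agree.
    by_cases hij : e.deg i + e.deg j = 4
    · rw [h1]
      congr 1
      have hi : e.deg i ≤ 4 := by omega
      have hj : e.deg j = 4 - e.deg i := by omega
      rw [hj]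
      interval_cases e.deg i <;> norm_num
    · have h2 : D.π (R.K (e.basis i)) (e.basis j) = 0 := by
        rcases Nat.eq_zero_or_pos (e.deg i) with h0 | h0
        · rw [R.K_mem_zero _ (h0 ▸ e.mem i), map_zero, LinearMap.zero_apply]
        · refine D.π_degree (e.deg i - 1) _ _ _ (R.K_mem _ _ ?_) (e.mem j) (by omega)
          rw [Nat.sub_add_cancel h0]
          exact e.mem i
      rw [h2] at h1 ⊢
      have h3 : D.π (e.basis i) (R.K (e.basis j)) = 0 :=
        (mul_eq_zero.mp h1.symm).resolve_left (pow_ne_zero _ (by norm_num))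
      rw [h3, mul_zero]
  refine ⟨R.ι_one_mem h, R.d_ι _, R.π_one_ι_one h, R.K_mem, R.K_mem_zero, ?_, hsymm, ?_, R.K_ι _⟩
  · intro a
    obtain ⟨x, hx, hπ⟩ := R.homotopy a
    rw [hx]
    congr 1
    have hv := R.ι_one_mem h
    have hvv : D.π (R.ι (h.basis 1)) (R.ι (h.basis 1)) = 0 := D.π_degree 3 3 _ _ hv hv (by norm_num)
    have h11 : D.π (1 : C) 1 = 0 := D.π_degree 0 0 _ _ one_mem_zero one_mem_zero (by norm_num)
    have h1v := R.π_one_ι_one h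
    have hv1 : D.π (R.ι (h.basis 1)) 1 = 1 := by rw [D.π_comm e, h1v]
    have hxι : R.ι x = h.basis.repr x 0 • (1 : C) + h.basis.repr x 1 • R.ι (h.basis 1) := by
      conv_lhs => rw [← h.basis.sum_repr x]
      rw [Fin.sum_univ_two, map_add, map_smul, map_smul, R.ι_zero h]
    have e0 := hπ (h.basis 0)
    have e1 := hπ (h.basis 1)
    rw [R.ι_zero h, hxι, map_add, map_smul, map_smul, LinearMap.add_apply, LinearMap.smul_apply,
      LinearMap.smul_apply, h11, hv1, smul_zero, zero_add, smul_eq_mul, mul_one] at e0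
    rw [hxι, map_add, map_smul, map_smul, LinearMap.add_apply, LinearMap.smul_apply,
      LinearMap.smul_apply, hvv, h1v, smul_zero, add_zero, smul_eq_mul, mul_one] at e1
    rw [hxι, e0, e1, harmonic_apply]
  · rw [← R.ι_zero h, R.K_ι]

theorem laplacian_eq_lap [DecidableEq τ] :
    Op.of (laplacian e R τ) = (SuperPoly.calculus (ghost e.deg τ)).lap D R.K 1 := by
  rw [SuperCalculus.lap_one_right]
  ext g
  simp only [Op.sum_apply, Op.mul_apply, SuperCalculus.dir_basis, Op.of_apply, laplacian,
    LinearMap.sum_apply, LinearMap.smul_apply, LinearMap.comp_apply, dual, map_sum, map_smul,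
    Op.smul_apply]
  rw [Finset.sum_congr rfl fun i _ => Finset.sum_congr rfl fun j _ => Finset.sum_comm]
  rw [Finset.sum_congr rfl fun i _ => Finset.sum_comm, Finset.sum_comm]
  refine Finset.sum_congr rfl fun b _ => ?_
  rw [Finset.sum_congr rfl fun i _ => Finset.sum_comm, Finset.sum_comm]
  refine Finset.sum_congr rfl fun m _ => Finset.sum_congr rfl fun i _ => ?_
  rw [SuperCalculus.dir_eq_sum, Op.sum_apply, Finset.smul_sum]
  refine Finset.sum_congr rfl fun j _ => ?_
  rw [Op.smul_apply, smul_smul]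
  rfl

theorem laplacian_pow_apply [DecidableEq τ] (E : ℕ) (g : SuperPoly (ghost e.deg τ)) :
    (laplacian e R τ ^ E) g =
      ((SuperPoly.calculus (ghost e.deg τ)).lap D R.K 1 ^ E) g := by
  rw [← laplacian_eq_lap]
  rfl

/-- The calculus on the functions of the coordinates on cohomology. -/
def DarbouxBasis.calculus (τ : Type*) : SuperCalculus (ghost ![0, 3] τ)
    (SuperPoly (ghost h.toHomogeneous.deg τ)) :=
  SuperPoly.calculus (ghost h.toHomogeneous.deg τ)

theorem isRestriction : (SuperPoly.calculus (ghost e.deg τ)).IsRestriction (h.calculus τ)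
    (R.ι (h.basis 1)) (restrict e R h.toHomogeneous τ) := by
  classical
  have hM : ∀ (x : I × τ) (y : Fin 2 × τ), (if x.2 = y.2 then
      e.basis.repr (R.ι (h.toHomogeneous.basis y.1)) x.1 else 0) ≠ 0 →
      ghost e.deg τ x = ghost h.toHomogeneous.deg τ y := by
    intro x y hxy
    have h1 : e.basis.repr (R.ι (h.toHomogeneous.basis y.1)) x.1 ≠ 0 := by
      intro h0; apply hxy; rw [h0, ite_self]
    rw [ghost, ghost, e.deg_eq_of_repr_ne_zero (R.ι_mem _ _ (h.toHomogeneous.mem y.1)) h1]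
  have hs : (SuperPoly.calculus (ghost e.deg τ)).IsSubst
      (SuperPoly.calculus (ghost h.toHomogeneous.deg τ)) (restrict e R h.toHomogeneous τ)
      (fun x y => if x.2 = y.2 then e.basis.repr (R.ι (h.toHomogeneous.basis y.1)) x.1 else 0) := by
    refine ⟨fun x => ?_, hM⟩
    rw [restrict]
    refine Eq.trans ?_ (SuperPoly.linearSubst_coord _ hM x)
    congr!
  have hd : ∀ p b f, (SuperPoly.calculus (ghost h.toHomogeneous.deg τ)).pderiv (p, b)
      (restrict e R h.toHomogeneous τ f) = restrict e R h.toHomogeneous τ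
        ((SuperPoly.calculus (ghost e.deg τ)).dir b (R.ι (h.basis p)) f) := by
    intro p b f
    rw [hs.pderiv, SuperCalculus.dir_eq_sum, Op.sum_apply, map_sum, Fintype.sum_prod_type]
    refine Finset.sum_congr rfl fun i _ => ?_
    rw [Finset.sum_eq_single b (fun a _ ha => by rw [if_neg ha, zero_smul]) (by simp), if_pos rfl,
      Op.smul_apply, map_smul]
    rfl
  refine ⟨fun hf => hs.map_mem hf, fun b f => ?_, fun b f => hd 1 b f⟩
  rw [← R.ι_zero h]
  exact hd 0 b f

end DGFrobenius

end AbstractCS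

/-! ### The function W and the powers of ħ. -/

namespace AbstractCS

namespace SuperCalculus

variable {τ B : Type*} [Fintype τ] [Ring B] [Algebra ℝ B]
  (S' : SuperCalculus (ghost ![0, 3] τ) B) {f : τ → τ → τ → ℝ}

/-- The cubic function `½ ∑ f_abd α₀^a α₀^b α₃^d`. -/
def tripleProduct (f : τ → τ → τ → ℝ) : B :=
  (1 / 2 : ℝ) • ∑ a, ∑ b, ∑ d, f a b d • (S'.coord (0, a) * S'.coord (0, b) * S'.coord (1, d))

theorem tripleProduct_mem : S'.tripleProduct f ∈ S'.wt 3 0 := by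
  refine Submodule.smul_mem _ _ <| Submodule.sum_mem _ fun a _ => Submodule.sum_mem _ fun b _ =>
    Submodule.sum_mem _ fun d _ => Submodule.smul_mem _ _ ?_
  have hm := S'.mul_mem (S'.mul_mem (S'.coord_mem (0, a)) (S'.coord_mem (0, b)))
    (S'.coord_mem (1, d))
  rw [ghost_zero, ghost_zero, ghost_one] at hm
  norm_num at hm
  exact hm

theorem third_pderiv_tripleProduct (hf : ∀ a b d, f a b d = -f b a d) (a b d : τ) :
    S'.pderiv (1, d) (S'.pderiv (0, b) (S'.pderiv (0, a) (S'.tripleProduct f))) =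
      algebraMap ℝ B (f a b d) := by
  classical
  have e1 : S'.pderiv (0, a) (S'.tripleProduct f) =
      ∑ b, ∑ d, f a b d • (S'.coord (0, b) * S'.coord (1, d)) := by
    have h1 : ∀ x y z, S'.pderiv (0, a) (S'.coord (0, x) * S'.coord (0, y) * S'.coord (1, z)) =
        (if a = x then S'.coord (0, y) * S'.coord (1, z) else 0) -
        (if a = y then S'.coord (0, x) * S'.coord (1, z) else 0) := by
      intro x y z
      rw [pderiv_coord_mul_coord_mul_coord]
      simp only [ghost_zero, Prod.mk.injEq, true_and, zero_ne_one, false_and, if_false, add_zero,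
        mul_one, zpow_one, neg_smul, one_smul]
      split_ifs <;> simp [sub_eq_add_neg]
    simp only [tripleProduct, map_smul, map_sum, h1, smul_sub, Finset.sum_sub_distrib]
    have a1 : ∑ x, ∑ y, ∑ z, f x y z • (if a = x then S'.coord (0, y) * S'.coord (1, z) else 0) =
        ∑ y, ∑ z, f a y z • (S'.coord (0, y) * S'.coord (1, z)) := by
      rw [Finset.sum_eq_single a (fun x _ hx => by simp [hx.symm]) (by simp)]
      simp
    have a2 : ∑ x, ∑ y, ∑ z, f x y z • (if a = y then S'.coord (0, x) * S'.coord (1, z) else 0) =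
        -∑ y, ∑ z, f a y z • (S'.coord (0, y) * S'.coord (1, z)) := by
      rw [← Finset.sum_neg_distrib]
      refine Finset.sum_congr rfl fun x _ => ?_
      rw [Finset.sum_eq_single a (fun x _ hx => by simp [hx.symm]) (by simp),
        ← Finset.sum_neg_distrib]
      refine Finset.sum_congr rfl fun z _ => ?_
      rw [if_pos rfl, hf x a, neg_smul]
    rw [a1, a2]
    module
  have e2 : S'.pderiv (0, b) (∑ b, ∑ d, f a b d • (S'.coord (0, b) * S'.coord (1, d))) =
      ∑ d, f a b d • S'.coord (1, d) := by
    simp only [map_sum, map_smul, pderiv_coord_mul_coord, Prod.mk.injEq, true_and, zero_ne_one,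
      false_and, if_false, add_zero]
    rw [Finset.sum_eq_single b (fun x _ hx => by simp [hx.symm]) (by simp)]
    simp
  rw [e1, e2, map_sum]
  simp only [map_smul, S'.pderiv_coord, Prod.mk.injEq, true_and, smul_ite, smul_zero,
    Finset.sum_ite_eq, Finset.mem_univ, if_true]
  rw [Algebra.algebraMap_eq_smul_one]

end SuperCalculus

namespace DGFrobenius

variable {C : Type*} [Ring C] [Algebra ℝ C] {𝒜 : ℕ → Submodule ℝ C} [GradedAlgebra 𝒜]
  {D : DGFrobenius 𝒜} {I τ L : Type*} [Fintype I] [DecidableEq I] [Fintype τ]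
  [LieRing L] [LieAlgebra ℝ L] {P : Type*} [Fintype P]

/-- A logarithm that is a combination of constants and a single function, with the supports
prescribed by the degrees, defines an induced action. -/
theorem isInd_ansatz {e : HomogeneousBasis 𝒜 I} {R : D.RelaxedInductionData}
    {h : HomogeneousBasis D.cohomologyDeg P} {S : SuperPoly (ghost e.deg τ)}
    {w : SuperPoly (ghost h.deg τ)} {a b : ℕ → ℕ → ℝ}
    (hlog : ∀ V E, logCoeff e R h S V E = algebraMap ℝ _ (b V E) + a V E • w)
    (hb : ∀ V E, b V E ≠ 0 → 3 * V = 2 * E) (ha : ∀ V E, a V E ≠ 0 → 3 * V = 2 * E + 3)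
    (hb0 : ∀ E, b 0 E = 0) :
    IsInd e R h S (ansatz (PowerSeries.mk fun l => a (2 * l + 1) (3 * l))
      (PowerSeries.mk fun l => b (2 * l - 2) (3 * l - 3)) w) := by
  have hb' : ∀ V E, 3 * V ≠ 2 * E → b V E = 0 := fun V E hVE => by
    by_contra h; exact hVE (hb V E h)
  have ha' : ∀ V E, 3 * V ≠ 2 * E + 3 → a V E = 0 := fun V E hVE => by
    by_contra h; exact hVE (ha V E h)
  refine ⟨fun V E hVE => ?_, fun l => ?_⟩
  · rw [hlog, hb' V E (by omega), ha' V E (by omega), map_zero, zero_smul, add_zero]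
  have hne : ∀ p : ℕ × ℕ, logCoeff e R h S p.1 p.2 ≠ 0 →
      3 * p.1 = 2 * p.2 ∨ 3 * p.1 = 2 * p.2 + 3 := by
    intro p hp
    by_contra hcon
    rw [not_or] at hcon
    apply hp
    rw [hlog, hb' _ _ hcon.1, ha' _ _ hcon.2, map_zero, zero_smul, add_zero]
  -- These solve E + 1 = l + V on the two support lines. At l = 0 truncated subtraction turns the
  -- first pair into (0,0), which is off the line E + 1 = V but harmless: the logarithm has no term
  -- without vertices (`hb0`).
  set t : Finset (ℕ × ℕ) := {(2 * l - 2, 3 * l - 3), (2 * l + 1, 3 * l)} with ht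
  have hmem : ∀ p : ℕ × ℕ, logCoeff e R h S p.1 p.2 ≠ 0 → (p.2 + 1 = l + p.1 ↔ p ∈ t) := by
    rintro ⟨V, E⟩ hp
    have h1 := hne _ hp
    simp only [ht, Finset.mem_insert, Finset.mem_singleton, Prod.mk.injEq] at h1 ⊢
    constructor
    · intro h2; omega
    · rintro (⟨rfl, rfl⟩ | ⟨rfl, rfl⟩)
      · rcases Nat.eq_zero_or_pos l with rfl | hl
        · refine absurd ?_ hp
          simp only
          rw [hlog, hb0, ha' _ _ (by omega), map_zero, zero_smul, add_zero]
        · omega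
      · omega
  refine ⟨t.finite_toSet.subset fun p hp => (hmem p hp.2).mp hp.1, ?_⟩
  have hfin := finsum_mem_eq_sum_of_inter_support_eq
    (fun p : ℕ × ℕ => logCoeff e R h S p.1 p.2) (s := {p | p.2 + 1 = l + p.1}) (t := t) (by
      ext p
      simp only [Set.mem_inter_iff, Set.mem_ofPred_eq, Function.mem_support, Finset.mem_coe]
      exact and_congr_left fun hp => hmem p hp)
  refine Eq.trans ?_ hfin.symm
  rw [ht, Finset.sum_pair (by intro h; have := congrArg Prod.fst h; simp only at this; omega), hlog,
    hlog, ha' (2 * l - 2) _ (by omega), hb' (2 * l + 1) _ (by omega), zero_smul, add_zero, map_zero,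
    zero_add, ansatz, PowerSeries.coeff_mk, PowerSeries.coeff_mk, PowerSeries.coeff_mk, add_comm]

end DGFrobenius

end AbstractCS

/-! ### The effective action and its two-loop part. -/

namespace AbstractCS

namespace DGFrobenius

variable {C : Type*} [Ring C] [Algebra ℝ C] {𝒜 : ℕ → Submodule ℝ C} [GradedAlgebra 𝒜]
  {D : DGFrobenius 𝒜} {I L : Type*} [Fintype I] [DecidableEq I] [LieRing L] [LieAlgebra ℝ L]

/-- The weight of the diagrams with `V` vertices and `E` edges. -/
def diagramWeight (V E : ℕ) : ℝ :=
  (1 / (V.factorial : ℝ)) * ((-1 / 2 : ℝ) ^ E / (E.factorial : ℝ))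

theorem diagramWeight_succ_mul (V E : ℕ) (r : ℝ) :
    diagramWeight (V + 1) E * (((V : ℝ) + 1) * r) = diagramWeight V E * r := by
  have h1 : ((V : ℝ) + 1) ≠ 0 := by positivity
  have h2 : (V.factorial : ℝ) ≠ 0 := by positivity
  have h3 : (E.factorial : ℝ) ≠ 0 := by positivity
  rw [diagramWeight, diagramWeight, Nat.factorial_succ]
  push_cast
  field_simp

/-- Both functions are cubic of ghost number zero, hence determined by their mixed third
derivatives, which are the structure constants in either case. -/
theorem prod003_eq_map {κ : LinearMap.BilinForm ℝ L} {T : Module.Basis (Fin 3) ℝ L}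
    (e : HomogeneousBasis 𝒜 I) (h : D.DarbouxBasis) (R : D.RelaxedInductionData)
    (hc : (SuperPoly.calculus (ghost e.deg (Fin 3))).IsCubic D (structureConst κ T)
      (D.cubicAction e κ T)) :
    prod003 h κ T = restrict e R h.toHomogeneous (Fin 3) (D.cubicAction e κ T) := by
  have h1 : prod003 h κ T = (h.calculus (Fin 3)).tripleProduct (structureConst κ T) := rfl
  have h2 := hc.eq_smul_map (R.isPropagator e h) (isRestriction e h R)
    (h.calculus (Fin 3)).tripleProduct_mem (r := 1) fun a b d => by
      rw [one_mul]
      exact SuperCalculus.third_pderiv_tripleProduct _ hc.swap₁₂ a b d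
  rw [h1, h2, one_smul]

/-- If the diagrams are combinations of constants and a square-zero function, with the supports
prescribed by the degrees, then the effective action has the form of the ansatz. -/
theorem exists_isInd_of_diagrams {τ P : Type*} [Fintype τ] [Fintype P] {e : HomogeneousBasis 𝒜 I}
    {R : D.RelaxedInductionData} {h : HomogeneousBasis D.cohomologyDeg P}
    {S : SuperPoly (ghost e.deg τ)} {w : SuperPoly (ghost h.deg τ)} (hw : w * w = 0)
    {α β : ℕ → ℕ → ℝ} (hβα : ∀ V E, restrict e R h τ ((laplacian e R τ ^ E)
      ((S - D.freeAction e τ) ^ V)) = algebraMap ℝ _ (β V E) + α V E • w)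
    (hβ : ∀ V E, β V E ≠ 0 → 3 * V = 2 * E) (hα : ∀ V E, α V E ≠ 0 → 3 * V = 2 * E + 3)
    (hβ00 : β 0 0 = 1) (hα10 : α 1 0 = 1) :
    ∃ A B : PowerSeries ℝ, IsInd e R h S (ansatz A B w) ∧
      PowerSeries.coeff 0 A = 1 ∧ PowerSeries.coeff 0 B = 0 ∧ PowerSeries.coeff 1 B = 0 ∧
      3 * PowerSeries.coeff 1 A + PowerSeries.coeff 2 B = (2 * β 2 3 - α 3 3) / 96 ∧
      ((∀ V E, 3 * V = 2 * E → α (V + 1) E = ((V : ℝ) + 1) * β V E) → A = 1) := by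
  -- The term without vertices is removed because the logarithm expands in the partition series
  -- minus one.
  let b : PowerSeries (PowerSeries ℝ) := PowerSeries.mk fun V => PowerSeries.mk fun E =>
    if V = 0 then 0 else diagramWeight V E * β V E
  let a : PowerSeries (PowerSeries ℝ) := PowerSeries.mk fun V => PowerSeries.mk fun E =>
    diagramWeight V E * α V E
  have hbc : ∀ V E, PowerSeries.coeff E (PowerSeries.coeff V b) =
      if V = 0 then 0 else diagramWeight V E * β V E := fun V E => by
    rw [PowerSeries.coeff_mk, PowerSeries.coeff_mk]
  have hac : ∀ V E, PowerSeries.coeff E (PowerSeries.coeff V a) =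
      diagramWeight V E * α V E := fun V E => by
    rw [PowerSeries.coeff_mk, PowerSeries.coeff_mk]
  have hb0 : PowerSeries.coeff 0 b = 0 := by
    ext E; rw [hbc, if_pos rfl, map_zero]
  have hb : SupportedOn 0 b := by
    intro V E hVE
    rw [hbc] at hVE
    split_ifs at hVE
    · exact absurd rfl hVE
    · exact hβ V E (right_ne_zero_of_mul hVE)
  have ha : SupportedOn 3 a := by
    intro V E hVE
    rw [hac] at hVE
    exact hα V E (right_ne_zero_of_mul hVE)
  have hlog : ∀ V E, logCoeff e R h S V E =
      algebraMap ℝ _ (logScalar b V E) + logLinear b a V E • w := by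
    refine coeff_formalLog (hw) fun V E => ?_
    have h1 : PowerSeries.coeff E (PowerSeries.coeff V
        (partitionSeries e R h S)) =
        diagramWeight V E • (algebraMap ℝ _ (β V E) + α V E • w) := by
      rw [partitionSeries, PowerSeries.coeff_mk, PowerSeries.coeff_mk, ← hβα, diagramWeight]
    rw [map_sub, map_sub, h1, hbc, hac, smul_add, smul_algebraMap, smul_smul,
      PowerSeries.coeff_one]
    by_cases hV : V = 0
    · subst hV
      have hα0 : α 0 E = 0 := by
        by_contra hne
        have := hα 0 E hne
        omega
      rw [if_pos rfl, if_pos rfl, PowerSeries.coeff_one, hα0, mul_zero, zero_smul, add_zero,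
        add_zero, map_zero]
      by_cases hE : E = 0
      · subst hE
        rw [if_pos rfl, hβ00, show diagramWeight 0 0 * 1 = 1 by norm_num [diagramWeight], map_one,
          sub_self]
      · have hβ0 : β 0 E = 0 := by
          by_contra hne
          have := hβ 0 E hne
          omega
        rw [if_neg hE, hβ0]
        simp
    · rw [if_neg hV, if_neg hV, map_zero, sub_zero]
  have hw10 : diagramWeight 1 0 = 1 := by norm_num [diagramWeight]
  have hw23 : diagramWeight 2 3 = -1 / 96 := by norm_num [diagramWeight, Nat.factorial]
  have hw33 : diagramWeight 3 3 = -1 / 288 := by norm_num [diagramWeight, Nat.factorial]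
  refine ⟨_, _, isInd_ansatz hlog (fun V E => logScalar_support hb)
    (fun V E => logLinear_support hb ha) (logScalar_zero b), ?_, ?_, ?_, ?_, ?_⟩
  · rw [PowerSeries.coeff_mk, logLinear_one, hac, hα10, hw10, mul_one]
  · rw [PowerSeries.coeff_mk, logScalar_zero]
  · rw [PowerSeries.coeff_mk, logScalar_zero]
  -- With the weights above, A⁽¹⁾ = -α₃₃/288 + β₂₃/96 and B⁽²⁾ = -β₂₃/96.
  · rw [PowerSeries.coeff_mk, PowerSeries.coeff_mk, logLinear_three hb hb0 ha,
      logScalar_two hb hb0, hac, hac, hbc, hα10, hw10, hw23, hw33]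
    norm_num
    ring
  · intro hK
    -- Here W occurs only as a bare vertex times vacuum diagrams; the factor V+1 is absorbed by the
    -- factorial in the weight. Taking the logarithm removes the vacuum factor.
    have hX : a = (1 + b) * PowerSeries.X := by
      ext V E
      rcases V with _ | V
      · rw [PowerSeries.coeff_zero_mul_X, hac, map_zero]
        have hα0 : α 0 E = 0 := by
          by_contra hne
          have := hα 0 E hne
          omega
        rw [hα0, mul_zero]
      · rw [PowerSeries.coeff_succ_mul_X, map_add, map_add, hac, hbc]
        by_cases hVE : 3 * V = 2 * E
        · rw [hK V E hVE,
            diagramWeight_succ_mul, PowerSeries.coeff_one]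
          by_cases hV : V = 0
          · subst hV
            obtain rfl : E = 0 := by omega
            rw [if_pos rfl, if_pos rfl, hβ00]
            simp [diagramWeight]
          · rw [if_neg hV, if_neg hV, map_zero, zero_add]
        · have e1 : α (V + 1) E = 0 := by
            by_contra hne
            have := hα _ _ hne
            omega
          have e2 : β V E = 0 := by
            by_contra hne
            exact hVE (hβ _ _ hne)
          rw [e1, e2, mul_zero, mul_zero, ite_self, add_zero, PowerSeries.coeff_one]
          split_ifs with hV
          · rw [PowerSeries.coeff_one, if_neg (by omega)]
          · rw [map_zero]
    ext l
    rw [PowerSeries.coeff_mk, logLinear_of_eq hb0 hX (by omega), PowerSeries.coeff_one]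
    exact if_congr (by omega) rfl rfl

/-- The effective action has the form of the ansatz, and its two-loop combination is determined by
the vacuum diagrams and the trace of the cube of the propagator. -/
theorem exists_isInd {κ : LinearMap.BilinForm ℝ L} {T : Module.Basis (Fin 3) ℝ L}
    (e : HomogeneousBasis 𝒜 I) (h : D.DarbouxBasis) (R : D.RelaxedInductionData)
    (hc : (SuperPoly.calculus (ghost e.deg (Fin 3))).IsCubic D (structureConst κ T)
      (D.cubicAction e κ T)) (hf : structureConst κ T 0 1 2 ≠ 0) {θ : ℝ}
    (hθ : ((SuperPoly.calculus (ghost e.deg (Fin 3))).lap D R.K 1 ^ 3) (D.cubicAction e κ T ^ 2) =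
      algebraMap ℝ _ θ) :
    ∃ A B : PowerSeries ℝ,
      IsInd e R h.toHomogeneous (D.action e κ T) (ansatz A B (prod003 h κ T)) ∧
      PowerSeries.coeff 0 A = 1 ∧ PowerSeries.coeff 0 B = 0 ∧ PowerSeries.coeff 1 B = 0 ∧
      3 * PowerSeries.coeff 1 A + PowerSeries.coeff 2 B = -(θ - 288 * structureConst κ T 0 1 2 ^ 2 *
        D.vtrace e (R.ι (h.basis 1)) (R.K ∘ₗ R.K ∘ₗ R.K)) / 96 ∧
      (R.IsStrict → A = 1) := by
  have hp := R.isPropagator e h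
  have hφ := isRestriction (τ := Fin 3) e h R
  rw [prod003_eq_map e h R hc]
  set φ := restrict e R h.toHomogeneous (Fin 3) with hφdef
  set c := D.cubicAction e κ T with hcdef
  set Λ := (SuperPoly.calculus (ghost e.deg (Fin 3))).lap D R.K 1 with hΛ
  -- Since W is non-zero, the coefficient of each cubic diagram is unique, so the explicit values
  -- can be identified with the chosen ones.
  have hW0 : φ c ≠ 0 := by
    intro h0
    have h1 := hc.third_pderiv_map hp hφ 0 1 2
    rw [h0, map_zero, map_zero, map_zero, ← map_zero (algebraMap ℝ _)] at h1
    exact hf (SuperPoly.algebraMap_injective h1).symm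
  have hex : ∀ V E, ∃ β α : ℝ, φ ((Λ ^ E) (c ^ V)) = algebraMap ℝ _ β + α • φ c ∧
      (β ≠ 0 → 3 * V = 2 * E) ∧ (α ≠ 0 → 3 * V = 2 * E + 3) ∧
      (3 * V = 2 * E → (Λ ^ E) (c ^ V) = algebraMap ℝ _ β) := by
    intro V E
    by_cases h0 : 3 * V = 2 * E
    · obtain ⟨r, hr⟩ := hc.exists_pow_lap_const hp h0
      refine ⟨r, 0, ?_, fun _ => h0, fun h => absurd rfl h, fun _ => hr⟩
      rw [hr, φ.commutes, zero_smul, add_zero]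
    by_cases h3 : 3 * V = 2 * E + 3
    · obtain ⟨r, hr⟩ := hc.exists_map_pow_lap hp hφ hf h3
      refine ⟨0, r, ?_, fun h => absurd rfl h, fun _ => h3, fun h => absurd h h0⟩
      rw [hr, map_zero, zero_add]
    · refine ⟨0, 0, ?_, fun h => absurd rfl h, fun h => absurd rfl h, fun h => absurd h h0⟩
      rw [hc.map_pow_lap_eq_zero hφ hp h0 h3, map_zero, zero_smul, add_zero]
  choose β α hβα hβ hα hβ' using hex
  have hα' : ∀ V E r, 3 * V = 2 * E + 3 → φ ((Λ ^ E) (c ^ V)) = r • φ c → α V E = r := by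
    intro V E r hVE hr
    have h1 := hβα V E
    have h2 : β V E = 0 := by
      by_contra hne
      have := hβ V E hne
      omega
    rw [h2, map_zero, zero_add, hr] at h1
    exact (smul_left_injective ℝ hW0 h1).symm
  have hβ23 : β 2 3 = θ := by
    have h1 := hβ' 2 3 (by norm_num)
    rw [hθ] at h1
    exact (SuperPoly.algebraMap_injective h1).symm
  have hβ00 : β 0 0 = 1 := by
    have h1 := hβ' 0 0 (by norm_num)
    rw [pow_zero, pow_zero, Op.one_apply, ← map_one (algebraMap ℝ _)] at h1
    exact (SuperPoly.algebraMap_injective h1).symm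
  have hα10 : α 1 0 = 1 := hα' 1 0 1 (by norm_num) (by
    rw [pow_zero, pow_one, Op.one_apply, one_smul])
  have hα33 := hα' 3 3 _ (by norm_num) (hc.map_lap_cube hp hφ hθ)
  have hd : ∀ V E, restrict e R h.toHomogeneous (Fin 3) ((laplacian e R (Fin 3) ^ E)
      ((D.action e κ T - D.freeAction e (Fin 3)) ^ V)) = algebraMap ℝ _ (β V E) + α V E • φ c := by
    intro V E
    rw [← hβα, laplacian_pow_apply, action, add_sub_cancel_left]
  obtain ⟨A, B, h1, h2, h3, h4, h5, h6⟩ :=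
    exists_isInd_of_diagrams (hc.map_mul_self hφ) hd hβ hα hβ00 hα10
  refine ⟨A, B, h1, h2, h3, h4, ?_, fun hK => h6 fun V E hVE => ?_⟩
  · rw [h5, hα33, hβ23]; ring
  · exact hα' (V + 1) E _ (by omega)
      (hc.map_pow_lap_succ_of_strict hp hφ hK hVE (hβ' V E hVE))

theorem structureConst_ne_zero {κ : LinearMap.BilinForm ℝ L} {T : Module.Basis (Fin 3) ℝ L}
    (e : HomogeneousBasis 𝒜 I) (hL : ∃ x y : L, ⁅x, y⁆ ≠ 0)
    (hT : ∀ a b, κ (T a) (T b) = if a = b then 1 else 0)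
    (hc : (SuperPoly.calculus (ghost e.deg (Fin 3))).IsCubic D (structureConst κ T)
      (D.cubicAction e κ T)) : structureConst κ T 0 1 2 ≠ 0 := by
  intro h0
  obtain ⟨x, y, hxy⟩ := hL
  exact hxy (lie_eq_zero_of_structureConst hT (fun a b d => by rw [hc.f_eq, h0, zero_mul]) x y)

end DGFrobenius

end AbstractCS

end

theorem proposition9 {C I : Type*} [Ring C] [Algebra ℝ C] (𝒜 : ℕ → Submodule ℝ C)
    [GradedAlgebra 𝒜] [Fintype I] [DecidableEq I]
    -- a finite-dimensional dg Frobenius algebra with a homogeneous basis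
    (D : DGFrobenius 𝒜) (e : HomogeneousBasis 𝒜 I)
    (hB0 : D.betti 0 = 1) (hB1 : D.betti 1 = 0)
    -- an invariant inner product on su(2) with an orthonormal basis
    (κ : LinearMap.BilinForm ℝ su2) (hκ_symm : ∀ x y, κ x y = κ y x)
    (hκ_inv : ∀ x y z, κ x ⁅y, z⁆ = κ ⁅x, y⁆ z)
    (T : Module.Basis (Fin 3) ℝ su2) (hT : ∀ a b, κ (T a) (T b) = if a = b then 1 else 0)
    (h : D.DarbouxBasis) :
    ∃ F₂ : ℝ,
      (∀ R : D.RelaxedInductionData, ∃ A B : PowerSeries ℝ,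
        DGFrobenius.IsInd e R h.toHomogeneous (D.action e κ T)
          (DGFrobenius.ansatz A B (DGFrobenius.prod003 h κ T)) ∧
        PowerSeries.coeff 0 A = 1 ∧ PowerSeries.coeff 0 B = 0 ∧ PowerSeries.coeff 1 B = 0 ∧
        3 * PowerSeries.coeff 1 A + PowerSeries.coeff 2 B = F₂) ∧
      (∀ R : D.RelaxedInductionData, R.IsStrict → ∃ F : PowerSeries ℝ,
        DGFrobenius.IsInd e R h.toHomogeneous (D.action e κ T)
          (DGFrobenius.ansatz 1 F (DGFrobenius.prod003 h κ T)) ∧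
        PowerSeries.coeff 0 F = 0 ∧ PowerSeries.coeff 1 F = 0 ∧ PowerSeries.coeff 2 F = F₂) := by
  have hc := isCubic_cubicAction D e (structureConst_swap₁₂ (T := T) hκ_inv)
    (structureConst_swap₂₃ (κ := κ))
  have hf := DGFrobenius.structureConst_ne_zero e su2_not_abelian hT hc
  suffices H : ∃ F₂ : ℝ, ∀ R : D.RelaxedInductionData, ∃ A B : PowerSeries ℝ,
      DGFrobenius.IsInd e R h.toHomogeneous (D.action e κ T)
        (DGFrobenius.ansatz A B (DGFrobenius.prod003 h κ T)) ∧
      PowerSeries.coeff 0 A = 1 ∧ PowerSeries.coeff 0 B = 0 ∧ PowerSeries.coeff 1 B = 0 ∧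
      3 * PowerSeries.coeff 1 A + PowerSeries.coeff 2 B = F₂ ∧ (R.IsStrict → A = 1) by
    obtain ⟨F₂, H⟩ := H
    refine ⟨F₂, fun R => ?_, fun R hR => ?_⟩
    · obtain ⟨A, B, h1, h2, h3, h4, h5, -⟩ := H R
      exact ⟨A, B, h1, h2, h3, h4, h5⟩
    · obtain ⟨A, B, h1, -, h3, h4, h5, h6⟩ := H R
      obtain rfl := h6 hR
      refine ⟨B, h1, h3, h4, ?_⟩
      rw [← h5, PowerSeries.coeff_one, if_neg one_ne_zero, mul_zero, zero_add]
  -- The invariant is computed from one reference choice of data; without any data the claim is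
  -- vacuous and every number serves.
  rcases isEmpty_or_nonempty D.RelaxedInductionData with hR | ⟨⟨R₀⟩⟩
  · exact ⟨0, fun R => hR.elim R⟩
  obtain ⟨θ₀, hθ₀⟩ := hc.lap_cube_mem_const (R₀.isPropagator e h)
  refine ⟨-(θ₀ - 288 * DGFrobenius.structureConst κ T 0 1 2 ^ 2 *
    D.vtrace e (R₀.ι (h.basis 1)) (R₀.K ∘ₗ R₀.K ∘ₗ R₀.K)) / 96, fun R => ?_⟩
  obtain ⟨θ, hθ⟩ := hc.lap_cube_mem_const (R.isPropagator e h)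
  rw [← hc.two_loop_invariant (R₀.isPropagator e h) (R.isPropagator e h) hθ₀ hθ]
  exact DGFrobenius.exists_isInd e h R hc hf hθ
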